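/- **Conventions.** A Dynkin configuration is a finite set $\Phi$ with a symmetric map $\langle\cdot,\cdot\rangle\colon\Phi\times\Phi\to\{-2,0,1\}$ such that $\langle x,x\rangle=-2$ for all $x$ and $\langle x,y\rangle\in\{0,1\}$ for $x\neq y$; its Dynkin diagram is the graph on $\Phi$ that joins $x$ and $y$ when $\langle x,y\rangle=1$. It is an ADE-configuration if every connected component of the diagram is of type $A_l$ ($l\ge1$), $D_m$ ($m\ge4$) or $E_n$ ($n=6,7,8$); its ADE-type $\tau(\Phi)$ is the formal sum of the types of the components. Let $\mathrm{Aut}(\Phi)$ be the group of permutations of $\Phi$ preserving $\langle\cdot,\cdot\rangle$, and let $\langle\Phi\rangle$ be the free $\mathbb Z$-module on $\Phi$ with the bilinear form extending $\langle\cdot,\cdot\rangle$; for an ADE-configuration it is negative definite. An even overlattice of $\langle\Phi\rangle$ is a submodule $\overline R$ of the dual lattice $\langle\Phi\rangle^\vee\subset\langle\Phi\rangle\otimes\mathbb Q$ that contains $\langle\Phi\rangle$ and on which the form is integer-valued and even. A root is a vector of square-norm $-2$. A root lattice is a lattice generated by its roots; a negative-definite root lattice $R$ has a basis of roots forming an ADE-configuration,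 whose ADE-type is denoted by $\tau(R)$. Let $L_{10}$ be the even unimodular hyperbolic lattice of rank $10$, with basis $E_{10}=\{e_1,\dots,e_{10}\}$ consisting of roots whose Dynkin diagram is the path $e_2 - e_3 - \cdots - e_{10}$ with $e_1$ joined to $e_4$. Let $\mathcal P_{10}$ be the connected component of $\{x\in L_{10}\otimes\mathbb R : \langle x,x\rangle>0\}$ that contains $e_1^\vee+\dots+e_{10}^\vee$ (where $e_i^\vee$ is the dual basis), and let $\mathrm O^+(L_{10})$ be the group of isometries of $L_{10}$ that preserve $\mathcal P_{10}$. Let $\mathcal S$ be the set of all subsets of $E_{10}$ other than $\emptyset$, $E_{10}$ and $\{e_1,\dots,e_9\}$. For $\Sigma\in\mathcal S$, let $\langle\Sigma\rangle\subset L_{10}$ be the sublattice generated by $\Sigma$, and let $$\mathrm{Stab}(\langle\Sigma\rangle,L_{10})=\{g\in\mathrm O^+(L_{10}) : g(\langle\Sigma\rangle)=\langle\Sigma\rangle\}.$$ **Theorem.** Let $\Phi$ be an ADE-configuration with $|\Phi|<10$. Let $\overline R$ be an even overlattice of $\langle\Phi\rangle$ that is a root lattice whose ADE-type is the ADE-type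 of some element of $\mathcal S$, and let $\Sigma\in\mathcal S$ satisfy $\tau(\overline R)=\tau(\Sigma)$. Let $\mathrm{Isom}(\overline R,\langle\Sigma\rangle)$ be the set of isometries from $\overline R$ onto $\langle\Sigma\rangle$, and let $\mathrm{Stab}(\overline R,\Phi)$ be the stabilizer of $\overline R$ in $\mathrm{Aut}(\Phi)$. Then the double coset space $$\mathrm{Stab}(\overline R,\Phi)\backslash\mathrm{Isom}(\overline R,\langle\Sigma\rangle)/\mathrm{Stab}(\langle\Sigma\rangle,L_{10})$$ consists of a single element. -/

import Mathlib

open LinearMap (BilinForm)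

noncomputable section

namespace EnriquesADE

/-! ### Dynkin configurations and their types -/

/-- A Dynkin configuration: a set `V` (finite wherever it matters) with a symmetric map
`V × V → {-2, 0, 1}` that is `-2` exactly on the diagonal. -/
structure DynkinConfig (V : Type*) where
  form : V → V → ℤ
  form_symm : ∀ x y, form x y = form y x
  form_self : ∀ x, form x x = -2
  form_ne : ∀ x y, x ≠ y → form x y = 0 ∨ form x y = 1

/-- The Dynkin diagram: `x` and `y` are joined when `⟨x, y⟩ = 1`. -/
def DynkinConfig.diagram {V : Type*} (D : DynkinConfig V) : SimpleGraph V where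
  Adj x y := D.form x y = 1
  symm := ⟨fun x y h => by rw [D.form_symm]; exact h⟩
  loopless := ⟨fun x h => by rw [D.form_self] at h; norm_num at h⟩

/-- The sub-configuration on a subset. -/
def DynkinConfig.restrict {V : Type*} (D : DynkinConfig V) (s : Set V) : DynkinConfig s where
  form x y := D.form x y
  form_symm x y := D.form_symm x y
  form_self x := D.form_self x
  form_ne x y h := D.form_ne x y (fun h' => h (Subtype.ext h'))

/-- The graph on `0, …, n - 1` consisting of the path `1 — 2 — ⋯ — (n - 1)` and one more edge
that joins `0` to `k`. -/
def branchGraph (n k : ℕ) : SimpleGraph (Fin n) :=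
  SimpleGraph.fromRel fun i j =>
    (1 ≤ i.val ∧ j.val = i.val + 1) ∨ (i.val = 0 ∧ j.val = k)

instance (n k : ℕ) : DecidableRel (branchGraph n k).Adj := fun i j =>
  decidable_of_iff _ (SimpleGraph.fromRel_adj _ i j).symm

/-- The connected Dynkin types `A_l` (`l ≥ 1`), `D_m` (`m ≥ 4`), `E_6`, `E_7`, `E_8`. -/
inductive ConnType where
  | A (l : ℕ) (hl : 1 ≤ l)
  | D (m : ℕ) (hm : 4 ≤ m)
  | E6
  | E7
  | E8

/-- The number of vertices of the diagram of a given type. -/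
def ConnType.rank : ConnType → ℕ
  | .A l _ => l
  | .D m _ => m
  | .E6 => 6
  | .E7 => 7
  | .E8 => 8

/-- The Dynkin diagram of a given type. -/
def ConnType.graph : (T : ConnType) → SimpleGraph (Fin T.rank)
  | .A l _ => SimpleGraph.pathGraph l
  | .D m _ => branchGraph m 2
  | .E6 => branchGraph 6 3
  | .E7 => branchGraph 7 3
  | .E8 => branchGraph 8 3

/-- The connected component `c` of the graph `G` is of type `T`. -/
def ComponentHasType {V : Type*} (G : SimpleGraph V) (c : G.ConnectedComponent)
    (T : ConnType) : Prop :=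
  Nonempty (G.induce c.supp ≃g T.graph)

/-- An ADE-configuration: every connected component of the diagram is of type `A`, `D` or `E`. -/
def DynkinConfig.IsADE {V : Type*} (D : DynkinConfig V) : Prop :=
  ∀ c : D.diagram.ConnectedComponent, ∃ T : ConnType, ComponentHasType D.diagram c T

/-- The ADE-type `τ(Φ)`, the formal sum of the types of the connected components, given by the
multiplicity with which each connected type occurs. -/
def DynkinConfig.adeType {V : Type*} (D : DynkinConfig V) : ConnType → ℕ := fun T =>
  Nat.card {c : D.diagram.ConnectedComponent // ComponentHasType D.diagram c T}

/-- The automorphism group `Aut(Φ)`. -/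
def DynkinConfig.aut {V : Type*} (D : DynkinConfig V) : Subgroup (Equiv.Perm V) where
  carrier := {γ | ∀ x y, D.form (γ x) (γ y) = D.form x y}
  one_mem' x y := rfl
  mul_mem' {a b} ha hb x y := by
    rw [Equiv.Perm.mul_apply, Equiv.Perm.mul_apply, ha, hb]
  inv_mem' {a} ha x y := by
    rw [← ha (a⁻¹ x) (a⁻¹ y)]
    exact congrArg₂ D.form (a.apply_symm_apply x) (a.apply_symm_apply y)

/-! ### The lattice generated by a Dynkin configuration -/

section Lattice

variable {V : Type*} [Fintype V] [DecidableEq V]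

/-- The bilinear form on `K ^ V = ⟨Φ⟩ ⊗ K` for which the standard basis vectors have
the given products. -/
def DynkinConfig.bilin (D : DynkinConfig V) (K : Type*) [CommRing K] : BilinForm K (V → K) :=
  Matrix.toBilin' (Matrix.of fun x y => (D.form x y : K))

/-- The lattice `⟨Φ⟩` inside `⟨Φ⟩ ⊗ ℚ = ℚ ^ V`. -/
def stdLattice (V : Type*) [DecidableEq V] : Submodule ℤ (V → ℚ) :=
  Submodule.span ℤ (Set.range fun x : V => Pi.single x (1 : ℚ))

/-- `M` is an even overlattice of `⟨Φ⟩`: a submodule of the dual lattice `⟨Φ⟩^∨` that contains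
`⟨Φ⟩` and on which the form is integral and even. -/
structure DynkinConfig.IsEvenOverlattice (D : DynkinConfig V) (M : Submodule ℤ (V → ℚ)) :
    Prop where
  le : stdLattice V ≤ M
  le_dual : M ≤ (D.bilin ℚ).dualSubmodule (stdLattice V)
  integral : ∀ x ∈ M, ∀ y ∈ M, ∃ k : ℤ, D.bilin ℚ x y = k
  even : ∀ x ∈ M, ∃ k : ℤ, D.bilin ℚ x x = 2 * k

/-- `M` is a root lattice: it is generated by its vectors of square-norm `-2`. -/
def DynkinConfig.IsRootLattice (D : DynkinConfig V) (M : Submodule ℤ (V → ℚ)) : Prop :=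
  Submodule.span ℤ {r : V → ℚ | r ∈ M ∧ D.bilin ℚ r r = -2} = M

/-- `M` has ADE-type `t`: it has a basis that consists of roots and forms
an ADE-configuration of type `t`. -/
def DynkinConfig.OverlatticeHasType (D : DynkinConfig V) (M : Submodule ℤ (V → ℚ))
    (t : ConnType → ℕ) : Prop :=
  ∃ (n : ℕ) (b : Fin n → V → ℚ) (C : DynkinConfig (Fin n)),
    LinearIndependent ℤ b ∧ Submodule.span ℤ (Set.range b) = M ∧
    (∀ i j, D.bilin ℚ (b i) (b j) = C.form i j) ∧ C.IsADE ∧ C.adeType = t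

end Lattice

/-- The action of a permutation `γ` of `V` on `ℚ ^ V`; it maps the basis vector of `x` to
the basis vector of `γ x`. -/
def permMap {V : Type*} (γ : Equiv.Perm V) : (V → ℚ) ≃ₗ[ℤ] (V → ℚ) :=
  LinearEquiv.funCongrLeft ℤ ℚ γ.symm

theorem permMap_single {V : Type*} [DecidableEq V] (γ : Equiv.Perm V) (x : V) :
    permMap γ (Pi.single x 1) = Pi.single (γ x) 1 := by
  ext y
  simp [permMap, LinearMap.funLeft_apply, Pi.single_apply, Equiv.symm_apply_eq]

theorem permMap_one {V : Type*} : permMap (1 : Equiv.Perm V) = 1 := rfl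

theorem permMap_mul {V : Type*} (a b : Equiv.Perm V) :
    permMap (a * b) = permMap a * permMap b := rfl

/-- The stabilizer, in a group of linear automorphisms of a module, of a submodule. -/
def submoduleStab {M : Type*} [AddCommGroup M] (N : Submodule ℤ M) : Subgroup (M ≃ₗ[ℤ] M) where
  carrier := {g | N.map (g : M →ₗ[ℤ] M) = N}
  one_mem' := Submodule.map_id N
  mul_mem' {a b} ha hb := by
    have h : ((a * b : M ≃ₗ[ℤ] M) : M →ₗ[ℤ] M) = (a : M →ₗ[ℤ] M).comp (b : M →ₗ[ℤ] M) := rfl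
    change N.map ((a * b : M ≃ₗ[ℤ] M) : M →ₗ[ℤ] M) = N
    rw [h, Submodule.map_comp, hb, ha]
  inv_mem' {a} ha := by
    change N.map ((a⁻¹ : M ≃ₗ[ℤ] M) : M →ₗ[ℤ] M) = N
    have h : ((a⁻¹ : M ≃ₗ[ℤ] M) : M →ₗ[ℤ] M).comp (a : M →ₗ[ℤ] M) = LinearMap.id := by
      ext x
      exact a.symm_apply_apply x
    conv_lhs => rw [← show N.map (a : M →ₗ[ℤ] M) = N from ha]
    rw [← Submodule.map_comp, h, Submodule.map_id]

/-- The stabilizer `Stab(M, Φ)` of `M` in `Aut(Φ)`. -/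
def DynkinConfig.stabOverlattice {V : Type*} (D : DynkinConfig V) (M : Submodule ℤ (V → ℚ)) :
    Subgroup (Equiv.Perm V) where
  carrier := {γ | γ ∈ D.aut ∧ permMap γ ∈ submoduleStab M}
  one_mem' := ⟨D.aut.one_mem, by rw [permMap_one]; exact Subgroup.one_mem _⟩
  mul_mem' ha hb := ⟨D.aut.mul_mem ha.1 hb.1, by
    rw [permMap_mul]; exact Subgroup.mul_mem _ ha.2 hb.2⟩
  inv_mem' {a} ha := ⟨D.aut.inv_mem ha.1, by
    have h : permMap a⁻¹ = (permMap a)⁻¹ := by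
      rw [eq_inv_iff_mul_eq_one, ← permMap_mul, inv_mul_cancel, permMap_one]
    rw [h]; exact Subgroup.inv_mem _ ha.2⟩

/-! ### The lattice `L₁₀` -/

/-- The Dynkin configuration `E₁₀`: the path `e₂ — e₃ — ⋯ — e₁₀` with `e₁` joined to `e₄`.
The element `e_{i+1}` has index `i`. -/
def E10 : DynkinConfig (Fin 10) where
  form i j := if i = j then -2 else if (branchGraph 10 3).Adj i j then 1 else 0
  form_symm i j := by simp only [eq_comm (a := i), (branchGraph 10 3).adj_comm i]
  form_self i := by simp
  form_ne i j h := by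
    rw [if_neg h]
    split_ifs
    · exact Or.inr rfl
    · exact Or.inl rfl

/-- The underlying module of the lattice `L₁₀`, with basis `e₁, …, e₁₀`. Its form is
`E10.bilin ℤ`. -/
abbrev L10 : Type := Fin 10 → ℤ

/-- The vector `c₀ = e₁^∨ + ⋯ + e₁₀^∨`, in the basis `e₁, …, e₁₀`. -/
def c0 : L10 := ![115, 76, 153, 231, 195, 160, 126, 93, 61, 30]

/-- The coordinates of `c₀` are the right ones: `⟨c₀, e_i⟩ = 1` for all `i`. -/
theorem c0_mul_e (i : Fin 10) : E10.bilin ℤ c0 (Pi.single i 1) = 1 := by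
  have h : ∀ i : Fin 10, ∑ j, c0 j * E10.form j i = 1 := by decide
  refine Eq.trans ?_ (h i)
  rw [DynkinConfig.bilin, Matrix.toBilin'_apply]
  simp [Pi.single_apply]

/-- The positive cone `P₁₀`: the connected component that contains `c₀` of the set of
vectors of positive square-norm in `L₁₀ ⊗ ℝ`. -/
def posCone : Set (Fin 10 → ℝ) :=
  connectedComponentIn {x | 0 < E10.bilin ℝ x x} (fun i => (c0 i : ℝ))

/-- The `ℝ`-linear extension of an endomorphism of `L₁₀`. -/
def realExt (g : L10 →ₗ[ℤ] L10) : (Fin 10 → ℝ) →ₗ[ℝ] (Fin 10 → ℝ) :=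
  Matrix.toLin' ((LinearMap.toMatrix' g).map (Int.castRingHom ℝ))

theorem realExt_id : realExt LinearMap.id = LinearMap.id := by
  rw [realExt, LinearMap.toMatrix'_id, Matrix.map_one _ (map_zero _) (map_one _),
    Matrix.toLin'_one]

theorem realExt_comp (a b : L10 →ₗ[ℤ] L10) :
    realExt (a.comp b) = (realExt a).comp (realExt b) := by
  rw [realExt, LinearMap.toMatrix'_comp, Matrix.map_mul, Matrix.toLin'_mul]
  rfl

/-- The group `O⁺(L₁₀)` of isometries of `L₁₀` that preserve the positive cone. -/
def OPlus : Subgroup (L10 ≃ₗ[ℤ] L10) where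
  carrier := {g | (∀ x y, E10.bilin ℤ (g x) (g y) = E10.bilin ℤ x y) ∧
    realExt (g : L10 →ₗ[ℤ] L10) '' posCone = posCone}
  one_mem' := ⟨fun _ _ => rfl, by
    change realExt LinearMap.id '' posCone = posCone
    rw [realExt_id]; exact Set.image_id _⟩
  mul_mem' {a b} ha hb := ⟨fun x y => by
      rw [LinearEquiv.mul_apply, LinearEquiv.mul_apply, ha.1, hb.1], by
    change realExt ((a : L10 →ₗ[ℤ] L10).comp (b : L10 →ₗ[ℤ] L10)) '' posCone = posCone
    rw [realExt_comp, LinearMap.coe_comp, Set.image_comp, hb.2, ha.2]⟩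
  inv_mem' {a} ha := ⟨fun x y => by
      rw [← ha.1 (a⁻¹ x) (a⁻¹ y)]
      exact congrArg₂ (fun u v => E10.bilin ℤ u v) (a.apply_symm_apply x) (a.apply_symm_apply y),
    by
      have h : ((a⁻¹ : L10 ≃ₗ[ℤ] L10) : L10 →ₗ[ℤ] L10).comp (a : L10 →ₗ[ℤ] L10)
          = LinearMap.id := by
        apply LinearMap.ext
        intro x
        exact a.symm_apply_apply x
      conv_lhs => rw [← ha.2]
      rw [← Set.image_comp, ← LinearMap.coe_comp, ← realExt_comp, h, realExt_id]
      exact Set.image_id _⟩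

/-- The set `S` of all subsets of `E₁₀` other than `∅`, `E₁₀` and `{e₁, …, e₉}`. -/
def admissibleSubsets : Set (Set (Fin 10)) :=
  {s | s ≠ ∅ ∧ s ≠ Set.univ ∧ s ≠ {i | i ≠ 9}}

/-- The sublattice `⟨Σ⟩` of `L₁₀` generated by a subset `Σ` of `E₁₀`. -/
def gen (s : Set (Fin 10)) : Submodule ℤ L10 :=
  Submodule.span ℤ ((fun i => Pi.single i (1 : ℤ)) '' s)

/-- The stabilizer `Stab(⟨Σ⟩, L₁₀)` of `⟨Σ⟩` in `O⁺(L₁₀)`. -/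
def stabGen (s : Set (Fin 10)) : Subgroup (L10 ≃ₗ[ℤ] L10) := OPlus ⊓ submoduleStab (gen s)

/-! ### The double coset space -/

section DoubleCoset

variable {V : Type*} [Fintype V] [DecidableEq V]

/-- Condition (♯): `M` is a root lattice whose ADE-type is the type of a member of `S`. -/
def DynkinConfig.Sharp (D : DynkinConfig V) (M : Submodule ℤ (V → ℚ)) : Prop :=
  D.IsRootLattice M ∧
    ∃ s ∈ admissibleSubsets, D.OverlatticeHasType M (E10.restrict s).adeType

/-- The pair of orbits `([M], [Σ])` belongs to `I_Φ`: `M` is an even overlattice of `⟨Φ⟩` that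
satisfies (♯), and `Σ` is a member of `S` with `τ(M) = τ(Σ)`. -/
structure DynkinConfig.IsAdmissiblePair (D : DynkinConfig V) (M : Submodule ℤ (V → ℚ))
    (s : Set (Fin 10)) : Prop where
  overlattice : D.IsEvenOverlattice M
  mem : s ∈ admissibleSubsets
  sharp : D.Sharp M
  type_eq : D.OverlatticeHasType M (E10.restrict s).adeType

/-- The set `Isom(M, ⟨Σ⟩)` of isometries from `M` onto `⟨Σ⟩`. -/
def DynkinConfig.Isom (D : DynkinConfig V) (M : Submodule ℤ (V → ℚ)) (s : Set (Fin 10)) : Type _ :=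
  {φ : M ≃ₗ[ℤ] gen s //
    ∀ x y : M, ((E10.bilin ℤ (φ x : L10) (φ y : L10) : ℤ) : ℚ) = D.bilin ℚ x y}

/-- Two isometries `φ, ψ : M → ⟨Σ⟩` lie in the same double coset when
`ψ = g ∘ φ ∘ γ` for some `γ ∈ Stab(M, Φ)` and `g ∈ Stab(⟨Σ⟩, L₁₀)`. -/
def DynkinConfig.SameDoubleCoset (D : DynkinConfig V) (M : Submodule ℤ (V → ℚ))
    (s : Set (Fin 10)) (φ ψ : D.Isom M s) : Prop :=
  ∃ γ ∈ D.stabOverlattice M, ∃ g ∈ stabGen s,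
    ∀ x y : M, (y : V → ℚ) = permMap γ x → (ψ.1 x : L10) = g (φ.1 y : L10)

/-- An automorphism of a module that stabilizes a submodule maps it to itself. -/
theorem mem_of_mem_submoduleStab {M : Type*} [AddCommGroup M] {N : Submodule ℤ M}
    {g : M ≃ₗ[ℤ] M} (hg : g ∈ submoduleStab N) {x : M} (hx : x ∈ N) : g x ∈ N := by
  have h : N.map (g : M →ₗ[ℤ] M) = N := hg
  rw [← h]
  exact Submodule.mem_map_of_mem hx

/-- Lying in the same double coset is an equivalence relation. -/
def DynkinConfig.doubleCosetSetoid (D : DynkinConfig V) (M : Submodule ℤ (V → ℚ))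
    (s : Set (Fin 10)) : Setoid (D.Isom M s) where
  r := D.SameDoubleCoset M s
  iseqv := by
    refine ⟨fun φ => ⟨1, Subgroup.one_mem _, 1, Subgroup.one_mem _, ?_⟩, ?_, ?_⟩
    · intro x y hxy
      have : y = x := Subtype.ext (by rw [hxy, permMap_one]; rfl)
      rw [this]; rfl
    · rintro φ ψ ⟨γ, hγ, g, hg, h⟩
      refine ⟨γ⁻¹, Subgroup.inv_mem _ hγ, g⁻¹, Subgroup.inv_mem _ hg, fun x y hxy => ?_⟩
      have hx : (x : V → ℚ) = permMap γ y := by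
        have e : permMap γ (permMap γ⁻¹ (x : V → ℚ)) = (x : V → ℚ) := by
          rw [← LinearEquiv.mul_apply, ← permMap_mul, mul_inv_cancel, permMap_one]; rfl
        rw [hxy, e]
      rw [h y x hx]
      exact (g.symm_apply_apply _).symm
    · rintro φ ψ χ ⟨γ, hγ, g, hg, h⟩ ⟨γ', hγ', g', hg', h'⟩
      refine ⟨γ * γ', Subgroup.mul_mem _ hγ hγ', g' * g, Subgroup.mul_mem _ hg' hg,
        fun x z hxz => ?_⟩
      have hy : permMap γ' (x : V → ℚ) ∈ M := mem_of_mem_submoduleStab hγ'.2 x.2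
      rw [h' x ⟨_, hy⟩ rfl, h ⟨_, hy⟩ z (by rw [hxz, permMap_mul]; rfl)]
      rfl

/-- The double coset space `Stab(M, Φ) \ Isom(M, ⟨Σ⟩) / Stab(⟨Σ⟩, L₁₀)`. -/
def DynkinConfig.Emb (D : DynkinConfig V) (M : Submodule ℤ (V → ℚ)) (s : Set (Fin 10)) : Type _ :=
  Quotient (D.doubleCosetSetoid M s)

end DoubleCoset

end EnriquesADE

end

/-!
The theorem says that two isometries `φ, ψ : M → ⟨Σ⟩` always differ by an isometry of `M` induced by
a permutation of `Φ` and by an isometry of `L₁₀` that preserves `⟨Σ⟩`. The reflections in the roots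
of `⟨Σ⟩` extend to `L₁₀` and preserve the positive cone (`reflection_mem_OPlus`), so the whole Weyl
group `W` of `⟨Σ⟩` comes from `Stab(⟨Σ⟩, L₁₀)` (`exists_stabGen_extension`), and it turns out that
nothing else is needed from `L₁₀`. Write `p` for the image of `Φ` under `φ`: a linearly independent
family of roots of `⟨Σ⟩` that spans a sublattice of finite index and is a simple system for it. What
has to be shown is that every isometry `α` of `⟨Σ⟩` maps `p` to a `W`-conjugate of `p`
(`Realizable`, `realizable_of_isIsometry`).

* `W` acts transitively on the simple systems of a given negative-definite lattice
  (`exists_weyl_map`). Hence, up to `W`, the isometry `α` permutes the basis `Σ` of `⟨Σ⟩`.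
* The diagram of `Σ` is part of the diagram `E₁₀`, which has one branch vertex, so at most one
  component is not of type `A`, and `α` preserves this component.
* A root lattice of type `A` has no proper root sublattice of finite index
  (`mem_span_of_typeA`). Therefore the part of `p` outside the exceptional component is a simple
  system of the sum of the `A`-components, and transitivity applies to it.
* For an exceptional component of type `D`, its roots being `±ε_i ± ε_j`, two members of `p` have
  the form `±ε_i + ε_j` and `±ε_i - ε_j`, up to sign (`exists_pair_of_typeD`). Exchanging them is
  the sign change of a coordinate, and this is conjugate under `W` to the automorphism of the
  diagram that exchanges two short arms (`realizable_signChange`). These automorphisms generate all,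
  including the three-fold symmetry of `D₄` (`realizable_of_typeD`).
* For type `E₆` the automorphism of the diagram is `-w` with `w ∈ W` (`exists_weyl_neg_flipE6`), and
  `-p` is conjugate to `p` by transitivity in the lattice spanned by `p` (`realizable_of_neg`).
  The diagrams `E₇` and `E₈` have no symmetries.

That an isometry exists at all follows since configurations of the same ADE-type have isomorphic
diagrams (`nonempty_iso_of_adeType_eq`), once the members of `S` are known to be ADE-configurations
(`isADE_restrict_E10`). The lattice `⟨Σ⟩` is negative definite because it is orthogonal to
a vector `e_k^∨` of positive square-norm (`bilin_self_neg`).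
-/

open LinearMap (BilinForm)

namespace EnriquesADE

/-! ### Reflections and Weyl groups of negative-definite even lattices -/

section Weyl

variable {N : Type*} [AddCommGroup N]

/-- An even negative-definite lattice (not assumed to be finitely generated). -/
structure IsNegDefEven (B : BilinForm ℤ N) : Prop where
  symm : ∀ x y, B x y = B y x
  even : ∀ x, Even (B x x)
  neg : ∀ x, x ≠ 0 → B x x < 0

/-- A linear automorphism that preserves the form `B`. -/
def IsIsometry (B : BilinForm ℤ N) (α : N ≃ₗ[ℤ] N) : Prop :=
  ∀ x y, B (α x) (α y) = B x y

/-- The Weyl group of a submodule `P`, acting on the whole lattice: it is generated by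
the reflections in the roots that lie in `P`. -/
def weyl (B : BilinForm ℤ N) (P : Submodule ℤ N) : Subgroup (N ≃ₗ[ℤ] N) :=
  Subgroup.closure {s | ∃ r ∈ P, B r r = -2 ∧ ∀ x, s x = x + B x r • r}

/-- A simple family: linearly independent roots with pairwise non-negative products (the form is
negative definite, so this is the usual obtuseness condition). -/
structure IsSimpleFamily (B : BilinForm ℤ N) {ι : Type*} (b : ι → N) : Prop where
  li : LinearIndependent ℤ b
  self : ∀ i, B (b i) (b i) = -2
  nonneg : ∀ i j, i ≠ j → 0 ≤ B (b i) (b j)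

variable {B : BilinForm ℤ N}

theorem IsIsometry.mul {α β : N ≃ₗ[ℤ] N} (hα : IsIsometry B α) (hβ : IsIsometry B β) :
    IsIsometry B (α * β) := fun x y => by
  rw [LinearEquiv.mul_apply, LinearEquiv.mul_apply, hα, hβ]

theorem IsIsometry.inv {α : N ≃ₗ[ℤ] N} (hα : IsIsometry B α) : IsIsometry B α⁻¹ := fun x y => by
  rw [← hα (α⁻¹ x) (α⁻¹ y)]
  exact congrArg₂ (fun u v => B u v) (α.apply_symm_apply x) (α.apply_symm_apply y)

theorem weyl_mono {P Q : Submodule ℤ N} (h : P ≤ Q) : weyl B P ≤ weyl B Q := by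
  apply Subgroup.closure_mono
  rintro s ⟨r, hr, h1, h2⟩
  exact ⟨r, h hr, h1, h2⟩

theorem exists_reflection (P : Submodule ℤ N) {r : N} (hr : r ∈ P) (h2 : B r r = -2) :
    ∃ s ∈ weyl B P, ∀ x, s x = x + B x r • r := by
  have hf : (-(B.flip r)) r = 2 := by simp [h2]
  refine ⟨Module.reflection hf, Subgroup.subset_closure ⟨r, hr, h2, ?_⟩, ?_⟩ <;>
    intro x <;> simp [Module.reflection_apply]

theorem isIsometry_of_mem_weyl (hB : IsNegDefEven B) {P : Submodule ℤ N} {w : N ≃ₗ[ℤ] N}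
    (hw : w ∈ weyl B P) : IsIsometry B w := by
  induction hw using Subgroup.closure_induction with
  | mem s hs =>
    obtain ⟨r, -, h2, hs⟩ := hs
    intro x y
    rw [hs, hs]
    simp only [map_add, map_smul, LinearMap.add_apply, LinearMap.smul_apply, smul_eq_mul, h2,
      hB.symm r y]
    ring
  | one => exact fun _ _ => rfl
  | mul a b _ _ ha hb => exact ha.mul hb
  | inv a _ ha => exact ha.inv

theorem sub_mem_of_mem_weyl {P : Submodule ℤ N} {w : N ≃ₗ[ℤ] N}
    (hw : w ∈ weyl B P) (x : N) : w x - x ∈ P := by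
  induction hw using Subgroup.closure_induction generalizing x with
  | mem s hs =>
    obtain ⟨r, hr, -, hs⟩ := hs
    rw [hs, add_sub_cancel_left]
    exact P.smul_mem _ hr
  | one => simp
  | mul a b _ _ ha hb =>
    have := P.add_mem (ha (b x)) (hb x)
    rwa [sub_add_sub_cancel] at this
  | inv a _ ha =>
    have := P.neg_mem (ha (a⁻¹ x))
    rwa [neg_sub, show a (a⁻¹ x) = x from a.apply_symm_apply x] at this

theorem apply_mem_of_mem_weyl {P : Submodule ℤ N} {w : N ≃ₗ[ℤ] N}
    (hw : w ∈ weyl B P) {x : N} (hx : x ∈ P) : w x ∈ P := by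
  simpa using P.add_mem (sub_mem_of_mem_weyl hw x) hx

theorem apply_eq_self_of_mem_weyl {P : Submodule ℤ N} {w : N ≃ₗ[ℤ] N}
    (hw : w ∈ weyl B P) {x : N} (hx : ∀ y ∈ P, B x y = 0) : w x = x := by
  induction hw using Subgroup.closure_induction with
  | mem s hs =>
    obtain ⟨r, hr, -, hs⟩ := hs
    rw [hs, hx r hr, zero_smul, add_zero]
  | one => rfl
  | mul a b _ _ ha hb => rw [LinearEquiv.mul_apply, hb, ha]
  | inv a _ ha =>
    conv_lhs => rw [← ha]
    exact a.symm_apply_apply x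

theorem conj_mem_weyl {α : N ≃ₗ[ℤ] N} (hα : IsIsometry B α) {w : N ≃ₗ[ℤ] N}
    (hw : w ∈ weyl B ⊤) : α * w * α⁻¹ ∈ weyl B ⊤ := by
  induction hw using Subgroup.closure_induction with
  | mem s hs =>
    obtain ⟨r, -, h2, hs⟩ := hs
    refine Subgroup.subset_closure ⟨α r, trivial, by rw [hα, h2], fun x => ?_⟩
    rw [LinearEquiv.mul_apply, LinearEquiv.mul_apply, hs, map_add, map_smul,
      ← hα (α⁻¹ x) r, show α (α⁻¹ x) = x from α.apply_symm_apply x]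
  | one => simp
  | mul a b _ _ ha hb =>
    have := mul_mem ha hb
    rwa [show α * a * α⁻¹ * (α * b * α⁻¹) = α * (a * b) * α⁻¹ by group] at this
  | inv a _ ha =>
    have := inv_mem ha
    rwa [show (α * a * α⁻¹)⁻¹ = α * a⁻¹ * α⁻¹ by group] at this

theorem IsNegDefEven.eq_zero (hB : IsNegDefEven B) {x : N} (h : B x x = 0) : x = 0 := by
  by_contra hx
  exact absurd (hB.neg x hx) (by omega)

theorem IsNegDefEven.nonpos (hB : IsNegDefEven B) (x : N) : B x x ≤ 0 := by
  by_cases hx : x = 0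
  · simp [hx]
  · exact (hB.neg x hx).le

theorem IsNegDefEven.le_neg_two (hB : IsNegDefEven B) {x : N} (hx : x ≠ 0) : B x x ≤ -2 := by
  obtain ⟨k, hk⟩ := hB.even x
  have := hB.neg x hx
  omega

theorem IsNegDefEven.eq_zero_of_smul (hB : IsNegDefEven B) {k : ℤ} (hk : k ≠ 0) {x : N}
    (h : k • x = 0) : x = 0 := by
  apply hB.eq_zero
  have : k * B x x = 0 := by rw [← smul_eq_mul, ← LinearMap.smul_apply, ← map_smul, h]; simp
  simpa [hk] using this

/-- A root that is a sum of two vectors with non-positive product is one of the summands: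
otherwise its square-norm would be at most `-4`. -/
theorem IsNegDefEven.eq_zero_or_eq_zero (hB : IsNegDefEven B) {r x y : N} (hr : B r r = -2)
    (h : r = x + y) (hxy : B x y ≤ 0) : x = 0 ∨ y = 0 := by
  by_contra! hne
  have h1 := hB.le_neg_two hne.1
  have h2 := hB.le_neg_two hne.2
  rw [h] at hr
  simp only [map_add, LinearMap.add_apply, hB.symm y x] at hr
  omega

theorem IsSimpleFamily.map {ι : Type*} {b : ι → N} (hb : IsSimpleFamily B b) {α : N ≃ₗ[ℤ] N}
    (hα : IsIsometry B α) : IsSimpleFamily B (fun i => α (b i)) where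
  li := hb.li.map' (α : N →ₗ[ℤ] N) (LinearMap.ker_eq_bot.2 α.injective)
  self i := by rw [hα, hb.self]
  nonneg i j h := by rw [hα]; exact hb.nonneg i j h

variable {ι ι' : Type*} [Fintype ι] [Fintype ι']

/-- The coefficients of a root with respect to a simple family have the same sign. -/
theorem IsSimpleFamily.root_sign (hB : IsNegDefEven B) {b : ι → N} (hb : IsSimpleFamily B b)
    {r : N} (hr : r ∈ Submodule.span ℤ (Set.range b)) (h2 : B r r = -2) :
    (∃ n : ι → ℕ, r = ∑ i, (n i : ℤ) • b i) ∨ (∃ n : ι → ℕ, r = -∑ i, (n i : ℤ) • b i) := by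
  obtain ⟨c, rfl⟩ := Submodule.mem_span_range_iff_exists_fun ℤ |>.1 hr
  set x := ∑ i, ((c i).toNat : ℤ) • b i with hx
  set y := ∑ i, ((-c i).toNat : ℤ) • b i with hy
  have hsum : ∑ i, c i • b i = x + (-y) := by
    rw [hx, hy, ← Finset.sum_neg_distrib, ← Finset.sum_add_distrib]
    refine Finset.sum_congr rfl fun i _ => ?_
    rw [← neg_smul, ← add_smul]
    congr 1
    omega
  have hxy : B x (-y) ≤ 0 := by
    rw [map_neg, hx, hy, neg_nonpos]
    simp only [map_sum, LinearMap.sum_apply, map_smul, LinearMap.smul_apply, smul_eq_mul,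
      Finset.mul_sum]
    refine Finset.sum_nonneg fun i _ => Finset.sum_nonneg fun j _ => ?_
    by_cases hij : j = i
    · subst hij
      rcases le_total (c j) 0 with h | h
      · rw [Int.toNat_of_nonpos h]; simp
      · rw [Int.toNat_of_nonpos (z := -c j) (by omega)]; simp
    · have := hb.nonneg j i hij
      positivity
  rcases hB.eq_zero_or_eq_zero h2 hsum hxy with h | h
  · right
    exact ⟨_, by rw [hsum, h, zero_add]⟩
  · left
    exact ⟨_, by rw [hsum, h, add_zero]⟩

/-- A vector in the span of a simple family that has the same positive product with each of its
members; its existence is the non-degeneracy of the Gram matrix. -/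
theorem IsSimpleFamily.exists_dominant (hB : IsNegDefEven B) {b : ι → N}
    (hb : IsSimpleFamily B b) :
    ∃ ρ ∈ Submodule.span ℤ (Set.range b), ∃ d : ℤ, 0 < d ∧ ∀ i, B ρ (b i) = d := by
  classical
  let G : Matrix ι ι ℤ := Matrix.of fun i j => B (b j) (b i)
  have hG : G.det ≠ 0 := by
    intro h0
    obtain ⟨v, hv, hGv⟩ := Matrix.exists_mulVec_eq_zero_iff.2 h0
    have hy : ∀ i, B (∑ j, v j • b j) (b i) = 0 := fun i => by
      have := congrFun hGv i
      simp only [Matrix.mulVec, dotProduct, G, Matrix.of_apply, Pi.zero_apply] at this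
      simp only [map_sum, LinearMap.sum_apply, map_smul, LinearMap.smul_apply, smul_eq_mul]
      rw [← this]
      exact Finset.sum_congr rfl fun j _ => mul_comm _ _
    have h1 : ∑ j, v j • b j = 0 := by
      apply hB.eq_zero
      conv_lhs => rw [map_sum]
      refine Finset.sum_eq_zero fun i _ => ?_
      rw [map_smul, hy, smul_zero]
    exact hv (funext fun i => Fintype.linearIndependent_iff.1 hb.li v h1 i)
  have key : ∀ ε : ℤ, ∃ ρ ∈ Submodule.span ℤ (Set.range b), ∀ i, B ρ (b i) = ε * G.det := by
    intro ε
    refine ⟨ε • ∑ j, (G.adjugate.mulVec 1) j • b j, ?_, fun i => ?_⟩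
    · exact Submodule.smul_mem _ _ (Submodule.sum_mem _ fun j _ =>
        Submodule.smul_mem _ _ (Submodule.subset_span ⟨j, rfl⟩))
    · have h1 : (G.mulVec (G.adjugate.mulVec 1)) i = G.det := by
        rw [Matrix.mulVec_mulVec, Matrix.mul_adjugate, Matrix.smul_mulVec, Matrix.one_mulVec]
        simp
      rw [map_smul, LinearMap.smul_apply, smul_eq_mul, ← h1]
      congr 1
      simp only [map_sum, LinearMap.sum_apply, map_smul, LinearMap.smul_apply, smul_eq_mul]
      exact Finset.sum_congr rfl fun j _ => mul_comm _ _
  rcases lt_or_gt_of_ne hG with h | h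
  · obtain ⟨ρ, h1, h2⟩ := key (-1)
    exact ⟨ρ, h1, _, by omega, h2⟩
  · obtain ⟨ρ, h1, h2⟩ := key 1
    exact ⟨ρ, h1, _, by omega, h2⟩

/-- The Weyl group acts transitively on the simple families with a given span. The element is
found by moving a dominant vector of the first family into the chamber of the second one, which
happens when its product with a dominant vector of the second family is minimal. -/
theorem exists_weyl_map (hB : IsNegDefEven B) {b : ι → N} {b' : ι' → N}
    (hb : IsSimpleFamily B b) (hb' : IsSimpleFamily B b')
    (hspan : Submodule.span ℤ (Set.range b) = Submodule.span ℤ (Set.range b')) :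
    ∃ w ∈ weyl B (Submodule.span ℤ (Set.range b)), ∀ i, ∃ j, w (b i) = b' j := by
  set P := Submodule.span ℤ (Set.range b) with hP
  have hbP : ∀ i, b i ∈ P := fun i => Submodule.subset_span ⟨i, rfl⟩
  have hb'P : ∀ i, b' i ∈ P := fun i => hspan ▸ Submodule.subset_span ⟨i, rfl⟩
  obtain ⟨ρ, hρ, d, hd, hρb⟩ := hb.exists_dominant hB
  obtain ⟨ρ', hρ', d', hd', hρb'⟩ := hb'.exists_dominant hB
  -- `w` is chosen so that `⟨ρ, w ρ'⟩` is minimal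
  obtain ⟨m, ⟨w, hw, hm⟩, hmin⟩ := Int.exists_least_of_bdd
    (P := fun z => ∃ w ∈ weyl B P, B ρ (w ρ') = z) (by
      obtain ⟨k, hk⟩ : ∃ k : ℤ, k = B ρ ρ + B ρ' ρ' := ⟨_, rfl⟩
      refine ⟨k, ?_⟩
      rintro z ⟨w, hw, rfl⟩
      have h1 := hB.nonpos (ρ - w ρ')
      have h2 := hB.nonpos (ρ + w ρ')
      simp only [map_add, map_sub, LinearMap.add_apply, LinearMap.sub_apply,
        isIsometry_of_mem_weyl hB hw ρ' ρ', hB.symm (w ρ') ρ] at h1 h2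
      have h3 := hB.nonpos ρ
      have h4 := hB.nonpos ρ'
      omega) ⟨_, 1, one_mem _, rfl⟩
  have hwi := isIsometry_of_mem_weyl hB hw
  -- `w⁻¹ (b i)` is a non-negative combination of `b'`
  have hge : ∀ i, 0 ≤ B (w ρ') (b i) := fun i => by
    obtain ⟨s, hs, hsx⟩ := exists_reflection P (hbP i) (hb.self i)
    have := hmin _ ⟨s * w, mul_mem hs hw, rfl⟩
    rw [LinearEquiv.mul_apply, hsx, map_add, map_smul, smul_eq_mul, hρb, ← hm] at this
    by_contra! hneg
    have h3 : B (w ρ') (b i) * d < 0 := mul_neg_of_neg_of_pos hneg hd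
    omega
  have hpos : ∀ i, ∃ n : ι' → ℕ, w⁻¹ (b i) = ∑ j, (n j : ℤ) • b' j := fun i => by
    have hwr : B (w⁻¹ (b i)) (w⁻¹ (b i)) = -2 := by rw [hwi.inv, hb.self]
    have hmem : w⁻¹ (b i) ∈ Submodule.span ℤ (Set.range b') :=
      hspan ▸ apply_mem_of_mem_weyl (inv_mem hw) (hbP i)
    rcases hb'.root_sign hB hmem hwr with h | ⟨n, hn⟩
    · exact h
    · exfalso
      have h1 : B ρ' (w⁻¹ (b i)) = -∑ j, (n j : ℤ) * d' := by
        rw [hn]; simp [hρb']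
      have h2 := hge i
      rw [← hwi.inv, show w⁻¹ (w ρ') = ρ' from w.symm_apply_apply ρ', h1,
        ← Finset.sum_mul] at h2
      have h3 : ∑ j, (n j : ℤ) = 0 := by
        have : 0 ≤ ∑ j, (n j : ℤ) := Finset.sum_nonneg fun j _ => by positivity
        nlinarith
      have h4 : ∀ j, (n j : ℤ) = 0 := fun j =>
        (Finset.sum_eq_zero_iff_of_nonneg fun j _ => by positivity).1 h3 j (Finset.mem_univ j)
      rw [hn] at hwr
      simp [h4] at hwr
  -- the members of `b'` are non-negative combinations of `w⁻¹ b`, so have positive product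
  -- with `w⁻¹ ρ`
  have hht : ∀ j, d ≤ B ρ (w (b' j)) := fun j => by
    have hwr : B (w (b' j)) (w (b' j)) = -2 := by rw [hwi, hb'.self]
    have hmem : w (b' j) ∈ Submodule.span ℤ (Set.range b) := apply_mem_of_mem_weyl hw (hb'P j)
    rcases hb.root_sign hB hmem hwr with ⟨n, hn⟩ | ⟨n, hn⟩
    · have h1 : B ρ (w (b' j)) = (∑ i, (n i : ℤ)) * d := by
        rw [hn, Finset.sum_mul]; simp [hρb]
      have h3 : 0 ≤ ∑ j, (n j : ℤ) := Finset.sum_nonneg fun j _ => by positivity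
      rcases h3.eq_or_lt with h3 | h3
      · have h4 : ∀ j, (n j : ℤ) = 0 := fun j =>
          (Finset.sum_eq_zero_iff_of_nonneg fun j _ => by positivity).1 h3.symm j
            (Finset.mem_univ j)
        rw [hn] at hwr
        simp [h4] at hwr
      · rw [h1]; nlinarith
    · exfalso
      have h5 : b' j = -∑ i, (n i : ℤ) • w⁻¹ (b i) := by
        have := congrArg (fun z => w⁻¹ z) hn
        rw [show w⁻¹ (w (b' j)) = b' j from w.symm_apply_apply _] at this
        simpa using this
      have h6 : B ρ' (b' j) ≤ 0 := by
        rw [h5]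
        simp only [map_neg, map_sum, map_smul, smul_eq_mul, neg_nonpos]
        refine Finset.sum_nonneg fun i _ => mul_nonneg (by positivity) ?_
        obtain ⟨n', hn'⟩ := hpos i
        rw [hn']
        simp only [map_sum, map_smul, smul_eq_mul, hρb']
        exact Finset.sum_nonneg fun i _ => by positivity
      rw [hρb'] at h6
      omega
  refine ⟨w⁻¹, inv_mem hw, fun i => ?_⟩
  obtain ⟨n, hn⟩ := hpos i
  have hbi : b i = ∑ j, (n j : ℤ) • w (b' j) := by
    have := congrArg w hn
    rw [show w (w⁻¹ (b i)) = b i from w.apply_symm_apply _] at this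
    simpa using this
  have h7 : (∑ j, (n j : ℤ)) * d ≤ d := by
    calc _ = ∑ j, (n j : ℤ) * d := Finset.sum_mul ..
      _ ≤ ∑ j, (n j : ℤ) * B ρ (w (b' j)) :=
          Finset.sum_le_sum fun j _ => mul_le_mul_of_nonneg_left (hht j) (by positivity)
      _ = B ρ (b i) := by rw [hbi]; simp
      _ = d := hρb i
  have h8 : ∑ j, (n j : ℤ) ≤ 1 := by nlinarith
  obtain ⟨j, hj⟩ : ∃ j, n j ≠ 0 := by
    by_contra! h
    have := hb.self i
    rw [hbi] at this
    simp [h] at this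
  classical
  have h9 := Finset.add_sum_erase Finset.univ (fun j => (n j : ℤ)) (Finset.mem_univ j)
  have h10 : 0 ≤ ∑ j ∈ Finset.univ.erase j, (n j : ℤ) :=
    Finset.sum_nonneg fun j _ => by positivity
  have h11 : n j = 1 ∧ ∑ j ∈ Finset.univ.erase j, (n j : ℤ) = 0 := by omega
  have h12 := (Finset.sum_eq_zero_iff_of_nonneg fun j _ => by positivity).1 h11.2
  refine ⟨j, ?_⟩
  rw [hn, ← Finset.add_sum_erase _ _ (Finset.mem_univ j), Finset.sum_eq_zero, h11.1]
  · simp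
  · intro k hk
    rw [h12 k hk, zero_smul]

end Weyl

/-! ### Root families of finite index and the isometries they realize -/

section Realizable

variable {N : Type*} [AddCommGroup N] {B : BilinForm ℤ N} {V : Type*} {p : V → N}

/-- The isometry `α` is realized by the family `p`: up to the Weyl group of the whole lattice
it permutes the members of `p`. -/
def Realizable (B : BilinForm ℤ N) (p : V → N) (α : N ≃ₗ[ℤ] N) : Prop :=
  ∃ w ∈ weyl B ⊤, ∀ x, ∃ y, w (α (p x)) = p y

/-- Realizable isometries compose, because the Weyl group is normalized by every isometry. -/
theorem Realizable.mul {α β : N ≃ₗ[ℤ] N} (hα : Realizable B p α) (hαi : IsIsometry B α)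
    (hβ : Realizable B p β) : Realizable B p (α * β) := by
  obtain ⟨w, hw, h⟩ := hα
  obtain ⟨w', hw', h'⟩ := hβ
  refine ⟨w * (α * w' * α⁻¹), mul_mem hw (conj_mem_weyl hαi hw'), fun x => ?_⟩
  obtain ⟨y, hy⟩ := h' x
  obtain ⟨z, hz⟩ := h y
  refine ⟨z, ?_⟩
  simp only [LinearEquiv.mul_apply]
  rw [show α⁻¹ (α (β (p x))) = β (p x) from α.symm_apply_apply _, hy, hz]

theorem Realizable.of_mem_weyl {w : N ≃ₗ[ℤ] N} (hw : w ∈ weyl B ⊤) : Realizable B p w :=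
  ⟨w⁻¹, inv_mem hw, fun x => ⟨x, w.symm_apply_apply _⟩⟩

theorem Realizable.of_permutes {α : N ≃ₗ[ℤ] N} (h : ∀ x, ∃ y, α (p x) = p y) :
    Realizable B p α := ⟨1, one_mem _, h⟩

theorem Realizable.of_weyl_mul {w α : N ≃ₗ[ℤ] N} (hw : w ∈ weyl B ⊤)
    (h : Realizable B p (w * α)) : Realizable B p α := by
  obtain ⟨w', hw', h'⟩ := h
  exact ⟨w' * w, mul_mem hw' hw, h'⟩

/-- The family `p` spans a subgroup of finite index (in the weak sense that every vector has
a non-zero multiple in its span). -/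
def SpansRationally (p : V → N) : Prop :=
  ∀ y, ∃ k : ℤ, k ≠ 0 ∧ k • y ∈ Submodule.span ℤ (Set.range p)

/-- Every vector of the lattice is the sum of a vector of `M` and a vector orthogonal to `M`, that
is, `M` is an orthogonal direct summand. -/
def IsOrthSummand (B : BilinForm ℤ N) (M : Submodule ℤ N) : Prop :=
  ∀ y, ∃ y₁ ∈ M, ∃ y₂, y = y₁ + y₂ ∧ ∀ z ∈ M, B y₂ z = 0

/-- A root is not a sum of two nonzero orthogonal vectors, so it lies in a given orthogonal summand
or is orthogonal to it. -/
theorem IsOrthSummand.root_mem_or (hB : IsNegDefEven B) {M : Submodule ℤ N}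
    (hM : IsOrthSummand B M) {r : N} (hr : B r r = -2) : r ∈ M ∨ ∀ z ∈ M, B r z = 0 := by
  obtain ⟨y₁, h1, y₂, rfl, h2⟩ := hM r
  rcases hB.eq_zero_or_eq_zero hr rfl (by rw [hB.symm, h2 _ h1]) with h | h
  · right; simpa [h] using h2
  · left; simpa [h] using h1

/-- The members of `p` that lie in an orthogonal summand `M` span it rationally. -/
theorem SpansRationally.smul_mem_span (hB : IsNegDefEven B) (hp : SpansRationally p)
    {M : Submodule ℤ N} (hsplit : ∀ x, p x ∈ M ∨ ∀ z ∈ M, B (p x) z = 0) {y : N} (hy : y ∈ M) :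
    ∃ k : ℤ, k ≠ 0 ∧ k • y ∈ Submodule.span ℤ (Set.range fun x : {x // p x ∈ M} => p x) := by
  have key : ∀ u ∈ Submodule.span ℤ (Set.range p),
      ∃ u₁ ∈ Submodule.span ℤ (Set.range fun x : {x // p x ∈ M} => p x),
        ∀ z ∈ M, B (u - u₁) z = 0 := by
    intro u hu
    induction hu using Submodule.span_induction with
    | mem u hu =>
      obtain ⟨x, rfl⟩ := hu
      rcases hsplit x with h | h
      · exact ⟨p x, Submodule.subset_span ⟨⟨x, h⟩, rfl⟩, by simp⟩
      · exact ⟨0, zero_mem _, by simpa using h⟩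
    | zero => exact ⟨0, zero_mem _, by simp⟩
    | add u v _ _ hu hv =>
      obtain ⟨u₁, hu1, hu2⟩ := hu
      obtain ⟨v₁, hv1, hv2⟩ := hv
      refine ⟨u₁ + v₁, add_mem hu1 hv1, fun z hz => ?_⟩
      rw [add_sub_add_comm, map_add, LinearMap.add_apply, hu2 z hz, hv2 z hz, add_zero]
    | smul c u _ hu =>
      obtain ⟨u₁, hu1, hu2⟩ := hu
      refine ⟨c • u₁, Submodule.smul_mem _ _ hu1, fun z hz => ?_⟩
      rw [← smul_sub, map_smul, LinearMap.smul_apply, hu2 z hz, smul_zero]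
  obtain ⟨k, hk, hmem⟩ := hp y
  obtain ⟨u₁, hu1, hu2⟩ := key _ hmem
  have hle : Submodule.span ℤ (Set.range fun x : {x // p x ∈ M} => p x) ≤ M := by
    rw [Submodule.span_le]
    rintro _ ⟨x, rfl⟩
    exact x.2
  have h0 : k • y - u₁ = 0 :=
    hB.eq_zero (hu2 _ (M.sub_mem (M.smul_mem _ hy) (hle hu1)))
  refine ⟨k, hk, ?_⟩
  rwa [sub_eq_zero.1 h0]

/-! ### Coordinates in which the form is minus the standard scalar product -/

/-- `E` gives coordinates on the orthogonal summand `M`: it vanishes on the orthogonal complement,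
and on `M` the form is minus the standard scalar product of the coordinates. -/
structure IsCoordinates (B : BilinForm ℤ N) (M : Submodule ℤ N) {κ : Type*} [Fintype κ]
    (E : N →ₗ[ℤ] κ → ℤ) : Prop where
  form : ∀ y, ∀ z ∈ M, B y z = -(E y ⬝ᵥ E z)
  orth : ∀ y, (∀ z ∈ M, B y z = 0) → E y = 0

variable {κ : Type*} [Fintype κ] {M : Submodule ℤ N} {E : N →ₗ[ℤ] κ → ℤ}

theorem IsCoordinates.inj (hB : IsNegDefEven B) (hE : IsCoordinates B M E) {y z : N}
    (hy : y ∈ M) (hz : z ∈ M) (h : E y = E z) : y = z := by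
  rw [← sub_eq_zero]
  apply hB.eq_zero
  rw [hE.form _ _ (M.sub_mem hy hz), map_sub, h, sub_self]
  simp

theorem isOrthSummand_span {ι τ : Type*} (b : Module.Basis ι ℤ N) (k : τ → ι)
    (h0 : ∀ i, i ∉ Set.range k → ∀ t, B (b i) (b (k t)) = 0) :
    IsOrthSummand B (Submodule.span ℤ (Set.range fun t => b (k t))) := by
  intro y
  induction b.mem_span y using Submodule.span_induction with
  | mem y hy =>
    obtain ⟨i, rfl⟩ := hy
    by_cases hi : i ∈ Set.range k
    · obtain ⟨t, rfl⟩ := hi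
      exact ⟨_, Submodule.subset_span ⟨t, rfl⟩, 0, by simp, by simp⟩
    · refine ⟨0, zero_mem _, b i, by simp, fun z hz => ?_⟩
      induction hz using Submodule.span_induction with
      | mem z hz => obtain ⟨t, rfl⟩ := hz; exact h0 i hi t
      | zero => simp
      | add u v _ _ hu hv => rw [map_add, hu, hv, add_zero]
      | smul c u _ hu => rw [map_smul, hu, smul_zero]
  | zero => exact ⟨0, zero_mem _, 0, by simp, by simp⟩
  | add u v _ _ hu hv =>
    obtain ⟨u₁, hu1, u₂, hu2, hu3⟩ := hu
    obtain ⟨v₁, hv1, v₂, hv2, hv3⟩ := hv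
    refine ⟨u₁ + v₁, add_mem hu1 hv1, u₂ + v₂, by rw [hu2, hv2]; abel, fun z hz => ?_⟩
    rw [map_add, LinearMap.add_apply, hu3 z hz, hv3 z hz, add_zero]
  | smul c u _ hu =>
    obtain ⟨u₁, hu1, u₂, hu2, hu3⟩ := hu
    refine ⟨c • u₁, Submodule.smul_mem _ _ hu1, c • u₂, by rw [← smul_add, ← hu2],
      fun z hz => ?_⟩
    rw [map_smul, LinearMap.smul_apply, hu3 z hz, smul_zero]

/-- Coordinates exist on the span of a part of a basis as soon as the Gram matrix of that part is
minus the Gram matrix of given integer vectors `v t`; the remaining basis vectors, which are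
orthogonal to that part, get coordinates `0`. -/
theorem exists_coordinates {ι τ : Type*} (b : Module.Basis ι ℤ N)
    {k : τ → ι} (hk : Function.Injective k) (v : τ → κ → ℤ)
    (hv : ∀ s t, B (b (k s)) (b (k t)) = -(v s ⬝ᵥ v t))
    (h0 : ∀ i, i ∉ Set.range k → ∀ t, B (b i) (b (k t)) = 0) :
    ∃ E : N →ₗ[ℤ] κ → ℤ, (∀ t, E (b (k t)) = v t) ∧
      IsCoordinates B (Submodule.span ℤ (Set.range fun t => b (k t))) E := by
  classical
  let E : N →ₗ[ℤ] κ → ℤ := b.constr ℤ (Function.extend k v 0)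
  have hE1 : ∀ t, E (b (k t)) = v t := fun t => by
    rw [Module.Basis.constr_basis, hk.extend_apply]
  have hE0 : ∀ i, i ∉ Set.range k → E (b i) = 0 := fun i hi => by
    rw [Module.Basis.constr_basis, Function.extend_apply' _ _ _ (by simpa using hi)]
    rfl
  have hform : ∀ y, ∀ z ∈ Submodule.span ℤ (Set.range fun t => b (k t)),
      B y z = -(E y ⬝ᵥ E z) := by
    intro y z hz
    induction hz using Submodule.span_induction with
    | mem z hz =>
      obtain ⟨t, rfl⟩ := hz
      induction b.mem_span y using Submodule.span_induction with
      | mem y hy =>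
        obtain ⟨i, rfl⟩ := hy
        by_cases hi : i ∈ Set.range k
        · obtain ⟨s, rfl⟩ := hi
          simp only
          rw [hE1, hE1, hv]
        · simp only
          rw [h0 i hi, hE0 i hi]; simp
      | zero => simp
      | add u v _ _ hu hv =>
        rw [map_add, LinearMap.add_apply, hu, hv, map_add, add_dotProduct]; ring
      | smul c u _ hu =>
        rw [map_smul, LinearMap.smul_apply, hu, map_smul, smul_dotProduct, smul_neg]
    | zero => simp
    | add u v _ _ hu hv => rw [map_add, hu, hv, map_add, dotProduct_add]; ring
    | smul c u _ hu => rw [map_smul, hu, map_smul, dotProduct_smul, smul_neg]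
  refine ⟨E, hE1, hform, fun y hy => ?_⟩
  -- only the component of `y` in `M` contributes to `E y`
  have hsq : E y ⬝ᵥ E y = 0 := by
    have key : ∀ y, ∃ z ∈ Submodule.span ℤ (Set.range fun t => b (k t)), E y = E z := by
      intro y
      induction b.mem_span y using Submodule.span_induction with
      | mem y hy =>
        obtain ⟨i, rfl⟩ := hy
        by_cases hi : i ∈ Set.range k
        · obtain ⟨t, rfl⟩ := hi
          exact ⟨_, Submodule.subset_span ⟨t, rfl⟩, rfl⟩
        · exact ⟨0, zero_mem _, by rw [hE0 i hi, map_zero]⟩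
      | zero => exact ⟨0, zero_mem _, rfl⟩
      | add u v _ _ hu hv =>
        obtain ⟨u', h1, h2⟩ := hu
        obtain ⟨v', h3, h4⟩ := hv
        exact ⟨u' + v', add_mem h1 h3, by rw [map_add, map_add, h2, h4]⟩
      | smul c u _ hu =>
        obtain ⟨u', h1, h2⟩ := hu
        exact ⟨c • u', Submodule.smul_mem _ _ h1, by rw [map_smul, map_smul, h2]⟩
    obtain ⟨z, hz, hyz⟩ := key y
    have := hform y z hz
    rw [hy z hz, ← hyz] at this
    omega
  exact dotProduct_self_eq_zero.1 hsq

omit [Fintype κ] in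
theorem sq_eq_one_of_ne_zero_of_le {z : ℤ} (h0 : z ≠ 0) (h : z * z ≤ 2) : z = 1 ∨ z = -1 := by
  have h1 : z ≤ 1 := by nlinarith
  have h2 : -1 ≤ z := by nlinarith
  omega

/-- An integral vector of square-norm `2` has exactly two non-zero coordinates, which
are `±1`. -/
theorem exists_support_of_norm_two {z : κ → ℤ} (hz : z ⬝ᵥ z = 2) {i : κ} (hi : z i ≠ 0) :
    ∃ j, j ≠ i ∧ (z i = 1 ∨ z i = -1) ∧ (z j = 1 ∨ z j = -1) ∧
      ∀ k, k ≠ i → k ≠ j → z k = 0 := by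
  classical
  have hnn : ∀ k, 0 ≤ z k * z k := fun k => mul_self_nonneg _
  have h1 := Finset.add_sum_erase Finset.univ (fun k => z k * z k) (Finset.mem_univ i)
  rw [show ∑ k, z k * z k = 2 from hz] at h1
  have h2 : 0 ≤ ∑ k ∈ Finset.univ.erase i, z k * z k := Finset.sum_nonneg fun k _ => hnn k
  have hi1 := sq_eq_one_of_ne_zero_of_le hi (by omega)
  have h3 : ∑ k ∈ Finset.univ.erase i, z k * z k = 1 := by
    rcases hi1 with h | h <;> simp only [h] at h1 <;> omega
  obtain ⟨j, hj, hj0⟩ := Finset.exists_ne_zero_of_sum_ne_zero (by rw [h3]; exact one_ne_zero)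
  have h4 := Finset.add_sum_erase _ (fun k => z k * z k) hj
  rw [h3] at h4
  have h5 : 0 ≤ ∑ k ∈ (Finset.univ.erase i).erase j, z k * z k :=
    Finset.sum_nonneg fun k _ => hnn k
  have hj1 := sq_eq_one_of_ne_zero_of_le (z := z j) (by rintro h; simp [h] at hj0) (by omega)
  have h6 : ∑ k ∈ (Finset.univ.erase i).erase j, z k * z k = 0 := by
    rcases hj1 with h | h <;> simp only [h] at h4 <;> omega
  refine ⟨j, (Finset.mem_erase.1 hj).1, hi1, hj1, fun k hki hkj => ?_⟩
  have := (Finset.sum_eq_zero_iff_of_nonneg fun k _ => hnn k).1 h6 k (by simp [hki, hkj])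
  exact mul_self_eq_zero.1 this

theorem dotProduct_of_support {z z' : κ → ℤ} {i j : κ} (hij : j ≠ i)
    (h : ∀ k, k ≠ i → k ≠ j → z k = 0) : z ⬝ᵥ z' = z i * z' i + z j * z' j := by
  classical
  rw [dotProduct, Fintype.sum_eq_add i j hij.symm]
  rintro k ⟨h1, h2⟩
  rw [h k h1 h2, zero_mul]

end Realizable

/-! ### Components of type `A` -/

section TypeA

variable {N : Type*} [AddCommGroup N] {B : BilinForm ℤ N} {V : Type*} {p : V → N}
  {M : Submodule ℤ N}

/-- The root lattice `A_l` has no proper root sublattice of finite index. In coordinates its roots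
are the differences `ε_k - ε_j`; if the indices fell into several classes under the relation
`ε_k - ε_j ∈ ⟨p⟩`, the indicator function of a class would give a non-zero functional that
vanishes on `p`. -/
theorem mem_span_of_typeA (hB : IsNegDefEven B) (hroot : ∀ x, B (p x) (p x) = -2)
    (hp : SpansRationally p) (hM : IsOrthSummand B M) {l : ℕ} {E : N →ₗ[ℤ] Fin (l + 1) → ℤ}
    (hE : IsCoordinates B M E) {f : Fin l → N} (hf : Submodule.span ℤ (Set.range f) = M)
    (hEf : ∀ t, E (f t) = Pi.single t.castSucc 1 - Pi.single t.succ 1) (t : Fin l) :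
    f t ∈ Submodule.span ℤ (Set.range fun x : {x // p x ∈ M} => p x) := by
  classical
  set A := Submodule.span ℤ (Set.range fun x : {x // p x ∈ M} => p x) with hA
  have hAM : A ≤ M := by
    rw [hA, Submodule.span_le]
    rintro _ ⟨x, rfl⟩
    exact x.2
  have hfM : ∀ t, f t ∈ M := fun t => hf ▸ Submodule.subset_span ⟨t, rfl⟩
  have hsum : ∀ y ∈ M, ∑ k, E y k = 0 := by
    intro y hy
    rw [← hf] at hy
    induction hy using Submodule.span_induction with
    | mem y hy => obtain ⟨t, rfl⟩ := hy; simp [hEf]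
    | zero => simp
    | add u v _ _ hu hv => simp [Finset.sum_add_distrib, hu, hv]
    | smul c u _ hu => simp [← Finset.mul_sum, hu]
  let rel : Fin (l + 1) → Fin (l + 1) → Prop := fun k j =>
    ∃ u ∈ A, E u = Pi.single k 1 - Pi.single j 1
  have rel_symm : ∀ {k j}, rel k j → rel j k := by
    rintro k j ⟨u, hu, h⟩
    exact ⟨-u, neg_mem hu, by rw [map_neg, h, neg_sub]⟩
  have rel_trans : ∀ {i k j}, rel i k → rel k j → rel i j := by
    rintro i k j ⟨u, hu, h⟩ ⟨v, hv, h'⟩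
    exact ⟨u + v, add_mem hu hv, by rw [map_add, h, h', sub_add_sub_cancel]⟩
  -- a root of `M` is a difference of two related coordinate vectors
  have hpx : ∀ x, p x ∈ M → ∃ k j, E (p x) = Pi.single k 1 - Pi.single j 1 ∧ rel k j := by
    intro x hx
    have h2 : E (p x) ⬝ᵥ E (p x) = 2 := by
      have := hE.form (p x) (p x) hx
      rw [hroot] at this
      omega
    obtain ⟨i, hi⟩ : ∃ i, E (p x) i ≠ 0 := by
      by_contra! h
      rw [show E (p x) = 0 from funext h] at h2
      simp at h2
    obtain ⟨j, hji, h3, h4, h5⟩ := exists_support_of_norm_two h2 hi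
    have h6 := hsum _ hx
    rw [Fintype.sum_eq_add i j hji.symm fun k hk => h5 k hk.1 hk.2] at h6
    have hmem : p x ∈ A := Submodule.subset_span ⟨⟨x, hx⟩, rfl⟩
    have form : ∀ a b : Fin (l + 1), a ≠ b → E (p x) a = 1 → E (p x) b = -1 →
        (∀ k, k ≠ a → k ≠ b → E (p x) k = 0) → E (p x) = Pi.single a 1 - Pi.single b 1 := by
      intro a b hab ha hb h0
      funext k
      by_cases hka : k = a
      · subst hka; simp [ha, hab]
      · by_cases hkb : k = b
        · subst hkb; simp [hb, hka]
        · simp [h0 k hka hkb, hka, hkb]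
    rcases h3 with h3 | h3
    · have := form i j hji.symm h3 (by omega) h5
      exact ⟨i, j, this, _, hmem, this⟩
    · have := form j i hji (by omega) h3 fun k h h' => h5 k h' h
      exact ⟨j, i, this, _, hmem, this⟩
  -- the functional given by the class of `t`
  let χ : Fin (l + 1) → ℤ := fun j => if rel t.castSucc j then 1 else 0
  have hχp : ∀ x, χ ⬝ᵥ E (p x) = 0 := by
    intro x
    rcases hM.root_mem_or hB (hroot x) with h | h
    · obtain ⟨k, j, h1, h2⟩ := hpx x h
      have : χ k = χ j := by
        simp only [χ]
        congr 1
        exact propext ⟨fun h => rel_trans h h2, fun h => rel_trans h (rel_symm h2)⟩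
      rw [h1, dotProduct_sub, dotProduct_single, dotProduct_single, this, sub_self]
    · rw [hE.orth _ h, dotProduct_zero]
  have hχ : ∀ y, χ ⬝ᵥ E y = 0 := by
    intro y
    obtain ⟨k, hk, hy⟩ := hp y
    have h0 : ∀ u ∈ Submodule.span ℤ (Set.range p), χ ⬝ᵥ E u = 0 := by
      intro u hu
      induction hu using Submodule.span_induction with
      | mem u hu => obtain ⟨x, rfl⟩ := hu; exact hχp x
      | zero => simp
      | add u v _ _ hu hv => rw [map_add, dotProduct_add, hu, hv, add_zero]
      | smul c u _ hu => rw [map_smul, dotProduct_smul, hu, smul_zero]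
    have := h0 _ hy
    rw [map_smul, dotProduct_smul, smul_eq_mul] at this
    simpa [hk] using this
  have h1 := hχ (f t)
  rw [hEf, dotProduct_sub, dotProduct_single, dotProduct_single] at h1
  have h2 : rel t.castSucc t.castSucc := ⟨0, zero_mem _, by simp⟩
  have h3 : rel t.castSucc t.succ := by
    by_contra h
    simp [χ, h2, h] at h1
  obtain ⟨u, hu, h4⟩ := h3
  rwa [hE.inj hB (hfM t) (hAM hu) (by rw [hEf, h4])]

end TypeA

/-! ### Components of type `D` -/

section TypeD

variable {N : Type*} [AddCommGroup N] {B : BilinForm ℤ N} {V : Type*} [Finite V] {p : V → N}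
  {M : Submodule ℤ N} {κ : Type*} [Fintype κ] [DecidableEq κ] {E : N →ₗ[ℤ] κ → ℤ}

/-- In a lattice of vectors with even coordinate sum (a lattice of type `D`), a simple family
of roots of finite index contains two members that differ by twice a coordinate vector, that is,
two roots `±ε_i ± ε_j` with the same `i` and `j`.

Modulo twice `ℤ^κ` the members of the family are linearly dependent; among the members that occur
in a dependency there is one that is orthogonal to all the others, because the form is negative
definite, and one of the others must share a coordinate, hence both coordinates, with it. -/
theorem exists_pair_of_typeD (hB : IsNegDefEven B) (hps : IsSimpleFamily B p)
    (hp : SpansRationally p) (hsplit : ∀ x, p x ∈ M ∨ ∀ z ∈ M, B (p x) z = 0)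
    (hE : IsCoordinates B M E) (hsum : ∀ y ∈ M, Even (∑ k, E y k)) {o : κ} {u : N} (hu : u ∈ M)
    (hEu : E u = Pi.single o 2) :
    ∃ x x', p x ∈ M ∧ p x' ∈ M ∧ x ≠ x' ∧ ∃ i, E (p x) - E (p x') = Pi.single i 2 := by
  classical
  have : Fintype V := Fintype.ofFinite V
  let q : {x // p x ∈ M} → N := fun x => p x
  have hqs : LinearIndependent ℤ q := hps.li.comp _ Subtype.val_injective
  -- a relation with minimal coefficient of `u`
  have hex : ∃ k : ℕ, 0 < k ∧ ∃ c : {x // p x ∈ M} → ℤ, (k : ℤ) • u = ∑ x, c x • q x := by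
    obtain ⟨k, hk, hmem⟩ := hp.smul_mem_span hB hsplit hu
    obtain ⟨c, hc⟩ := Submodule.mem_span_range_iff_exists_fun ℤ |>.1 hmem
    rcases le_total 0 k with h | h
    · exact ⟨k.toNat, by omega, c, by rw [Int.toNat_of_nonneg h, ← hc]⟩
    · refine ⟨(-k).toNat, by omega, -c, ?_⟩
      rw [Int.toNat_of_nonneg (by omega), neg_smul, ← hc]
      simp [q, Finset.sum_neg_distrib]
  obtain ⟨hk0, c, hc⟩ := Nat.find_spec hex
  set k := Nat.find hex with hk
  have hEc : ∀ i, ∑ x, c x * E (q x) i = if i = o then 2 * (k : ℤ) else 0 := by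
    intro i
    have := congrFun (congrArg E hc) i
    simp only [map_smul, hEu, map_sum, Finset.sum_apply, Pi.smul_apply, smul_eq_mul,
      Pi.single_apply] at this
    rw [← this]
    split_ifs <;> ring
  let T : Finset {x // p x ∈ M} := Finset.univ.filter fun x => Odd (c x)
  have hT : T.Nonempty := by
    by_contra hT
    have heven : ∀ x, ∃ d, c x = 2 * d := fun x => by
      have : ¬ Odd (c x) := fun h => hT ⟨x, by simp [T, h]⟩
      exact (Int.not_odd_iff_even.1 this).two_dvd
    choose d hd using heven
    rcases Nat.even_or_odd' k with ⟨m, hm | hm⟩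
    · -- half of an even relation is a smaller relation
      have h1 : (m : ℤ) • u = ∑ x, d x • q x := by
        rw [← sub_eq_zero]
        apply hB.eq_zero_of_smul (two_ne_zero (α := ℤ))
        rw [smul_sub, Finset.smul_sum, smul_smul, sub_eq_zero]
        simp only [smul_smul, ← hd]
        rw [← hc, hm]
        push_cast
        rfl
      have := Nat.find_min' hex ⟨show 0 < m by omega, d, h1⟩
      omega
    · have h1 : ∀ i, ∑ x, d x * E (q x) i = if i = o then (k : ℤ) else 0 := by
        intro i
        have := hEc i
        simp only [hd, mul_assoc, ← Finset.mul_sum] at this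
        split_ifs at this ⊢ <;> omega
      have h2 : ∑ i, ∑ x, d x * E (q x) i = k := by simp [h1]
      rw [Finset.sum_comm] at h2
      have h3 : Even (k : ℤ) := by
        rw [← h2]
        refine Finset.even_sum _ fun x _ => ?_
        rw [← Finset.mul_sum]
        exact (hsum _ x.2).mul_left _
      rw [hm] at h3
      exact absurd h3 (by simp [parity_simps])
  -- the sum of the members with odd coefficient has even coordinates
  let v : N := ∑ x ∈ T, q x
  have hEv : ∀ i, Even (E v i) := by
    intro i
    have h1 : ∑ x, c x * E (q x) i - E v i =
        ∑ x, (c x - if Odd (c x) then 1 else 0) * E (q x) i := by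
      simp only [v, map_sum, Finset.sum_apply]
      simp only [T, Finset.sum_filter, sub_mul, Finset.sum_sub_distrib, ite_mul, one_mul,
        zero_mul]
    have h2 : Even (∑ x, (c x - if Odd (c x) then 1 else 0) * E (q x) i) := by
      refine Finset.even_sum _ fun x _ => Even.mul_right ?_ _
      split_ifs with h
      · exact h.sub_odd odd_one
      · simpa using h
    have h3 : Even (∑ x, c x * E (q x) i) := by
      rw [hEc]; split_ifs <;> simp
    rw [← h1] at h2
    have := h3.sub h2
    rwa [sub_sub_cancel] at this
  have hBv : ∀ x : {x // p x ∈ M}, Even (B v (q x)) := fun x => by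
    rw [hE.form _ _ x.2, even_neg]
    exact Finset.even_sum _ fun i _ => (hEv i).mul_right _
  have hv0 : v ≠ 0 := by
    intro h0
    obtain ⟨x, hx⟩ := hT
    have := linearIndependent_iff'.1 hqs T (fun _ => 1) (by simpa [v] using h0) x hx
    exact one_ne_zero this
  obtain ⟨a, ha, hav⟩ : ∃ a ∈ T, B v (q a) < 0 := by
    by_contra! h
    have h1 : 0 ≤ B v v := by
      conv_rhs => rw [show B v v = B v (∑ x ∈ T, q x) from rfl, map_sum]
      exact Finset.sum_nonneg h
    have := hB.neg v hv0
    omega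
  -- `a` is orthogonal to the other members of `T`
  have horth : ∀ x ∈ T, x ≠ a → B (q a) (q x) = 0 := by
    have hnn : ∀ x ∈ T.erase a, 0 ≤ B (q x) (q a) := fun x hx =>
      hps.nonneg _ _ fun h => (Finset.mem_erase.1 hx).1 (Subtype.ext h)
    have h1 : B v (q a) = -2 + ∑ x ∈ T.erase a, B (q x) (q a) := by
      simp only [v, map_sum, LinearMap.sum_apply]
      rw [← Finset.add_sum_erase _ _ ha, show B (q a) (q a) = -2 from hps.self _]
    have h2 := Finset.sum_nonneg hnn
    obtain ⟨m, hm⟩ := hBv a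
    have h3 : ∑ x ∈ T.erase a, B (q x) (q a) = 0 := by omega
    intro x hx hxa
    rw [hB.symm]
    exact (Finset.sum_eq_zero_iff_of_nonneg hnn).1 h3 x (by simp [hx, hxa])
  have hnorm : ∀ x : {x // p x ∈ M}, E (q x) ⬝ᵥ E (q x) = 2 := fun x => by
    have := hE.form (q x) (q x) x.2
    rw [show B (q x) (q x) = -2 from hps.self _] at this
    omega
  obtain ⟨i, hi⟩ : ∃ i, E (q a) i ≠ 0 := by
    by_contra! h
    have h2 := hnorm a
    rw [show E (q a) = 0 from funext h] at h2
    simp at h2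
  obtain ⟨j, hji, hai, haj, ha0⟩ := exists_support_of_norm_two (hnorm a) hi
  obtain ⟨b, hb, hba, hbi⟩ : ∃ b ∈ T, b ≠ a ∧ E (q b) i ≠ 0 := by
    by_contra! h
    have h1 : E v i = E (q a) i := by
      simp only [v, map_sum, Finset.sum_apply]
      exact Finset.sum_eq_single_of_mem a ha fun x hx hxa => h x hx hxa
    have h2 := hEv i
    rw [h1] at h2
    rcases hai with h | h <;> rw [h] at h2 <;> revert h2 <;> decide
  obtain ⟨j', hji', hbi', hbj, hb0⟩ := exists_support_of_norm_two (hnorm b) hbi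
  have hdot : E (q a) i * E (q b) i + E (q a) j * E (q b) j = 0 := by
    rw [← dotProduct_of_support hji ha0, ← neg_eq_zero, ← hE.form _ _ b.2]
    exact horth b hb hba
  have hjj : j' = j := by
    by_contra h
    rw [hb0 j hji (Ne.symm h)] at hdot
    rcases hai with h | h <;> rcases hbi' with h' | h' <;> simp [h, h'] at hdot
  subst hjj
  have hab : (a : V) ≠ b := fun h => hba (Subtype.ext h.symm)
  -- according to the signs, `a - b` or `b - a` is twice the coordinate vector of `i` or `j`
  have fin : ∀ (x y : {x // p x ∈ M}) (m : κ), (x : V) ≠ y → E (q x) m - E (q y) m = 2 →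
      (∀ k, k ≠ m → E (q x) k - E (q y) k = 0) →
      ∃ x x', p x ∈ M ∧ p x' ∈ M ∧ x ≠ x' ∧ ∃ i, E (p x) - E (p x') = Pi.single i 2 := by
    intro x y m hxy h1 h2
    refine ⟨x, y, x.2, y.2, hxy, m, funext fun k => ?_⟩
    by_cases hk : k = m
    · subst hk; simpa [q] using h1
    · simpa [hk, q] using h2 k hk
  have hrest : ∀ k, k ≠ i → k ≠ j' → E (q a) k = 0 ∧ E (q b) k = 0 := fun k h h' =>
    ⟨ha0 k h h', hb0 k h h'⟩
  have hcase : ∀ k, k = i ∨ k = j' ∨ (E (q a) k = 0 ∧ E (q b) k = 0) := fun k => by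
    by_cases h : k = i
    · exact Or.inl h
    · by_cases h' : k = j'
      · exact Or.inr (Or.inl h')
      · exact Or.inr (Or.inr (hrest k h h'))
  rcases hai with h1 | h1 <;> rcases hbi' with h2 | h2 <;> rcases haj with h3 | h3 <;>
    rcases hbj with h4 | h4 <;> rw [h1, h2, h3, h4] at hdot <;> norm_num at hdot
  · exact fin a b j' hab (by omega) fun k hk => by rcases hcase k with h | h | h <;> grind
  · exact fin b a j' hab.symm (by omega) fun k hk => by rcases hcase k with h | h | h <;> grind
  · exact fin a b i hab (by omega) fun k hk => by rcases hcase k with h | h | h <;> grind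
  · exact fin a b i hab (by omega) fun k hk => by rcases hcase k with h | h | h <;> grind
  · exact fin b a i hab.symm (by omega) fun k hk => by rcases hcase k with h | h | h <;> grind
  · exact fin b a i hab.symm (by omega) fun k hk => by rcases hcase k with h | h | h <;> grind
  · exact fin a b j' hab (by omega) fun k hk => by rcases hcase k with h | h | h <;> grind
  · exact fin b a j' hab.symm (by omega) fun k hk => by rcases hcase k with h | h | h <;> grind

/-- The reflection that changes the sign of the `o`-th coordinate, which exists on the whole
lattice because twice the coordinate vector belongs to it. -/
theorem exists_signChange (hB : IsNegDefEven B) (hE : IsCoordinates B M E) {o : κ} {u : N}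
    (hu : u ∈ M) (hEu : E u = Pi.single o 2) :
    ∃ σ : N ≃ₗ[ℤ] N, IsIsometry B σ ∧ ∀ y, σ y = y - E y o • u := by
  have hf : ((LinearMap.proj o).comp E) u = 2 := by simp [hEu]
  refine ⟨Module.reflection hf, fun x y => ?_, fun y => by simp [Module.reflection_apply]⟩
  have h1 : ∀ y, B y u = -2 * E y o := fun y => by
    rw [hE.form y u hu, hEu, dotProduct_single]; ring
  simp only [Module.reflection_apply, LinearMap.comp_apply, LinearMap.proj_apply, map_sub,
    map_smul, LinearMap.sub_apply, LinearMap.smul_apply, smul_eq_mul, hB.symm u y, h1, hEu,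
    Pi.single_eq_same]
  ring

/-- Sign changes of one coordinate of a lattice of type `D` are realized: the Weyl group permutes
the coordinates, and for a suitable coordinate the sign change exchanges the two roots
of `exists_pair_of_typeD` and fixes the other members of `p`. -/
theorem realizable_signChange (hB : IsNegDefEven B) (hps : IsSimpleFamily B p)
    (hle : ∀ x y, x ≠ y → B (p x) (p y) ≤ 1)
    (hp : SpansRationally p) (hsplit : ∀ x, p x ∈ M ∨ ∀ z ∈ M, B (p x) z = 0)
    (hE : IsCoordinates B M E) (hsum : ∀ y ∈ M, Even (∑ k, E y k)) {o : κ} {u : N} (hu : u ∈ M)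
    (hEu : E u = Pi.single o 2)
    (hdiff : ∀ i, i ≠ o → ∃ r ∈ M, E r = Pi.single i 1 - Pi.single o 1)
    {π : N ≃ₗ[ℤ] N} (hπu : ∀ y, π y = y - E y o • u) :
    Realizable B p π := by
  obtain ⟨x, x', hx, hx', hxx, i, hi⟩ := exists_pair_of_typeD hB hps hp hsplit hE hsum hu hEu
  set u' := p x - p x' with hu'
  have hu'M : u' ∈ M := M.sub_mem hx hx'
  have hEu' : E u' = Pi.single i 2 := by rw [hu', map_sub, hi]
  obtain ⟨σ, hσi, hσ⟩ := exists_signChange hB hE hu'M hEu'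
  have hBu : ∀ y, B y u' = -2 * E y i := fun y => by
    rw [hE.form y u' hu'M, hEu', dotProduct_single]; ring
  have hσp : Realizable B p σ := by
    refine Realizable.of_permutes fun z => ?_
    have h1 := hBu (p z)
    rw [hu', map_sub] at h1
    have h2 := hps.nonneg x x' hxx
    have h3 := hle x x' hxx
    have h4 := hps.self x
    have h5 := hps.self x'
    have h6 := hB.symm (p x) (p x')
    by_cases hz : z = x
    · subst hz
      have : E (p z) i = 1 := by omega
      exact ⟨x', by rw [hσ, this, hu']; simp⟩
    · by_cases hz' : z = x'
      · subst hz'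
        have : E (p z) i = -1 := by omega
        exact ⟨x, by rw [hσ, this, hu']; simp⟩
      · have h7 := hps.nonneg z x hz
        have h8 := hle z x hz
        have h9 := hps.nonneg z x' hz'
        have h10 := hle z x' hz'
        have : E (p z) i = 0 := by omega
        exact ⟨z, by rw [hσ, this]; simp⟩
  by_cases hio : i = o
  · subst hio
    have huu : u = u' := hE.inj hB hu hu'M (by rw [hEu, hEu'])
    have : π = σ := LinearEquiv.ext fun y => by rw [hπu, hσ, huu]
    rwa [this]
  · obtain ⟨r, hr, hEr⟩ := hdiff i hio
    have hrr : B r r = -2 := by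
      rw [hE.form _ _ hr, hEr]
      simp [dotProduct_sub, hio, Ne.symm hio]
    obtain ⟨s, hs, hsx⟩ := exists_reflection (B := B) ⊤ (Submodule.mem_top (x := r)) hrr
    have hsi := isIsometry_of_mem_weyl hB hs
    have hsu : s u = u' := by
      rw [hsx]
      refine hE.inj hB (M.add_mem hu (M.smul_mem _ hr)) hu'M ?_
      have h1 : B u r = 2 := by
        rw [hE.form _ _ hr, hEr, hEu]
        simp [dotProduct_sub, Ne.symm hio]
      rw [h1, map_add, map_smul, hEr, hEu, hEu']
      funext k
      by_cases hk : k = i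
      · subst hk; simp [hio]
      · by_cases hk' : k = o
        · subst hk'; simp [hk]
        · simp [hk, hk']
    have hconj : π = s⁻¹ * (σ * s) := by
      rw [eq_inv_mul_iff_mul_eq]
      refine LinearEquiv.ext fun y => ?_
      rw [LinearEquiv.mul_apply, LinearEquiv.mul_apply, hπu, hσ, map_sub, map_smul, hsu]
      congr 2
      have h1 := hBu (s y)
      rw [← hsu, hsi, hE.form y u hu, hEu, dotProduct_single] at h1
      omega
    rw [hconj]
    exact (Realizable.of_mem_weyl (inv_mem hs)).mul hsi.inv
      (hσp.mul hσi (Realizable.of_mem_weyl hs))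

end TypeD

/-! ### Automorphisms of the diagrams `D` and `E` -/

section Diagrams

theorem branchGraph_adj {n k : ℕ} {i j : Fin n} :
    (branchGraph n k).Adj i j ↔ i.val ≠ j.val ∧
      (((1 ≤ i.val ∧ j.val = i.val + 1) ∨ (i.val = 0 ∧ j.val = k)) ∨
        ((1 ≤ j.val ∧ i.val = j.val + 1) ∨ (j.val = 0 ∧ i.val = k))) := by
  rw [branchGraph, SimpleGraph.fromRel_adj, ne_eq, Fin.ext_iff]

/-- The sums of a function over the neighbours of the vertices of a graph. -/
def neighborSum {τ : Type*} [Fintype τ] (G : SimpleGraph τ) [DecidableRel G.Adj] (h : τ → ℕ) :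
    τ → ℕ := fun v => ∑ w, if G.Adj v w then h w else 0

theorem neighborSum_apply_iso {τ : Type*} [Fintype τ] {G : SimpleGraph τ} [DecidableRel G.Adj]
    (e : G ≃g G) {h : τ → ℕ} (hh : ∀ v, h (e v) = h v) (v : τ) :
    neighborSum G h (e v) = neighborSum G h v := by
  unfold neighborSum
  rw [← e.toEquiv.sum_comp]
  refine Finset.sum_congr rfl fun w _ => ?_
  have h1 : G.Adj (e v) (e w) ↔ G.Adj v w := e.map_adj_iff
  simp only [RelIso.coe_fn_toEquiv, h1, hh]

/-- The number of walks of length `n` that start at a given vertex. -/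
def walkCount {τ : Type*} [Fintype τ] (G : SimpleGraph τ) [DecidableRel G.Adj] : ℕ → τ → ℕ
  | 0 => 1
  | n + 1 => neighborSum G (walkCount G n)

/-- The numbers of walks that start at a vertex are invariant under automorphisms; in the diagrams
of type `E` those of length two and three almost determine the vertex. -/
theorem walkCount_apply_iso {τ : Type*} [Fintype τ] {G : SimpleGraph τ} [DecidableRel G.Adj]
    (e : G ≃g G) (n : ℕ) (v : τ) : walkCount G n (e v) = walkCount G n v := by
  induction n generalizing v with
  | zero => rfl
  | succ n ih => exact neighborSum_apply_iso e ih v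

theorem iso_E8_apply (e : branchGraph 8 3 ≃g branchGraph 8 3) (v : Fin 8) : e v = v := by
  have key : ∀ v w : Fin 8,
      walkCount (branchGraph 8 3) 3 v = walkCount (branchGraph 8 3) 3 w → v = w := by
    decide +kernel
  exact key _ _ (walkCount_apply_iso e 3 v)

theorem iso_E7_apply (e : branchGraph 7 3 ≃g branchGraph 7 3) (v : Fin 7) : e v = v := by
  have key : ∀ v w : Fin 7,
      walkCount (branchGraph 7 3) 2 v = walkCount (branchGraph 7 3) 2 w →
      walkCount (branchGraph 7 3) 3 v = walkCount (branchGraph 7 3) 3 w → v = w := by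
    decide +kernel
  exact key _ _ (walkCount_apply_iso e 2 v) (walkCount_apply_iso e 3 v)

/-- The non-trivial automorphism of the diagram `E₆`, as a map on vertices. -/
def flipE6 : Fin 6 → Fin 6 := ![0, 5, 4, 3, 2, 1]

theorem iso_E6_apply (e : branchGraph 6 3 ≃g branchGraph 6 3) :
    (∀ v, e v = v) ∨ ∀ v, e v = flipE6 v := by
  have key : ∀ v w : Fin 6,
      walkCount (branchGraph 6 3) 3 v = walkCount (branchGraph 6 3) 3 w →
      v = w ∨ v = flipE6 w := by
    decide +kernel
  have h : ∀ v, e v = v ∨ e v = flipE6 v := fun v => key _ _ (walkCount_apply_iso e 3 v)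
  have h21 : (branchGraph 6 3).Adj (e 2) (e 1) := e.map_adj_iff.2 (by decide)
  have h45 : (branchGraph 6 3).Adj (e 4) (e 5) := e.map_adj_iff.2 (by decide)
  have h24 : e 2 ≠ e 4 := e.injective.ne (by decide)
  have h0 := h 0
  have h3 := h 3
  rcases h 2 with h2 | h2 <;> rcases h 4 with h4 | h4 <;> rcases h 1 with h1 | h1 <;>
    rcases h 5 with h5 | h5 <;> rw [h2, h1] at h21 <;> rw [h4, h5] at h45 <;>
    rw [h2, h4] at h24 <;> first
    | exact absurd h21 (by decide)
    | exact absurd h45 (by decide)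
    | exact absurd rfl h24
    | (left; intro v; fin_cases v <;>
        first | assumption | simpa [flipE6] using h0 | simpa [flipE6] using h3)
    | (right; intro v; fin_cases v <;>
        first | assumption | simpa [flipE6] using h0 | simpa [flipE6] using h3)

theorem eq_of_neighbors_branchGraph {n k : ℕ} {v a b c : Fin n}
    (ha : (branchGraph n k).Adj v a) (hb : (branchGraph n k).Adj v b)
    (hc : (branchGraph n k).Adj v c) (hab : a ≠ b) (hac : a ≠ c) (hbc : b ≠ c) :
    v.val = k := by
  rw [branchGraph_adj] at ha hb hc
  rw [ne_eq, Fin.ext_iff] at hab hac hbc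
  omega

/-- An automorphism of the diagram `D_m` fixes the branch vertex and all vertices beyond it,
and permutes the two short arms — except that for `m = 4` there is a third short arm. -/
theorem iso_D_apply {m : ℕ} (hm : 4 ≤ m) (e : branchGraph m 2 ≃g branchGraph m 2) :
    (m = 4 ∨ (e ⟨3, by omega⟩).val = 3) ∧ (e ⟨2, by omega⟩).val = 2 ∧
    ((e ⟨3, by omega⟩).val = 3 ∨ (e ⟨3, by omega⟩).val = 0 ∨ (e ⟨3, by omega⟩).val = 1) ∧
    ((e ⟨3, by omega⟩).val = 3 →
      (∀ i : Fin m, 2 ≤ i.val → e i = i) ∧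
      (((e ⟨0, by omega⟩).val = 0 ∧ (e ⟨1, by omega⟩).val = 1) ∨
        ((e ⟨0, by omega⟩).val = 1 ∧ (e ⟨1, by omega⟩).val = 0))) := by
  set v0 : Fin m := ⟨0, by omega⟩
  set v1 : Fin m := ⟨1, by omega⟩
  set v2 : Fin m := ⟨2, by omega⟩
  set v3 : Fin m := ⟨3, by omega⟩
  have h20 : (branchGraph m 2).Adj (e v2) (e v0) :=
    e.map_adj_iff.2 (by rw [branchGraph_adj]; simp [v2, v0])
  have h21 : (branchGraph m 2).Adj (e v2) (e v1) :=
    e.map_adj_iff.2 (by rw [branchGraph_adj]; simp [v2, v1])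
  have h23 : (branchGraph m 2).Adj (e v2) (e v3) :=
    e.map_adj_iff.2 (by rw [branchGraph_adj]; simp [v2, v3])
  have n01 : e v0 ≠ e v1 := e.injective.ne (by simp [v0, v1])
  have n03 : e v0 ≠ e v3 := e.injective.ne (by simp [v0, v3])
  have n13 : e v1 ≠ e v3 := e.injective.ne (by simp [v1, v3])
  have h2 := eq_of_neighbors_branchGraph h20 h21 h23 n01 n03 n13
  rw [branchGraph_adj] at h20 h21 h23
  rw [ne_eq, Fin.ext_iff] at n01 n03 n13
  refine ⟨?_, h2, by omega, fun h3 => ⟨?_, by omega⟩⟩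
  · by_contra! h
    let v4 : Fin m := ⟨4, by omega⟩
    have h34 : (branchGraph m 2).Adj (e v3) (e v4) :=
      e.map_adj_iff.2 (by rw [branchGraph_adj]; simp [v3, v4])
    have n24 : e v2 ≠ e v4 := e.injective.ne (by simp [v2, v4])
    rw [branchGraph_adj] at h34
    rw [ne_eq, Fin.ext_iff] at n24
    omega
  · have key : ∀ n, 3 ≤ n → ∀ hn : n < m, (e ⟨n, hn⟩).val = n ∧
        (e ⟨n - 1, by omega⟩).val = n - 1 := by
      intro n hn
      induction n, hn using Nat.le_induction with
      | base => exact fun _ => ⟨h3, h2⟩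
      | succ n hn ih =>
        intro hn'
        obtain ⟨h4, h5⟩ := ih (by omega)
        have ha : (branchGraph m 2).Adj (e ⟨n, by omega⟩) (e ⟨n + 1, hn'⟩) :=
          e.map_adj_iff.2 (by rw [branchGraph_adj]; simp; omega)
        have hne : e ⟨n - 1, by omega⟩ ≠ e ⟨n + 1, hn'⟩ := e.injective.ne (by simp)
        rw [branchGraph_adj] at ha
        rw [ne_eq, Fin.ext_iff] at hne
        refine ⟨by omega, ?_⟩
        simpa using h4
    intro i hi
    rcases hi.eq_or_lt with h | h
    · have : i = v2 := Fin.ext (by simp [v2, ← h])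
      rw [this]
      exact Fin.ext h2
    · exact Fin.ext (key i.val h i.2).1

end Diagrams

/-! ### Realizing the automorphisms of a component of type `D` or `E` -/

section Component

variable {N : Type*} [AddCommGroup N] {B : BilinForm ℤ N} {V : Type*} [Finite V] {p : V → N}

/-- The products of the members of the family `f` are those prescribed by the graph `G`. -/
structure Represents (B : BilinForm ℤ N) {τ : Type*} (f : τ → N) (G : SimpleGraph τ) : Prop where
  self : ∀ s, B (f s) (f s) = -2
  adj : ∀ s t, G.Adj s t → B (f s) (f t) = 1
  not_adj : ∀ s t, s ≠ t → ¬ G.Adj s t → B (f s) (f t) = 0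

theorem Represents.comp_iso {τ τ' : Type*} {f : τ → N} {G : SimpleGraph τ} {G' : SimpleGraph τ'}
    (h : Represents B f G) (g : G' ≃g G) : Represents B (fun t => f (g t)) G' where
  self _ := h.self _
  adj _ _ hst := h.adj _ _ (g.map_adj_iff.2 hst)
  not_adj _ _ hne hst := h.not_adj _ _ (g.injective.ne hne) fun h' => hst (g.map_adj_iff.1 h')

omit [Finite V] in
/-- An isometry that is the identity on the summand `M` and permutes the members of `p` outside
`M` is realized. -/
theorem realizable_of_fixes {M : Submodule ℤ N} {α : N ≃ₗ[ℤ] N} {τ : Type*} {f : τ → N}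
    (hf : Submodule.span ℤ (Set.range f) = M) (hα : ∀ t, α (f t) = f t)
    (hαp : ∀ x, p x ∉ M → ∃ y, p y ∉ M ∧ α (p x) = p y) : Realizable B p α := by
  refine Realizable.of_permutes fun x => ?_
  by_cases hx : p x ∈ M
  · refine ⟨x, ?_⟩
    rw [← hf] at hx
    have h : Set.EqOn (α : N →ₗ[ℤ] N) (LinearMap.id : N →ₗ[ℤ] N) (Set.range f) := by
      rintro _ ⟨t, rfl⟩
      exact hα t
    exact LinearMap.eqOn_span h hx
  · obtain ⟨y, -, hy⟩ := hαp x hx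
    exact ⟨y, hy⟩

/-- The standard coordinates of the simple roots of `D_m`: the vertex `t ≥ 1` of the diagram is
`ε_t - ε_{t-1}`, and the vertex `0` is `ε_0 + ε_1`. -/
def coordD (m : ℕ) (hm : 4 ≤ m) (t : Fin m) : Fin m → ℤ :=
  Pi.single t 1 +
    if t.val = 0 then Pi.single ⟨1, by omega⟩ 1 else -Pi.single ⟨t.val - 1, by omega⟩ 1

theorem coordD_gram {m : ℕ} (hm : 4 ≤ m) {f : Fin m → N} (hf : Represents B f (branchGraph m 2))
    (s t : Fin m) : B (f s) (f t) = -(coordD m hm s ⬝ᵥ coordD m hm t) := by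
  have key : coordD m hm s ⬝ᵥ coordD m hm t =
      if s = t then 2 else if (branchGraph m 2).Adj s t then -1 else 0 := by
    simp only [branchGraph_adj, Fin.ext_iff]
    have hs' : coordD m hm s ⬝ᵥ coordD m hm t = coordD m hm t s +
        if s.val = 0 then coordD m hm t ⟨1, by omega⟩
        else -coordD m hm t ⟨s.val - 1, by omega⟩ := by
      rw [coordD]
      split_ifs <;> simp [add_dotProduct]
    have hval : ∀ (u : Fin m) (n : ℕ) (hn : n < m), coordD m hm u ⟨n, hn⟩ =
        (if n = u.val then 1 else 0) + if u.val = 0 then (if n = 1 then 1 else 0)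
          else -(if n = u.val - 1 then 1 else 0) := by
      intro u n hn
      unfold coordD
      split_ifs <;> simp_all [Pi.single_apply, Fin.ext_iff]
    have hts : coordD m hm t s = _ := hval t s.val s.2
    rw [hs', hts, hval, hval]
    clear hs' hts hval
    split_ifs <;> omega
  rw [key]
  split_ifs with h1 h2
  · subst h1; exact hf.self _
  · exact hf.adj _ _ h2
  · exact hf.not_adj _ _ h1 h2

variable {ι : Type*} {b : Module.Basis ι ℤ N}

/-- The exchange of the two short arms `0` and `1` of a `D_m`-component, fixing everything
orthogonal to the component, is realizable: in the coordinates `coordD` it is the sign change of one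
coordinate. -/
theorem exists_realizable_flip_of_typeD (hB : IsNegDefEven B) (hps : IsSimpleFamily B p)
    (hle : ∀ x y, x ≠ y → B (p x) (p y) ≤ 1) (hp : SpansRationally p) {m : ℕ} (hm : 4 ≤ m)
    {k : Fin m → ι} (hk : Function.Injective k)
    (hrep : Represents B (fun t => b (k t)) (branchGraph m 2))
    (h0 : ∀ i, i ∉ Set.range k → ∀ t, B (b i) (b (k t)) = 0) :
    ∃ π : N ≃ₗ[ℤ] N, IsIsometry B π ∧ Realizable B p π ∧ π * π = 1 ∧
      π (b (k ⟨0, by omega⟩)) = b (k ⟨1, by omega⟩) ∧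
      π (b (k ⟨1, by omega⟩)) = b (k ⟨0, by omega⟩) ∧
      (∀ i : Fin m, 2 ≤ i.val → π (b (k i)) = b (k i)) ∧
      ∀ y, (∀ z ∈ Submodule.span ℤ (Set.range fun t => b (k t)), B y z = 0) → π y = y := by
  obtain ⟨E, hEf, hE⟩ := exists_coordinates (B := B) b hk (coordD m hm)
    (coordD_gram hm hrep) h0
  set M := Submodule.span ℤ (Set.range fun t => b (k t)) with hM
  have hfM : ∀ t, b (k t) ∈ M := fun t => Submodule.subset_span ⟨t, rfl⟩
  have hsplit : ∀ x, p x ∈ M ∨ ∀ z ∈ M, B (p x) z = 0 := fun x =>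
    (isOrthSummand_span b k h0).root_mem_or hB (hps.self x)
  set v0 : Fin m := ⟨0, by omega⟩ with hv0
  set v1 : Fin m := ⟨1, by omega⟩ with hv1
  set u := b (k v0) - b (k v1) with hu
  have huM : u ∈ M := M.sub_mem (hfM _) (hfM _)
  have hEu : E u = Pi.single v0 2 := by
    rw [hu, map_sub, hEf, hEf]
    funext j
    simp only [coordD, hv0, hv1, Pi.sub_apply, Pi.add_apply, if_true, one_ne_zero, if_false,
      Pi.neg_apply, Pi.single_apply, Fin.ext_iff, Nat.sub_self]
    split_ifs <;> omega
  have hsum : ∀ y ∈ M, Even (∑ j, E y j) := by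
    intro y hy
    induction hy using Submodule.span_induction with
    | mem y hy =>
      obtain ⟨t, rfl⟩ := hy
      simp only
      rw [hEf]
      unfold coordD
      split_ifs
      · simp [Finset.sum_add_distrib]
      · simp [Finset.sum_add_distrib]
    | zero => simp
    | add u v _ _ hu hv =>
      simpa [Finset.sum_add_distrib] using hu.add hv
    | smul c u _ hu =>
      simpa [← Finset.mul_sum] using hu.mul_left c
  have hdiff : ∀ n, ∀ hn : n < m, ∃ r ∈ M, E r = Pi.single ⟨n, hn⟩ 1 - Pi.single v0 1 := by
    intro n
    induction n with
    | zero => exact fun _ => ⟨0, zero_mem _, by simp [hv0]⟩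
    | succ n ih =>
      intro hn
      obtain ⟨r, hr, hEr⟩ := ih (by omega)
      refine ⟨r + b (k ⟨n + 1, hn⟩), add_mem hr (hfM _), ?_⟩
      rw [map_add, hEr, hEf, coordD]
      simp only [Nat.add_one_ne_zero, if_false, Nat.add_sub_cancel]
      abel
  obtain ⟨π, hπi, hπ⟩ := exists_signChange hB hE huM hEu
  refine ⟨π, hπi, realizable_signChange hB hps hle hp hsplit hE hsum huM hEu
    (fun i _ => hdiff i.val i.2) hπ, ?_, ?_, ?_, ?_, ?_⟩
  · refine LinearEquiv.ext fun y => ?_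
    rw [LinearEquiv.mul_apply, hπ, hπ, map_sub, map_smul, hEu]
    simp only [Pi.sub_apply, Pi.smul_apply, Pi.single_eq_same, smul_eq_mul, LinearEquiv.coe_one,
      id_eq]
    module
  · have : E (b (k v0)) v0 = 1 := by rw [hEf]; simp [coordD, hv0]
    rw [hπ, this, hu]; simp
  · have : E (b (k v1)) v0 = -1 := by rw [hEf]; simp [coordD, hv0, hv1]
    rw [hπ, this, hu]; simp
  · intro i hi
    have : E (b (k i)) v0 = 0 := by
      rw [hEf]
      simp only [coordD, hv0, Pi.add_apply, Pi.single_apply, Fin.ext_iff]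
      rw [if_neg (by omega), if_neg (by omega)]
      simp only [Pi.neg_apply, Pi.single_apply, Fin.ext_iff]
      rw [if_neg (by omega)]
      rfl
    rw [hπ, this, zero_smul, sub_zero]
  · intro y hy
    rw [hπ, hE.orth y hy]; simp

/-- The composite with a transposition of two short arms of `D_m` reduces an automorphism that
fixes the vertex `3` to the identity. -/
theorem realizable_of_typeD_of_fixes_three (hB : IsNegDefEven B) (hps : IsSimpleFamily B p)
    (hle : ∀ x y, x ≠ y → B (p x) (p y) ≤ 1) (hp : SpansRationally p) {m : ℕ} (hm : 4 ≤ m)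
    {k : Fin m → ι} (hk : Function.Injective k)
    (hrep : Represents B (fun t => b (k t)) (branchGraph m 2))
    (h0 : ∀ i, i ∉ Set.range k → ∀ t, B (b i) (b (k t)) = 0)
    {α : N ≃ₗ[ℤ] N} (e : branchGraph m 2 ≃g branchGraph m 2)
    (hα : ∀ t, α (b (k t)) = b (k (e t)))
    (hαp : ∀ x, p x ∉ Submodule.span ℤ (Set.range fun t => b (k t)) →
      ∃ y, p y ∉ Submodule.span ℤ (Set.range fun t => b (k t)) ∧ α (p x) = p y)
    (h3 : (e ⟨3, by omega⟩).val = 3) : Realizable B p α := by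
  obtain ⟨hi, hcase⟩ := (iso_D_apply hm e).2.2.2 h3
  rcases hcase with ⟨he0, he1⟩ | ⟨he0, he1⟩
  · refine realizable_of_fixes rfl (fun t => ?_) hαp
    have : e t = t := by
      by_cases ht : 2 ≤ t.val
      · exact hi t ht
      · obtain h | h : t.val = 0 ∨ t.val = 1 := by omega
        · rw [show t = ⟨0, by omega⟩ from Fin.ext h]
          exact Fin.ext he0
        · rw [show t = ⟨1, by omega⟩ from Fin.ext h]
          exact Fin.ext he1
    rw [hα, this]
  · obtain ⟨π, hπi, hπp, hππ, hπ0, hπ1, hπ2, hπo⟩ :=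
      exists_realizable_flip_of_typeD hB hps hle hp hm hk hrep h0
    have h : α = π * (π * α) := by rw [← mul_assoc, hππ, one_mul]
    rw [h]
    refine hπp.mul hπi (realizable_of_fixes (f := fun t => b (k t)) rfl (fun t => ?_)
      fun x hx => ?_)
    · rw [LinearEquiv.mul_apply, hα]
      by_cases ht : 2 ≤ t.val
      · rw [hi t ht, hπ2 t ht]
      · obtain h | h : t.val = 0 ∨ t.val = 1 := by omega
        · rw [show t = ⟨0, by omega⟩ from Fin.ext h,
            show e ⟨0, by omega⟩ = ⟨1, by omega⟩ from Fin.ext he0, hπ1]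
        · rw [show t = ⟨1, by omega⟩ from Fin.ext h,
            show e ⟨1, by omega⟩ = ⟨0, by omega⟩ from Fin.ext he1, hπ0]
    · obtain ⟨y, hy, hxy⟩ := hαp x hx
      refine ⟨y, hy, ?_⟩
      rw [LinearEquiv.mul_apply, hxy]
      exact hπo _ (((isOrthSummand_span b k h0).root_mem_or hB (hps.self y)).resolve_left hy)

/-- Isometries that permute the simple roots of a component of type `D` are realized. For `D₄`
the three transpositions of the arms are sign changes in three different coordinate systems. -/
theorem realizable_of_typeD (hB : IsNegDefEven B) (hps : IsSimpleFamily B p)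
    (hle : ∀ x y, x ≠ y → B (p x) (p y) ≤ 1) (hp : SpansRationally p) {m : ℕ} (hm : 4 ≤ m)
    {k : Fin m → ι} (hk : Function.Injective k)
    (hrep : Represents B (fun t => b (k t)) (branchGraph m 2))
    (h0 : ∀ i, i ∉ Set.range k → ∀ t, B (b i) (b (k t)) = 0)
    {α : N ≃ₗ[ℤ] N} (e : branchGraph m 2 ≃g branchGraph m 2)
    (hα : ∀ t, α (b (k t)) = b (k (e t)))
    (hαp : ∀ x, p x ∉ Submodule.span ℤ (Set.range fun t => b (k t)) →
      ∃ y, p y ∉ Submodule.span ℤ (Set.range fun t => b (k t)) ∧ α (p x) = p y) :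
    Realizable B p α := by
  by_cases h3 : (e ⟨3, by omega⟩).val = 3
  · exact realizable_of_typeD_of_fixes_three hB hps hle hp hm hk hrep h0 e hα hαp h3
  obtain ⟨h4, -, h013, -⟩ := iso_D_apply hm e
  obtain rfl : m = 4 := h4.resolve_right h3
  -- `g` relabels the diagram in such a way that the arms `0` and `1` become `t₀` and `3`
  have key : ∀ (t₀ : Fin 4) (g : branchGraph 4 2 ≃g branchGraph 4 2), g 0 = t₀ → g 1 = 3 →
      g 2 = 2 → e 3 = t₀ → ∀ τ : branchGraph 4 2 ≃g branchGraph 4 2, (∀ i, τ i =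
        if i = t₀ then 3 else if i = 3 then t₀ else i) → Realizable B p α := by
    intro t₀ g hg0 hg1 hg2 he3 τ hτ
    have hrange : (Set.range fun t => b (k (g t))) = Set.range fun t => b (k t) :=
      g.surjective.range_comp fun t => b (k t)
    have hg' : ∀ i, i ∉ Set.range (fun t => k (g t)) → i ∉ Set.range k := fun i hi hi' =>
      hi (by rwa [← g.surjective.range_comp k] at hi')
    obtain ⟨π, hπi, hπp, hππ, hπ0, hπ1, hπ2, hπo⟩ :=
      exists_realizable_flip_of_typeD (k := fun t => k (g t)) hB hps hle hp hm
        (hk.comp g.injective) (hrep.comp_iso g) (fun i hi t => h0 i (hg' i hi) (g t))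
    rw [hrange] at hπo
    have e0 : (⟨0, by omega⟩ : Fin 4) = 0 := rfl
    have e1 : (⟨1, by omega⟩ : Fin 4) = 1 := rfl
    rw [e0, e1, hg0, hg1] at hπ0 hπ1
    have hπk : ∀ i, π (b (k i)) = b (k (τ i)) := by
      intro i
      rw [hτ]
      split_ifs with h1 h2
      · rw [h1, hπ0]
      · rw [h2, hπ1]
      · obtain ⟨j, rfl⟩ := g.surjective i
        refine hπ2 j ?_
        by_contra hj
        obtain h | h : j = 0 ∨ j = 1 := by omega
        · rw [h] at h1; exact h1 hg0
        · rw [h] at h2; exact h2 hg1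
    have h : α = π * (π * α) := by rw [← mul_assoc, hππ, one_mul]
    rw [h]
    refine hπp.mul hπi (realizable_of_typeD_of_fixes_three hB hps hle hp hm hk hrep h0
      (e.trans τ) (fun t => ?_) (fun x hx => ?_) ?_)
    · rw [LinearEquiv.mul_apply, hα, hπk]; rfl
    · obtain ⟨y, hy, hxy⟩ := hαp x hx
      refine ⟨y, hy, ?_⟩
      rw [LinearEquiv.mul_apply, hxy]
      exact hπo _ (((isOrthSummand_span b k h0).root_mem_or hB (hps.self y)).resolve_left hy)
    · change (τ (e 3)).val = 3
      rw [he3, hτ, if_pos rfl]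
      rfl
  rcases h013 with h | h | h
  · exact absurd h h3
  · exact key 0 ⟨Equiv.swap 1 3, by decide⟩ rfl rfl rfl (Fin.ext h)
      ⟨Equiv.swap 0 3, by decide⟩ (by decide)
  · exact key 1 ⟨Equiv.swap 0 1 * Equiv.swap 1 3, by decide⟩ rfl rfl rfl (Fin.ext h)
      ⟨Equiv.swap 1 3, by decide⟩ (by decide)

/-- An isometry that is `-1` on the summand `M` and permutes the members of `p` outside `M` is
realized: it maps `p` to a simple family with the same span. -/
theorem realizable_of_neg (hB : IsNegDefEven B) (hps : IsSimpleFamily B p) {M : Submodule ℤ N}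
    {α : N ≃ₗ[ℤ] N} (hαi : IsIsometry B α) (hα : ∀ z ∈ M, α z = -z)
    (hαp : ∀ x, p x ∉ M → ∃ y, p y ∉ M ∧ α (p x) = p y) : Realizable B p α := by
  classical
  have : Fintype V := Fintype.ofFinite V
  have hex : ∀ x, ∃ y, (p x ∈ M → y = x) ∧ (p x ∉ M → p y ∉ M ∧ α (p x) = p y) := fun x => by
    by_cases hx : p x ∈ M
    · exact ⟨x, fun _ => rfl, fun h => absurd hx h⟩
    · obtain ⟨y, hy⟩ := hαp x hx
      exact ⟨y, fun h => absurd h hx, fun _ => hy⟩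
  choose τ hτ using hex
  have hpinj : Function.Injective p := hps.li.injective
  have hinj : Function.Injective τ := by
    intro x y hxy
    by_cases hx : p x ∈ M <;> by_cases hy : p y ∈ M
    · rw [← (hτ x).1 hx, hxy, (hτ y).1 hy]
    · exact absurd (by rwa [← hxy, (hτ x).1 hx]) ((hτ y).2 hy).1
    · exact absurd (by rwa [hxy, (hτ y).1 hy]) ((hτ x).2 hx).1
    · apply hpinj
      apply α.injective
      rw [((hτ x).2 hx).2, ((hτ y).2 hy).2, hxy]
  have hsurj : Function.Surjective τ := Finite.surjective_of_injective hinj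
  have hspan : Submodule.span ℤ (Set.range fun x => α (p x)) =
      Submodule.span ℤ (Set.range p) := by
    apply le_antisymm <;> rw [Submodule.span_le]
    · rintro _ ⟨x, rfl⟩
      by_cases hx : p x ∈ M
      · simp only
        rw [hα _ hx]
        exact neg_mem (Submodule.subset_span ⟨x, rfl⟩)
      · simp only
        rw [((hτ x).2 hx).2]
        exact Submodule.subset_span ⟨τ x, rfl⟩
    · rintro _ ⟨y, rfl⟩
      obtain ⟨x, rfl⟩ := hsurj y
      by_cases hx : p x ∈ M
      · rw [(hτ x).1 hx, ← neg_neg (p x), ← hα _ hx]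
        exact neg_mem (Submodule.subset_span ⟨x, rfl⟩)
      · rw [← ((hτ x).2 hx).2]
        exact Submodule.subset_span ⟨x, rfl⟩
  obtain ⟨w, hw, h⟩ := exists_weyl_map hB (hps.map hαi) hps hspan
  exact ⟨w, weyl_mono le_top hw, h⟩

/-- On the lattice `E₆` minus the diagram automorphism is an element of the Weyl group, namely the
product of the reflections in four orthogonal roots that are fixed by the automorphism. -/
theorem exists_weyl_neg_flipE6 {f : Fin 6 → N} (hf : Represents B f (branchGraph 6 3)) :
    ∃ w ∈ weyl B (Submodule.span ℤ (Set.range f)), ∀ t, w (f t) = -f (flipE6 t) := by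
  have hG : ∀ s t, B (f s) (f t) =
      if s = t then -2 else if (branchGraph 6 3).Adj s t then 1 else 0 := fun s t => by
    split_ifs with h1 h2
    · subst h1; exact hf.self _
    · exact hf.adj _ _ h2
    · exact hf.not_adj _ _ h1 h2
  have hG' : ∀ s t, B (f s) (f t) =
      (![![-2, 0, 0, 1, 0, 0], ![0, -2, 1, 0, 0, 0], ![0, 1, -2, 1, 0, 0],
      ![1, 0, 1, -2, 1, 0], ![0, 0, 0, 1, -2, 1],
        ![0, 0, 0, 0, 1, -2]] : Fin 6 → Fin 6 → ℤ) s t := by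
    intro s t
    rw [hG]
    fin_cases s <;> fin_cases t <;> decide
  set P := Submodule.span ℤ (Set.range f)
  have hP : ∀ t, f t ∈ P := fun t => Submodule.subset_span ⟨t, rfl⟩
  have h2 : f 2 + f 3 + f 4 ∈ P := add_mem (add_mem (hP _) (hP _)) (hP _)
  have h3 : f 1 + (f 2 + f 3 + f 4) + f 5 ∈ P := add_mem (add_mem (hP _) h2) (hP _)
  have h4 : (2 : ℤ) • f 0 + f 3 + (f 2 + f 3 + f 4) + (f 1 + (f 2 + f 3 + f 4) + f 5) ∈ P :=
    add_mem (add_mem (add_mem (P.smul_mem _ (hP _)) (hP _)) h2) h3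
  obtain ⟨s1, hs1, e1⟩ := exists_reflection P (hP 3) (hf.self 3)
  obtain ⟨s2, hs2, e2⟩ := exists_reflection (B := B) P h2 (by simp [hG'])
  obtain ⟨s3, hs3, e3⟩ := exists_reflection (B := B) P h3 (by simp [hG'])
  obtain ⟨s4, hs4, e4⟩ := exists_reflection (B := B) P h4 (by simp [hG'])
  refine ⟨s1 * (s2 * (s3 * s4)), mul_mem hs1 (mul_mem hs2 (mul_mem hs3 hs4)), fun t => ?_⟩
  simp only [LinearEquiv.mul_apply]
  fin_cases t <;> simp [e1, e2, e3, e4, hG', flipE6] <;> module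

theorem realizable_of_typeE6 (hB : IsNegDefEven B) (hps : IsSimpleFamily B p)
    {k : Fin 6 → ι} (hrep : Represents B (fun t => b (k t)) (branchGraph 6 3))
    (h0 : ∀ i, i ∉ Set.range k → ∀ t, B (b i) (b (k t)) = 0)
    {α : N ≃ₗ[ℤ] N} (hαi : IsIsometry B α) (e : branchGraph 6 3 ≃g branchGraph 6 3)
    (hα : ∀ t, α (b (k t)) = b (k (e t)))
    (hαp : ∀ x, p x ∉ Submodule.span ℤ (Set.range fun t => b (k t)) →
      ∃ y, p y ∉ Submodule.span ℤ (Set.range fun t => b (k t)) ∧ α (p x) = p y) :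
    Realizable B p α := by
  rcases iso_E6_apply e with he | he
  · exact realizable_of_fixes rfl (fun t => by rw [hα, he]) hαp
  · obtain ⟨w, hw, hwf⟩ := exists_weyl_neg_flipE6 hrep
    refine Realizable.of_weyl_mul (weyl_mono le_top hw) (realizable_of_neg hB hps
      (M := Submodule.span ℤ (Set.range fun t => b (k t)))
      ((isIsometry_of_mem_weyl hB hw).mul hαi) (fun z hz => ?_) fun x hx => ?_)
    · have h : Set.EqOn ((w * α : N ≃ₗ[ℤ] N) : N →ₗ[ℤ] N) (-LinearMap.id : N →ₗ[ℤ] N)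
          (Set.range fun t => b (k t)) := by
        rintro _ ⟨t, rfl⟩
        have hff : flipE6 (flipE6 t) = t := by revert t; decide
        change w (α (b (k t))) = -b (k t)
        rw [hα, he, hwf, hff]
      exact LinearMap.eqOn_span h hz
    · obtain ⟨y, hy, hxy⟩ := hαp x hx
      refine ⟨y, hy, ?_⟩
      rw [LinearEquiv.mul_apply, hxy]
      exact apply_eq_self_of_mem_weyl hw
        (((isOrthSummand_span b k h0).root_mem_or hB (hps.self y)).resolve_left hy)

end Component

/-! ### Isometries of a root lattice with at most one component that is not of type `A` -/

section MainLattice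

/-- The vertex `v` has three different neighbours. -/
def IsTrivalent {τ : Type*} (G : SimpleGraph τ) (v : τ) : Prop :=
  ∃ x y z, x ≠ y ∧ x ≠ z ∧ y ≠ z ∧ G.Adj v x ∧ G.Adj v y ∧ G.Adj v z

theorem IsTrivalent.map {τ τ' : Type*} {G : SimpleGraph τ} {G' : SimpleGraph τ'} {v : τ}
    (h : IsTrivalent G v) (f : τ → τ') (hf : Function.Injective f)
    (hadj : ∀ x y, G.Adj x y → G'.Adj (f x) (f y)) : IsTrivalent G' (f v) := by
  obtain ⟨x, y, z, h1, h2, h3, h4, h5, h6⟩ := h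
  exact ⟨f x, f y, f z, hf.ne h1, hf.ne h2, hf.ne h3, hadj _ _ h4, hadj _ _ h5, hadj _ _ h6⟩

theorem isTrivalent_branchGraph {n k : ℕ} (hk : 2 ≤ k) (hn : k + 1 < n) :
    IsTrivalent (branchGraph n k) ⟨k, by omega⟩ := by
  refine ⟨⟨0, by omega⟩, ⟨k - 1, by omega⟩, ⟨k + 1, hn⟩, ?_, ?_, ?_, ?_, ?_, ?_⟩ <;>
    first | rw [branchGraph_adj] | rw [ne_eq, Fin.ext_iff]
  all_goals first | omega | (dsimp only; omega)

theorem ConnType.exists_isTrivalent (T : ConnType) (hT : ∀ l hl, T ≠ .A l hl) :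
    ∃ v, IsTrivalent T.graph v := by
  cases T with
  | A l hl => exact absurd rfl (hT l hl)
  | D m hm => exact ⟨_, isTrivalent_branchGraph (n := m) (k := 2) le_rfl (by omega)⟩
  | E6 => exact ⟨_, isTrivalent_branchGraph (n := 6) (k := 3) (by omega) (by omega)⟩
  | E7 => exact ⟨_, isTrivalent_branchGraph (n := 7) (k := 3) (by omega) (by omega)⟩
  | E8 => exact ⟨_, isTrivalent_branchGraph (n := 8) (k := 3) (by omega) (by omega)⟩

variable {N : Type*} [AddCommGroup N] {B : BilinForm ℤ N} {V : Type*} [Finite V] {p : V → N}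
  {ι : Type*} {b : Module.Basis ι ℤ N} {G : SimpleGraph ι}

omit [Finite V] in
theorem Represents.adj_iff {f : ι → N} (h : Represents B f G) (i j : ι) :
    G.Adj i j ↔ B (f i) (f j) = 1 := by
  refine ⟨h.adj i j, fun h1 => ?_⟩
  by_contra h2
  by_cases hij : i = j
  · subst hij
    rw [h.self] at h1
    omega
  · rw [h.not_adj i j hij h2] at h1
    omega

omit [Finite V] in
theorem Represents.isSimpleFamily {f : ι → N} (h : Represents B f G)
    (hf : LinearIndependent ℤ f) : IsSimpleFamily B f where
  li := hf
  self := h.self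
  nonneg i j hij := by
    by_cases h1 : G.Adj i j
    · rw [h.adj i j h1]; omega
    · rw [h.not_adj i j hij h1]

omit [Finite V] in
/-- A labelling of a component by the vertices of the standard diagram. -/
theorem ComponentHasType.exists_labelling {c : G.ConnectedComponent} {T : ConnType}
    (h : ComponentHasType G c T) :
    ∃ k : Fin T.rank → ι, Function.Injective k ∧ Set.range k = c.supp ∧
      ∀ s t, G.Adj (k s) (k t) ↔ T.graph.Adj s t := by
  obtain ⟨φ⟩ := h
  refine ⟨fun t => (φ.symm t : ι), Subtype.val_injective.comp φ.symm.injective, ?_, fun s t => ?_⟩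
  · ext i
    constructor
    · rintro ⟨t, rfl⟩
      exact (φ.symm t).2
    · intro hi
      exact ⟨φ ⟨i, hi⟩, by simp⟩
  · exact φ.symm.map_adj_iff

omit [Finite V] in
theorem Represents.comp_labelling {f : ι → N} (h : Represents B f G) {τ : Type*}
    {H : SimpleGraph τ} {k : τ → ι} (hk : Function.Injective k)
    (hadj : ∀ s t, G.Adj (k s) (k t) ↔ H.Adj s t) : Represents B (fun t => f (k t)) H where
  self _ := h.self _
  adj s t hst := h.adj _ _ ((hadj s t).2 hst)
  not_adj s t hne hst := h.not_adj _ _ (hk.ne hne) fun h' => hst ((hadj s t).1 h')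

omit [Finite V] in
theorem Represents.eq_zero_of_component {f : ι → N} (h : Represents B f G)
    {c : G.ConnectedComponent} {i j : ι} (hi : i ∉ c.supp) (hj : j ∈ c.supp) :
    B (f i) (f j) = 0 := by
  refine h.not_adj _ _ (fun hij => hi (hij ▸ hj)) fun hadj => hi ?_
  rw [SimpleGraph.ConnectedComponent.mem_supp_iff] at hj ⊢
  rw [← hj]
  exact SimpleGraph.ConnectedComponent.sound hadj.reachable

omit [Finite V] in
theorem coordA_gram {l : ℕ} {f : Fin l → N} (hf : Represents B f (SimpleGraph.pathGraph l))
    (s t : Fin l) : B (f s) (f t) =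
      -((Pi.single s.castSucc 1 - Pi.single s.succ 1 : Fin (l + 1) → ℤ) ⬝ᵥ
        (Pi.single t.castSucc 1 - Pi.single t.succ 1)) := by
  have hrhs : -((Pi.single s.castSucc 1 - Pi.single s.succ 1 : Fin (l + 1) → ℤ) ⬝ᵥ
        (Pi.single t.castSucc 1 - Pi.single t.succ 1)) =
      if s = t then -2 else if s.val + 1 = t.val ∨ t.val + 1 = s.val then 1 else 0 := by
    simp only [sub_dotProduct, single_dotProduct, one_mul, Pi.sub_apply, Pi.single_apply,
      Fin.ext_iff, Fin.val_castSucc, Fin.val_succ]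
    split_ifs <;> omega
  rw [hrhs]
  split_ifs with h1 h2
  · subst h1; exact hf.self _
  · exact hf.adj _ _ (SimpleGraph.pathGraph_adj.2 h2)
  · exact hf.not_adj _ _ h1 fun h => h2 (SimpleGraph.pathGraph_adj.1 h)

omit [Finite V] in
/-- The members of `p` inside the span of an `A`-component generate that span: a root lattice of
type `A` has no proper root sublattice of finite index. -/
theorem mem_span_of_componentA (hB : IsNegDefEven B) (hroot : ∀ x, B (p x) (p x) = -2)
    (hp : SpansRationally p) (hrep : Represents B b G) {c : G.ConnectedComponent} {l : ℕ}
    {hl : 1 ≤ l} (hc : ComponentHasType G c (.A l hl)) {i : ι} (hi : i ∈ c.supp) :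
    b i ∈ Submodule.span ℤ
      (Set.range fun x : {x // p x ∈ Submodule.span ℤ (b '' c.supp)} => p x) := by
  obtain ⟨k, hk, hrange, hadj⟩ : ∃ k : Fin l → ι, Function.Injective k ∧
      Set.range k = c.supp ∧ ∀ s t, G.Adj (k s) (k t) ↔ (SimpleGraph.pathGraph l).Adj s t :=
    hc.exists_labelling
  have hrep' : Represents B (fun t => b (k t)) (SimpleGraph.pathGraph l) :=
    hrep.comp_labelling hk hadj
  have h0 : ∀ i, i ∉ Set.range k → ∀ t, B (b i) (b (k t)) = 0 := fun i hi t =>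
    hrep.eq_zero_of_component (c := c) (hrange ▸ hi) (hrange ▸ ⟨t, rfl⟩)
  obtain ⟨E, hEf, hE⟩ := exists_coordinates (B := B) b hk _ (coordA_gram hrep') h0
  have hM : Submodule.span ℤ (Set.range fun t => b (k t)) = Submodule.span ℤ (b '' c.supp) := by
    rw [← hrange, ← Set.range_comp]; rfl
  rw [← hrange] at hi
  obtain ⟨t, rfl⟩ := hi
  have := mem_span_of_typeA hB hroot hp (isOrthSummand_span b k h0) hE rfl hEf t
  rwa [hM] at this

/-- Isometries that permute the simple roots of a component that is not of type `A`, and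
permute the members of `p` outside that component, are realized. -/
theorem realizable_of_component (hB : IsNegDefEven B) (hps : IsSimpleFamily B p)
    (hle : ∀ x y, x ≠ y → B (p x) (p y) ≤ 1) (hp : SpansRationally p)
    {T : ConnType} (hT : ∀ l hl, T ≠ .A l hl) {k : Fin T.rank → ι} (hk : Function.Injective k)
    (hrep : Represents B (fun t => b (k t)) T.graph)
    (h0 : ∀ i, i ∉ Set.range k → ∀ t, B (b i) (b (k t)) = 0)
    {α : N ≃ₗ[ℤ] N} (hαi : IsIsometry B α) (e : T.graph ≃g T.graph)
    (hα : ∀ t, α (b (k t)) = b (k (e t)))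
    (hαp : ∀ x, p x ∉ Submodule.span ℤ (Set.range fun t => b (k t)) →
      ∃ y, p y ∉ Submodule.span ℤ (Set.range fun t => b (k t)) ∧ α (p x) = p y) :
    Realizable B p α := by
  cases T with
  | A l hl => exact absurd rfl (hT l hl)
  | D m hm => exact realizable_of_typeD hB hps hle hp hm hk hrep h0 e hα hαp
  | E6 => exact realizable_of_typeE6 hB hps hrep h0 hαi e hα hαp
  | E7 => exact realizable_of_fixes rfl (fun t => (hα t).trans
      (congrArg (fun s => b (k s)) (iso_E7_apply e t))) hαp
  | E8 => exact realizable_of_fixes rfl (fun t => (hα t).trans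
      (congrArg (fun s => b (k s)) (iso_E8_apply e t))) hαp

/-- Let a root lattice have at most one component that is not of type `A`. Then every isometry is
realized by every simple family of finite index. -/
theorem realizable_of_isIsometry [Fintype ι] (hB : IsNegDefEven B) (hps : IsSimpleFamily B p)
    (hle : ∀ x y, x ≠ y → B (p x) (p y) ≤ 1) (hp : SpansRationally p)
    (hrep : Represents B b G) (hADE : ∀ c : G.ConnectedComponent, ∃ T, ComponentHasType G c T)
    (htri : ∀ v v', IsTrivalent G v → IsTrivalent G v' → v = v')
    {α : N ≃ₗ[ℤ] N} (hα : IsIsometry B α) : Realizable B p α := by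
  have : Fintype V := Fintype.ofFinite V
  have hbs : IsSimpleFamily B b := hrep.isSimpleFamily b.linearIndependent
  have hpne : ∀ x, p x ≠ 0 := fun x h => by
    have := hps.self x
    rw [h] at this
    simp at this
  by_cases hallA : ∀ c : G.ConnectedComponent, ∃ l hl, ComponentHasType G c (.A l hl)
  · -- `p` spans the whole lattice
    have hspan : Submodule.span ℤ (Set.range p) = ⊤ := by
      rw [eq_top_iff, ← b.span_eq, Submodule.span_le]
      rintro _ ⟨i, rfl⟩
      obtain ⟨l, hl, hc⟩ := hallA (G.connectedComponentMk i)
      refine Submodule.span_mono ?_ (mem_span_of_componentA hB hps.self hp hrep hc (i := i) rfl)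
      rintro _ ⟨x, rfl⟩
      exact ⟨x, rfl⟩
    have hspan' : Submodule.span ℤ (Set.range fun x => α (p x)) =
        Submodule.span ℤ (Set.range p) := by
      have : (Set.range fun x => α (p x)) = (α : N →ₗ[ℤ] N) '' Set.range p := by
        rw [← Set.range_comp]; rfl
      rw [this, Submodule.span_image, hspan, Submodule.map_top, LinearMap.range_eq_top]
      exact α.surjective
    obtain ⟨w, hw, h⟩ := exists_weyl_map hB (hps.map hα) hps hspan'
    exact ⟨w, weyl_mono le_top hw, h⟩
  push Not at hallA
  obtain ⟨c, hcA⟩ := hallA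
  obtain ⟨T, hcT⟩ := hADE c
  have hT : ∀ l hl, T ≠ .A l hl := fun l hl h => hcA l hl (h ▸ hcT)
  obtain ⟨k, hk, hrange, hadj⟩ := hcT.exists_labelling
  have hrep' := hrep.comp_labelling hk hadj
  have h0 : ∀ i, i ∉ Set.range k → ∀ t, B (b i) (b (k t)) = 0 := fun i hi t =>
    hrep.eq_zero_of_component (c := c) (hrange ▸ hi) (hrange ▸ ⟨t, rfl⟩)
  -- the branch vertex of the component `c` is the only trivalent vertex
  obtain ⟨o, ho⟩ := T.exists_isTrivalent hT
  have hko : IsTrivalent G (k o) := ho.map k hk fun x y h => (hadj x y).2 h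
  have hkc : ∀ t, k t ∈ c.supp := fun t => hrange ▸ ⟨t, rfl⟩
  have hotherA : ∀ c' : G.ConnectedComponent, c' ≠ c →
      ∃ l hl, ComponentHasType G c' (.A l hl) := by
    intro c' hc'
    by_contra! h
    obtain ⟨T', hT'⟩ := hADE c'
    obtain ⟨o', ho'⟩ := T'.exists_isTrivalent fun l hl hh => h l hl (hh ▸ hT')
    obtain ⟨k', hk', hrange', hadj'⟩ := hT'.exists_labelling
    have h1 := htri _ _ (ho'.map k' hk' fun x y h => (hadj' x y).2 h) hko
    have h2 : k' o' ∈ c'.supp := hrange' ▸ ⟨o', rfl⟩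
    rw [h1] at h2
    exact hc' (h2.symm.trans (hkc o))
  -- up to the Weyl group `α` permutes the simple roots
  obtain ⟨w₁, hw₁, h₁⟩ := exists_weyl_map hB (hbs.map hα) hbs (by
    have : (Set.range fun i => α (b i)) = (α : N →ₗ[ℤ] N) '' Set.range b := by
      rw [← Set.range_comp]; rfl
    rw [this, Submodule.span_image, b.span_eq, Submodule.map_top, LinearMap.range_eq_top]
    exact α.surjective)
  choose e₁ he₁ using h₁
  replace hw₁ := weyl_mono le_top hw₁
  have hα₁ := (isIsometry_of_mem_weyl hB hw₁).mul hα
  set α₁ := w₁ * α with hα₁def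
  change ∀ i, α₁ (b i) = b (e₁ i) at he₁
  have he₁inj : Function.Injective e₁ := fun i j hij => by
    apply b.injective
    apply α₁.injective
    rw [he₁, he₁, hij]
  have he₁adj : ∀ i j, G.Adj (e₁ i) (e₁ j) ↔ G.Adj i j := fun i j => by
    rw [hrep.adj_iff, hrep.adj_iff, ← he₁, ← he₁, hα₁]
  let e : G ≃g G :=
    ⟨Equiv.ofBijective e₁ (Finite.injective_iff_bijective.1 he₁inj), fun {i j} => he₁adj i j⟩
  have heo : e (k o) = k o := htri _ _ (hko.map e₁ he₁inj fun x y h => (he₁adj x y).2 h) hko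
  have hec : ∀ i, e₁ i ∈ c.supp ↔ i ∈ c.supp := by
    intro i
    have h1 : ∀ i, i ∈ c.supp ↔ G.Reachable i (k o) := fun i => by
      rw [SimpleGraph.ConnectedComponent.mem_supp_iff, ← SimpleGraph.ConnectedComponent.eq,
        (hkc o : G.connectedComponentMk (k o) = c)]
    rw [h1, h1]
    have h2 := e.reachable_iff (u := i) (v := k o)
    rw [heo] at h2
    exact h2
  -- the members of `p` outside the component `c` span the sum of the other components
  set M := Submodule.span ℤ (Set.range fun t => b (k t)) with hM
  let k' : {i // i ∉ c.supp} → ι := Subtype.val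
  set M' := Submodule.span ℤ (Set.range fun t => b (k' t)) with hM'
  have hMM' : ∀ y ∈ M', ∀ z ∈ M, B y z = 0 := by
    intro y hy z hz
    induction hy using Submodule.span_induction with
    | mem y hy =>
      obtain ⟨i, rfl⟩ := hy
      induction hz using Submodule.span_induction with
      | mem z hz =>
        obtain ⟨t, rfl⟩ := hz
        exact hrep.eq_zero_of_component i.2 (hkc t)
      | zero => simp
      | add u v _ _ hu hv => rw [map_add, hu, hv, add_zero]
      | smul a u _ hu => rw [map_smul, hu, smul_zero]
    | zero => simp
    | add u v _ _ hu hv => rw [map_add, LinearMap.add_apply, hu, hv, add_zero]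
    | smul a u _ hu => rw [map_smul, LinearMap.smul_apply, hu, smul_zero]
  have hbM : ∀ i ∈ c.supp, b i ∈ M := by
    intro i hi
    rw [← hrange] at hi
    obtain ⟨t, rfl⟩ := hi
    exact Submodule.subset_span ⟨t, rfl⟩
  have hbM' : ∀ i, i ∉ c.supp → b i ∈ M' := fun i hi => Submodule.subset_span ⟨⟨i, hi⟩, rfl⟩
  have hO' : IsOrthSummand B M' := isOrthSummand_span b k' fun i hi t => by
    have hic : i ∈ c.supp := by
      by_contra h
      exact hi ⟨⟨i, h⟩, rfl⟩
    rw [hB.symm]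
    exact hrep.eq_zero_of_component t.2 hic
  have hO : IsOrthSummand B M := isOrthSummand_span b k h0
  have : Fintype {x // p x ∉ M} := Fintype.ofFinite _
  let q : {x // p x ∉ M} → N := fun x => p x
  have hqs : IsSimpleFamily B q :=
    ⟨hps.li.comp _ Subtype.val_injective, fun x => hps.self x,
      fun x y h => hps.nonneg x y fun h' => h (Subtype.ext h')⟩
  have hqspan : Submodule.span ℤ (Set.range q) = M' := by
    apply le_antisymm <;> rw [Submodule.span_le]
    · rintro _ ⟨⟨x, hx⟩, rfl⟩
      refine (hO'.root_mem_or hB (hps.self x)).resolve_right fun h => hpne x ?_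
      have h2 := (hO.root_mem_or hB (hps.self x)).resolve_left hx
      apply hB.eq_zero
      have h3 : ∀ z, B (p x) z = 0 := fun z => by
        induction b.mem_span z using Submodule.span_induction with
        | mem z hz =>
          obtain ⟨i, rfl⟩ := hz
          by_cases hi : i ∈ c.supp
          · exact h2 _ (hbM i hi)
          · exact h _ (hbM' i hi)
        | zero => simp
        | add u v _ _ hu hv => rw [map_add, hu, hv, add_zero]
        | smul a u _ hu => rw [map_smul, hu, smul_zero]
      exact h3 _
    · rintro _ ⟨⟨i, hi⟩, rfl⟩
      obtain ⟨l, hl, hc'⟩ := hotherA (G.connectedComponentMk i) hi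
      refine Submodule.span_mono ?_ (mem_span_of_componentA hB hps.self hp hrep hc' (i := i) rfl)
      rintro _ ⟨⟨x, hx⟩, rfl⟩
      refine ⟨⟨x, fun hxM => hpne x (hB.eq_zero (hMM' _ ?_ _ hxM))⟩, rfl⟩
      refine Submodule.span_mono ?_ hx
      rintro _ ⟨j, hj, rfl⟩
      refine ⟨⟨j, fun hjc => hi ?_⟩, rfl⟩
      exact (SimpleGraph.ConnectedComponent.mem_supp_iff _ _ |>.1 hj).symm.trans hjc
  have hαq : Submodule.span ℤ (Set.range fun x => α₁ (q x)) = Submodule.span ℤ (Set.range q) := by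
    have h1 : (Set.range fun x => α₁ (q x)) = (α₁ : N →ₗ[ℤ] N) '' Set.range q := by
      rw [← Set.range_comp]; rfl
    rw [h1, Submodule.span_image, hqspan, hM', ← Submodule.span_image, ← Set.range_comp]
    congr 1
    ext y
    constructor
    · rintro ⟨⟨i, hi⟩, rfl⟩
      exact ⟨⟨e₁ i, fun h => hi ((hec i).1 h)⟩, (he₁ i).symm⟩
    · rintro ⟨⟨i, hi⟩, rfl⟩
      obtain ⟨j, rfl⟩ := e.surjective i
      exact ⟨⟨j, fun h => hi ((hec j).2 h)⟩, he₁ j⟩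
  obtain ⟨w₂, hw₂, h₂⟩ := exists_weyl_map hB (hqs.map hα₁) hqs hαq
  rw [hαq, hqspan] at hw₂
  -- now `w₂ α₁` permutes the simple roots of `c` and the members of `p` outside `c`
  refine Realizable.of_weyl_mul hw₁ (Realizable.of_weyl_mul (weyl_mono le_top hw₂) ?_)
  have hmem : ∀ t, e₁ (k t) ∈ Set.range k := fun t => by
    rw [hrange]
    exact (hec _).2 (hkc t)
  choose g hg using hmem
  have hginj : Function.Injective g := fun s t hst => by
    apply hk
    apply he₁inj
    rw [← hg, ← hg, hst]
  let eT : T.graph ≃g T.graph :=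
    ⟨Equiv.ofBijective g (Finite.injective_iff_bijective.1 hginj), fun {s t} => by
      change T.graph.Adj (g s) (g t) ↔ _
      rw [← hadj, hg, hg, he₁adj, hadj]⟩
  refine realizable_of_component hB hps hle hp hT hk hrep' h0
    ((isIsometry_of_mem_weyl hB hw₂).mul hα₁) eT (fun t => ?_) fun x hx => ?_
  · rw [LinearEquiv.mul_apply, he₁]
    change w₂ (b (e₁ (k t))) = b (k (g t))
    rw [hg]
    refine apply_eq_self_of_mem_weyl hw₂ fun y hy => ?_
    rw [hB.symm]
    exact hMM' y hy _ (hbM _ ((hec _).2 (hkc t)))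
  · obtain ⟨y, hy⟩ := h₂ ⟨x, hx⟩
    exact ⟨y, y.2, hy⟩

end MainLattice

/-! ### The types of the subsets of `E₁₀` -/

section Types

theorem branchGraph_preconnected {n k : ℕ} (hk : 1 ≤ k) (hn : k < n) :
    (branchGraph n k).Preconnected := by
  have key : ∀ m, 1 ≤ m → ∀ hm : m < n,
      (branchGraph n k).Reachable ⟨m, hm⟩ ⟨1, by omega⟩ := by
    intro m hm
    induction m, hm using Nat.le_induction with
    | base => exact fun _ => SimpleGraph.Reachable.refl _
    | succ m hm ih =>
      intro hm'
      refine SimpleGraph.Reachable.trans (SimpleGraph.Adj.reachable ?_) (ih (by omega))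
      rw [branchGraph_adj]
      dsimp only
      omega
  have key' : ∀ v : Fin n, (branchGraph n k).Reachable v ⟨1, by omega⟩ := by
    intro v
    by_cases hv : v.val = 0
    · refine SimpleGraph.Reachable.trans (SimpleGraph.Adj.reachable ?_) (key k hk hn)
      rw [branchGraph_adj]
      dsimp only
      omega
    · exact key v.val (by omega) v.2
  exact fun v w => (key' v).trans (key' w).symm

theorem ConnType.graph_preconnected (T : ConnType) : T.graph.Preconnected := by
  cases T with
  | A l hl => exact SimpleGraph.pathGraph_preconnected l
  | D m hm => exact branchGraph_preconnected (n := m) (k := 2) (by omega) (by omega)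
  | E6 => exact branchGraph_preconnected (n := 6) (k := 3) (by omega) (by omega)
  | E7 => exact branchGraph_preconnected (n := 7) (k := 3) (by omega) (by omega)
  | E8 => exact branchGraph_preconnected (n := 8) (k := 3) (by omega) (by omega)

/-- A labelling of a set of vertices that is closed under adjacency exhibits the type of
the component. -/
theorem componentHasType_of_labelling {ι : Type*} {G : SimpleGraph ι} {T : ConnType}
    (f : Fin T.rank → ι) (hf : Function.Injective f)
    (hadj : ∀ s t, G.Adj (f s) (f t) ↔ T.graph.Adj s t)
    (hclosed : ∀ s j, G.Adj (f s) j → j ∈ Set.range f) (s : Fin T.rank) :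
    ComponentHasType G (G.connectedComponentMk (f s)) T := by
  let F : T.graph →g G := ⟨f, fun {a b} h => (hadj a b).2 h⟩
  have hsub : ∀ i j, G.Reachable i j → i ∈ Set.range f → j ∈ Set.range f := by
    rintro i j ⟨w⟩ hi
    induction w with
    | nil => exact hi
    | cons h _ ih =>
      obtain ⟨t, rfl⟩ := hi
      exact ih (hclosed t _ h)
  have hmem : ∀ i, i ∈ (G.connectedComponentMk (f s)).supp ↔ i ∈ Set.range f := by
    intro i
    rw [SimpleGraph.ConnectedComponent.mem_supp_iff, SimpleGraph.ConnectedComponent.eq]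
    constructor
    · exact fun h => hsub _ _ h.symm ⟨s, rfl⟩
    · rintro ⟨t, rfl⟩
      exact (T.graph_preconnected t s).map F
  let φ : Fin T.rank → (G.connectedComponentMk (f s)).supp := fun t => ⟨f t, (hmem _).2 ⟨t, rfl⟩⟩
  have hφ : Function.Bijective φ := by
    refine ⟨fun a b h => hf (congrArg Subtype.val h), ?_⟩
    rintro ⟨i, hi⟩
    obtain ⟨t, rfl⟩ := (hmem i).1 hi
    exact ⟨t, rfl⟩
  exact ⟨SimpleGraph.Iso.symm ⟨Equiv.ofBijective φ hφ, fun {a b} => hadj a b⟩⟩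

theorem restrict_E10_adj {S : Set (Fin 10)} (x y : S) :
    (E10.restrict S).diagram.Adj x y ↔ (branchGraph 10 3).Adj x y := by
  change (if (x : Fin 10) = y then (-2 : ℤ)
    else if (branchGraph 10 3).Adj x y then 1 else 0) = 1 ↔ _
  split_ifs with h1 h2
  · simp [h1]
  · simp [h2]
  · simp [h2]

theorem componentHasType_restrict {S : Set (Fin 10)} {T : ConnType} (f : Fin T.rank → Fin 10)
    (hf : Function.Injective f) (hfS : ∀ s, f s ∈ S)
    (hadj : ∀ s t, (branchGraph 10 3).Adj (f s) (f t) ↔ T.graph.Adj s t)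
    (hclosed : ∀ s, ∀ j ∈ S, (branchGraph 10 3).Adj (f s) j → ∃ t, f t = j)
    {v : Fin 10} (hv : v ∈ S) (hvf : ∃ t, f t = v) :
    ComponentHasType (E10.restrict S).diagram
      ((E10.restrict S).diagram.connectedComponentMk ⟨v, hv⟩) T := by
  obtain ⟨s, rfl⟩ := hvf
  refine componentHasType_of_labelling (G := (E10.restrict S).diagram)
    (fun t => (⟨f t, hfS t⟩ : S)) (fun a b h => hf (congrArg Subtype.val h)) (fun s t => ?_)
    (fun s j hj => ?_) s
  · rw [restrict_E10_adj, hadj]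
  · rw [restrict_E10_adj] at hj
    obtain ⟨t, ht⟩ := hclosed s j j.2 hj
    exact ⟨t, Subtype.ext ht⟩

/-- A maximal interval around `v` on which `P` holds. -/
theorem exists_maximal_interval (P : ℕ → Prop) (h0 : ¬ P 0) (h10 : ¬ P 10) {v : ℕ} (hv : P v)
    (hv10 : v < 10) : ∃ a b, a ≤ v ∧ v ≤ b ∧ 1 ≤ a ∧ b ≤ 9 ∧ (∀ i, a ≤ i → i ≤ b → P i) ∧
      ¬ P (a - 1) ∧ ¬ P (b + 1) := by
  classical
  have hb : ∃ n, v ≤ n ∧ ¬ P (n + 1) := ⟨9, by omega, h10⟩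
  have ha : ∃ n, ¬ P (v - n) := ⟨v, by simpa using h0⟩
  obtain ⟨hb1, hb2⟩ := Nat.find_spec hb
  have ha1 := Nat.find_spec ha
  have hbmin : ∀ n, n < Nat.find hb → ¬ (v ≤ n ∧ ¬ P (n + 1)) := fun n hn => Nat.find_min hb hn
  have hamin : ∀ n, n < Nat.find ha → P (v - n) := fun n hn => not_not.1 (Nat.find_min ha hn)
  have hb9 : Nat.find hb ≤ 9 := Nat.find_min' hb ⟨by omega, h10⟩
  have hav : Nat.find ha ≤ v := Nat.find_min' ha (by simpa using h0)
  set b := Nat.find hb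
  set n := Nat.find ha
  have hn1 : 1 ≤ n := by
    by_contra h
    rw [show n = 0 by omega] at ha1
    exact ha1 hv
  refine ⟨v - n + 1, b, by omega, hb1, by omega, hb9, fun i hi hib => ?_, by simpa using ha1, hb2⟩
  rcases le_total i v with h | h
  · have := hamin (v - i) (by omega)
    rwa [show v - (v - i) = i by omega] at this
  · rcases h.eq_or_lt with h | h
    · exact h ▸ hv
    · have := hbmin (i - 1) (by omega)
      rw [show i - 1 + 1 = i by omega] at this
      by_contra hP
      exact this ⟨by omega, hP⟩

/-- The component of the branch vertex in a subset that contains the short arm `0`; here `[a, b]`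
is the maximal interval of the long path that contains the branch vertex. -/
theorem exists_type_branch_component {S : Set (Fin 10)} (hS : S ∈ admissibleSubsets)
    (h0 : (0 : Fin 10) ∈ S) {a b : ℕ} (ha3 : a ≤ 3) (hb3 : 3 ≤ b) (ha1 : 1 ≤ a) (hb9 : b ≤ 9)
    (hab : ∀ i : Fin 10, a ≤ i.val → i.val ≤ b → i ∈ S)
    (ha : ∀ i : Fin 10, i.val + 1 = a → 1 ≤ i.val → i ∉ S)
    (hb : ∀ i : Fin 10, i.val = b + 1 → i ∉ S) {v : Fin 10} (hv : v ∈ S)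
    (hvab : v.val = 0 ∨ a ≤ v.val ∧ v.val ≤ b) :
    ∃ T, ComponentHasType (E10.restrict S).diagram
      ((E10.restrict S).diagram.connectedComponentMk ⟨v, hv⟩) T := by
  have main : ∀ (T : ConnType) (f : Fin T.rank → Fin 10), Function.Injective f →
      (∀ s t, (branchGraph 10 3).Adj (f s) (f t) ↔ T.graph.Adj s t) →
      (∀ j : Fin 10, (∃ t, f t = j) ↔ j.val = 0 ∨ a ≤ j.val ∧ j.val ≤ b) →
      ∃ T, ComponentHasType (E10.restrict S).diagram
        ((E10.restrict S).diagram.connectedComponentMk ⟨v, hv⟩) T := by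
    intro T f hf hadj hr
    refine ⟨T, componentHasType_restrict f hf (fun s => ?_) hadj (fun s j hj hadj' => ?_) hv
      ((hr v).2 hvab)⟩
    · rcases (hr (f s)).1 ⟨s, rfl⟩ with h | h
      · rwa [show f s = 0 from Fin.ext h]
      · exact hab _ h.1 h.2
    · rw [hr]
      have h1 := (hr (f s)).1 ⟨s, rfl⟩
      rw [branchGraph_adj] at hadj'
      have h2 : ¬ (j.val + 1 = a ∧ 1 ≤ j.val) := fun h => ha j h.1 h.2 hj
      have h3 : j.val ≠ b + 1 := fun h => hb j h hj
      omega
  obtain rfl | rfl | rfl : a = 3 ∨ a = 2 ∨ a = 1 := by omega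
  · refine main (.A (b - 1) (by omega)) (fun (s : Fin (b - 1)) => if s.val = 0 then 0 else
      ⟨s.val + 2, by omega⟩) ?_ ?_ ?_
    · intro (s : Fin (b - 1)) (t : Fin (b - 1)) h
      simp only [Fin.ext_iff] at h ⊢
      split_ifs at h <;> simp at h <;> omega
    · intro (s : Fin (b - 1)) (t : Fin (b - 1))
      refine Iff.trans ?_ SimpleGraph.pathGraph_adj.symm
      rw [branchGraph_adj]
      split_ifs <;> simp <;> omega
    · intro j
      constructor
      · rintro ⟨(s : Fin (b - 1)), rfl⟩
        split_ifs <;> simp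
        omega
      · intro h
        by_cases hj : j.val = 0
        · exact ⟨(⟨0, by omega⟩ : Fin (b - 1)), by rw [if_pos rfl]; exact Fin.ext hj.symm⟩
        · refine ⟨(⟨j.val - 2, by omega⟩ : Fin (b - 1)), ?_⟩
          rw [if_neg (by dsimp only; omega)]
          exact Fin.ext (by dsimp only; omega)
  · rcases hb3.eq_or_lt with rfl | hb4
    · exact main (.A 3 (by omega)) ![0, 3, 2]
        (by decide : Function.Injective (![0, 3, 2] : Fin 3 → Fin 10))
        (fun (s t : Fin 3) => by
          refine Iff.trans ?_ SimpleGraph.pathGraph_adj.symm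
          revert s t; decide)
        (by decide : ∀ j : Fin 10, (∃ t, (![0, 3, 2] : Fin 3 → Fin 10) t = j) ↔
            j.val = 0 ∨ 2 ≤ j.val ∧ j.val ≤ 3)
    · refine main (.D b (by omega)) (fun (s : Fin b) => if s.val = 0 then 0 else
        ⟨s.val + 1, by omega⟩) ?_ ?_ ?_
      · intro (s : Fin b) (t : Fin b) h
        simp only [Fin.ext_iff] at h ⊢
        split_ifs at h <;> simp at h <;> omega
      · intro (s : Fin b) (t : Fin b)
        refine Iff.trans ?_ (branchGraph_adj (n := b) (k := 2)).symm
        rw [branchGraph_adj]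
        split_ifs <;> simp <;> omega
      · intro j
        constructor
        · rintro ⟨(s : Fin b), rfl⟩
          split_ifs <;> simp
          omega
        · intro h
          by_cases hj : j.val = 0
          · exact ⟨(⟨0, by omega⟩ : Fin b), by rw [if_pos rfl]; exact Fin.ext hj.symm⟩
          · refine ⟨(⟨j.val - 1, by omega⟩ : Fin b), ?_⟩
            rw [if_neg (by dsimp only; omega)]
            exact Fin.ext (by dsimp only; omega)
  · have h08 : 8 ≤ b → ∀ i : Fin 10, i ≠ 9 → i ∈ S := by
      intro hb8 i hi
      by_cases h : i.val = 0
      · rwa [show i = 0 from Fin.ext h]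
      · exact hab i (by omega) (by omega)
    obtain rfl | rfl | rfl | rfl | rfl | rfl | rfl :
      b = 3 ∨ b = 4 ∨ b = 5 ∨ b = 6 ∨ b = 7 ∨ b = 8 ∨ b = 9 := by omega
    · exact main (.A 4 (by omega)) ![0, 3, 2, 1]
        (by decide : Function.Injective (![0, 3, 2, 1] : Fin 4 → Fin 10))
        (fun (s t : Fin 4) => by
          refine Iff.trans ?_ SimpleGraph.pathGraph_adj.symm
          revert s t; decide)
        (by decide : ∀ j : Fin 10, (∃ t, (![0, 3, 2, 1] : Fin 4 → Fin 10) t = j) ↔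
            j.val = 0 ∨ 1 ≤ j.val ∧ j.val ≤ 3)
    · exact main (.D 5 (by omega)) ![0, 4, 3, 2, 1]
        (by decide : Function.Injective (![0, 4, 3, 2, 1] : Fin 5 → Fin 10))
        (by decide : ∀ s t : Fin 5, (branchGraph 10 3).Adj (![0, 4, 3, 2, 1] s)
          (![0, 4, 3, 2, 1] t) ↔ (branchGraph 5 2).Adj s t)
        (by decide : ∀ j : Fin 10, (∃ t, (![0, 4, 3, 2, 1] : Fin 5 → Fin 10) t = j) ↔
            j.val = 0 ∨ 1 ≤ j.val ∧ j.val ≤ 4)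
    · exact main .E6 ![0, 1, 2, 3, 4, 5]
        (by decide : Function.Injective (![0, 1, 2, 3, 4, 5] : Fin 6 → Fin 10))
        (by decide : ∀ s t : Fin 6, (branchGraph 10 3).Adj (![0, 1, 2, 3, 4, 5] s)
          (![0, 1, 2, 3, 4, 5] t) ↔ (branchGraph 6 3).Adj s t)
        (by decide : ∀ j : Fin 10, (∃ t, (![0, 1, 2, 3, 4, 5] : Fin 6 → Fin 10) t = j) ↔
            j.val = 0 ∨ 1 ≤ j.val ∧ j.val ≤ 5)
    · exact main .E7 ![0, 1, 2, 3, 4, 5, 6]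
        (by decide : Function.Injective (![0, 1, 2, 3, 4, 5, 6] : Fin 7 → Fin 10))
        (by decide : ∀ s t : Fin 7, (branchGraph 10 3).Adj (![0, 1, 2, 3, 4, 5, 6] s)
          (![0, 1, 2, 3, 4, 5, 6] t) ↔ (branchGraph 7 3).Adj s t)
        (by decide : ∀ j : Fin 10, (∃ t, (![0, 1, 2, 3, 4, 5, 6] : Fin 7 → Fin 10) t = j) ↔
            j.val = 0 ∨ 1 ≤ j.val ∧ j.val ≤ 6)
    · exact main .E8 ![0, 1, 2, 3, 4, 5, 6, 7]
        (by decide : Function.Injective (![0, 1, 2, 3, 4, 5, 6, 7] : Fin 8 → Fin 10))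
        (by decide : ∀ s t : Fin 8, (branchGraph 10 3).Adj (![0, 1, 2, 3, 4, 5, 6, 7] s)
          (![0, 1, 2, 3, 4, 5, 6, 7] t) ↔ (branchGraph 8 3).Adj s t)
        (by decide : ∀ j : Fin 10, (∃ t, (![0, 1, 2, 3, 4, 5, 6, 7] : Fin 8 → Fin 10) t = j) ↔
            j.val = 0 ∨ 1 ≤ j.val ∧ j.val ≤ 7)
    · have hS9 : S = {i | i ≠ 9} := by
        ext i
        exact ⟨fun hi (h9 : i = 9) => hb 9 rfl (h9 ▸ hi), fun hi => h08 le_rfl i hi⟩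
      exact absurd hS9 hS.2.2
    · refine absurd (Set.eq_univ_of_forall fun i => ?_) hS.2.1
      by_cases h : i = 9
      · exact hab i (by rw [h]; decide) (by rw [h]; decide)
      · exact h08 (by omega) i h

/-- A component that contains vertex `0` and the branch vertex `3` is determined by the maximal
interval around `3` of the long path in `S`; any other component is the vertex `0` alone or a
maximal interval of the long path, of type `A`. -/
theorem isADE_restrict_E10 {S : Set (Fin 10)} (hS : S ∈ admissibleSubsets) :
    (E10.restrict S).IsADE := by
  intro c
  induction c using SimpleGraph.ConnectedComponent.ind with
  | h v =>
  obtain ⟨v, hv⟩ := v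
  let P : ℕ → Prop := fun n => 1 ≤ n ∧ ∃ h : n < 10, (⟨n, h⟩ : Fin 10) ∈ S
  have hP0 : ¬ P 0 := fun h => by have := h.1; omega
  have hP10 : ¬ P 10 := fun h => by have := h.2.1; omega
  have hPmem : ∀ i : Fin 10, 1 ≤ i.val → i ∈ S → P i.val := fun i h h' => ⟨h, i.2, h'⟩
  by_cases h30 : (0 : Fin 10) ∈ S ∧ v = 0 ∧ (3 : Fin 10) ∈ S
  · obtain ⟨a, b, h1, h2, h3, h4, h5, h6, h7⟩ :=
      exists_maximal_interval P hP0 hP10 (hPmem 3 (by decide) h30.2.2) (by decide)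
    refine exists_type_branch_component hS h30.1 h1 h2 h3 h4 (fun i hi hi' => (h5 i hi hi').2.2)
      (fun i hi hi' hiS => h6 ?_) (fun i hi hiS => h7 ?_) hv (Or.inl (by rw [h30.2.1]; rfl))
    · rw [← hi]; exact hPmem i hi' hiS
    · rw [← hi]; exact hPmem i (by omega) hiS
  by_cases hv0 : v = 0
  · have h3 : (3 : Fin 10) ∉ S := fun h => h30 ⟨hv0 ▸ hv, hv0, h⟩
    subst hv0
    refine ⟨.A 1 le_rfl, componentHasType_restrict (T := .A 1 le_rfl) (fun _ : Fin 1 => 0)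
      (fun (s t : Fin 1) _ => Subsingleton.elim s t) (fun _ => hv) (fun (s t : Fin 1) => ?_)
      (fun s j hj hadj => ?_) hv ⟨(0 : Fin 1), rfl⟩⟩
    · obtain rfl := Subsingleton.elim s t
      exact iff_of_false (SimpleGraph.irrefl _) (SimpleGraph.irrefl _)
    · rw [branchGraph_adj] at hadj
      have : j = 3 := Fin.ext (by simp at hadj ⊢; omega)
      exact absurd (this ▸ hj) h3
  · have hv1 : 1 ≤ v.val := by
      have : v.val ≠ 0 := fun h => hv0 (Fin.ext h)
      omega
    obtain ⟨a, b, h1, h2, h3, h4, h5, h6, h7⟩ :=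
      exists_maximal_interval P hP0 hP10 (hPmem v hv1 hv) v.2
    have hmem : ∀ i : Fin 10, a ≤ i.val → i.val ≤ b → i ∈ S := fun i hi hi' => (h5 i hi hi').2.2
    have hna : ∀ i : Fin 10, i.val + 1 = a → 1 ≤ i.val → i ∉ S := fun i hi hi' hiS => h6 (by
      rw [← hi]; exact hPmem i hi' hiS)
    have hnb : ∀ i : Fin 10, i.val = b + 1 → i ∉ S := fun i hi hiS => h7 (by
      rw [← hi]; exact hPmem i (by omega) hiS)
    by_cases hbr : (0 : Fin 10) ∈ S ∧ a ≤ 3 ∧ 3 ≤ b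
    · exact exists_type_branch_component hS hbr.1 hbr.2.1 hbr.2.2 h3 h4 hmem hna hnb hv
        (Or.inr ⟨h1, h2⟩)
    · refine ⟨.A (b - a + 1) (by omega), componentHasType_restrict (T := .A (b - a + 1) (by omega))
        (fun s : Fin (b - a + 1) => (⟨a + s.val, by omega⟩ : Fin 10))
        (fun (s t : Fin (b - a + 1)) h => ?_) (fun (s : Fin (b - a + 1)) => ?_)
        (fun (s t : Fin (b - a + 1)) => ?_) (fun (s : Fin (b - a + 1)) j hj hadj => ?_) hv
        ⟨(⟨v.val - a, by omega⟩ : Fin (b - a + 1)), Fin.ext (by dsimp only; omega)⟩⟩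
      · simp only [Fin.ext_iff] at h ⊢
        omega
      · exact hmem _ (by dsimp only; omega) (by dsimp only; omega)
      · refine Iff.trans ?_ SimpleGraph.pathGraph_adj.symm
        rw [branchGraph_adj]
        dsimp only
        omega
      · rw [branchGraph_adj] at hadj
        dsimp only at hadj
        have h8 : ¬ (j.val + 1 = a ∧ 1 ≤ j.val) := fun h => hna j h.1 h.2 hj
        have h9 : j.val ≠ b + 1 := fun h => hnb j h hj
        have h10 : j.val = 0 → ¬ (a ≤ 3 ∧ 3 ≤ b) := fun h h' =>
          hbr ⟨(show j = 0 from Fin.ext h) ▸ hj, h'⟩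
        refine ⟨(⟨j.val - a, by omega⟩ : Fin (b - a + 1)), Fin.ext (by dsimp only; omega)⟩

theorem eq_of_isTrivalent_restrict_E10 {S : Set (Fin 10)} {v v' : S}
    (h : IsTrivalent (E10.restrict S).diagram v) (h' : IsTrivalent (E10.restrict S).diagram v') :
    v = v' := by
  have key : ∀ v : S, IsTrivalent (E10.restrict S).diagram v → v.val.val = 3 := by
    intro v h
    obtain ⟨x, y, z, h1, h2, h3, h4, h5, h6⟩ := h.map (G' := branchGraph 10 3) Subtype.val
      Subtype.val_injective fun x y h => (restrict_E10_adj x y).1 h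
    exact eq_of_neighbors_branchGraph h4 h5 h6 h1 h2 h3
  exact Subtype.ext (Fin.ext ((key v h).trans (key v' h').symm))

/-! ### The type determines the diagram -/

/-- Graphs with componentwise isomorphic components are isomorphic. -/
theorem nonempty_iso_of_components {ι ι' : Type*} {G : SimpleGraph ι} {G' : SimpleGraph ι'}
    (E : G.ConnectedComponent ≃ G'.ConnectedComponent)
    (h : ∀ c, Nonempty (G.induce c.supp ≃g G'.induce (E c).supp)) : Nonempty (G ≃g G') := by
  have ψ : ∀ c, G.induce c.supp ≃g G'.induce (E c).supp := fun c => (h c).some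
  let F : ι → ι' := fun v => (ψ (G.connectedComponentMk v) ⟨v, rfl⟩ : ι')
  have hF : ∀ (v : ι) (c : G.ConnectedComponent) (hv : v ∈ c.supp), F v = ψ c ⟨v, hv⟩ := by
    rintro v c rfl
    rfl
  have hFc : ∀ v, G'.connectedComponentMk (F v) = E (G.connectedComponentMk v) := fun v =>
    (ψ (G.connectedComponentMk v) ⟨v, rfl⟩).2
  have hbij : Function.Bijective F := by
    constructor
    · intro v v' hvv
      have h1 : G.connectedComponentMk v = G.connectedComponentMk v' := by
        apply E.injective
        rw [← hFc, ← hFc, hvv]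
      have h2 : F v' = ψ (G.connectedComponentMk v') ⟨v', rfl⟩ := rfl
      rw [hF v _ h1, h2] at hvv
      exact congrArg Subtype.val ((ψ _).injective (Subtype.ext hvv))
    · intro w
      let c := E.symm (G'.connectedComponentMk w)
      have hw : w ∈ (E c).supp := (E.apply_symm_apply _).symm
      refine ⟨(ψ c).symm ⟨w, hw⟩, ?_⟩
      rw [hF _ c ((ψ c).symm ⟨w, hw⟩).2]
      simp
  refine ⟨⟨Equiv.ofBijective F hbij, fun {v v'} => ?_⟩⟩
  change G'.Adj (F v) (F v') ↔ G.Adj v v'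
  by_cases hvv : G.connectedComponentMk v = G.connectedComponentMk v'
  · rw [hF v _ hvv, hF v' _ rfl]
    exact (ψ (G.connectedComponentMk v')).map_adj_iff (v := ⟨v, hvv⟩) (w := ⟨v', rfl⟩)
  · refine ⟨fun h => absurd ?_ hvv, fun h => absurd ?_ hvv⟩
    · apply E.injective
      rw [← hFc, ← hFc]
      exact SimpleGraph.ConnectedComponent.sound h.reachable
    · exact SimpleGraph.ConnectedComponent.sound h.reachable

theorem ComponentHasType.nonempty_iso {ι ι' : Type*} {G : SimpleGraph ι} {G' : SimpleGraph ι'}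
    {c : G.ConnectedComponent} {c' : G'.ConnectedComponent} {T : ConnType}
    (h : ComponentHasType G c T) (h' : ComponentHasType G' c' T) :
    Nonempty (G.induce c.supp ≃g G'.induce c'.supp) := by
  obtain ⟨φ⟩ := h
  obtain ⟨φ'⟩ := h'
  exact ⟨φ.trans φ'.symm⟩

theorem ComponentHasType.congr {ι ι' : Type*} {G : SimpleGraph ι} {G' : SimpleGraph ι'}
    {c : G.ConnectedComponent} {c' : G'.ConnectedComponent} {T T' : ConnType}
    (h : ComponentHasType G c T) (h' : ComponentHasType G' c' T)
    (hT' : ComponentHasType G c T') : ComponentHasType G' c' T' := by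
  obtain ⟨φ⟩ := h'.nonempty_iso h
  obtain ⟨φ'⟩ := hT'
  exact ⟨φ.trans φ'⟩

/-- ADE-configurations of the same type have isomorphic diagrams. The components are matched by
means of the set of all their types, so that it is not necessary to know that the types have
pairwise different diagrams. -/
theorem nonempty_iso_of_adeType_eq {ι ι' : Type*} [Finite ι] [Finite ι'] {C : DynkinConfig ι}
    {C' : DynkinConfig ι'} (hC : C.IsADE) (hC' : C'.IsADE) (h : C.adeType = C'.adeType) :
    Nonempty (C.diagram ≃g C'.diagram) := by
  let ty : C.diagram.ConnectedComponent → Set ConnType :=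
    fun c => {T | ComponentHasType C.diagram c T}
  let ty' : C'.diagram.ConnectedComponent → Set ConnType :=
    fun c => {T | ComponentHasType C'.diagram c T}
  have : Finite C.diagram.ConnectedComponent := Quot.finite _
  have : Finite C'.diagram.ConnectedComponent := Quot.finite _
  have hfib : ∀ (Z : Set ConnType) (T : ConnType), T ∈ Z →
      ((∃ c, ty c = Z) ∨ ∃ c, ty' c = Z) →
      Nonempty ({c // ty c = Z} ≃ {c // ty' c = Z}) := by
    intro Z T hT hex
    have h1 : ∀ c, ty c = Z ↔ ComponentHasType C.diagram c T := by
      intro c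
      refine ⟨fun h => (h ▸ hT : T ∈ ty c), fun hc => ?_⟩
      rcases hex with ⟨c', rfl⟩ | ⟨c', rfl⟩
      · exact Set.ext fun T' => ⟨fun h => hc.congr hT h, fun h => ComponentHasType.congr hT hc h⟩
      · exact Set.ext fun T' => ⟨fun h => hc.congr hT h, fun h => ComponentHasType.congr hT hc h⟩
    have h2 : ∀ c, ty' c = Z ↔ ComponentHasType C'.diagram c T := by
      intro c
      refine ⟨fun h => (h ▸ hT : T ∈ ty' c), fun hc => ?_⟩
      rcases hex with ⟨c', rfl⟩ | ⟨c', rfl⟩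
      · exact Set.ext fun T' => ⟨fun h => hc.congr hT h, fun h => ComponentHasType.congr hT hc h⟩
      · exact Set.ext fun T' => ⟨fun h => hc.congr hT h, fun h => ComponentHasType.congr hT hc h⟩
    obtain ⟨e⟩ := Finite.card_eq.1 (congrFun h T)
    exact ⟨(Equiv.subtypeEquivRight h1).trans (e.trans (Equiv.subtypeEquivRight h2).symm)⟩
  have hfib' : ∀ Z : Set ConnType, Nonempty ({c // ty c = Z} ≃ {c // ty' c = Z}) := by
    intro Z
    by_cases hex : (∃ c, ty c = Z) ∨ ∃ c, ty' c = Z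
    · obtain ⟨T, hT⟩ : Z.Nonempty := by
        rcases hex with ⟨c, rfl⟩ | ⟨c, rfl⟩
        · exact hC c
        · exact hC' c
      exact hfib Z T hT hex
    · push Not at hex
      have : IsEmpty {c // ty c = Z} := ⟨fun c => hex.1 c c.2⟩
      have : IsEmpty {c // ty' c = Z} := ⟨fun c => hex.2 c c.2⟩
      exact ⟨Equiv.equivOfIsEmpty _ _⟩
  have e : ∀ Z, {c // ty c = Z} ≃ {c // ty' c = Z} := fun Z => (hfib' Z).some
  refine nonempty_iso_of_components (Equiv.ofFiberEquiv e) fun c => ?_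
  obtain ⟨T, hT⟩ := hC c
  have h1 : ty' (Equiv.ofFiberEquiv e c) = ty c := Equiv.ofFiberEquiv_map e c
  have h2 : T ∈ ty' (Equiv.ofFiberEquiv e c) := h1 ▸ hT
  exact hT.nonempty_iso h2

end Types

/-! ### The sublattices `⟨Σ⟩` of `L₁₀` -/

section Hyperbolic

theorem bilin_single {V : Type*} [Fintype V] [DecidableEq V] (D : DynkinConfig V) (K : Type*)
    [CommRing K] (x y : V) :
    D.bilin K (Pi.single x 1) (Pi.single y 1) = (D.form x y : K) := by
  rw [DynkinConfig.bilin, Matrix.toBilin'_single, Matrix.of_apply]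

theorem bilin_symm {V : Type*} [Fintype V] [DecidableEq V] (D : DynkinConfig V) (K : Type*)
    [CommRing K] (x y : V → K) : D.bilin K x y = D.bilin K y x := by
  rw [DynkinConfig.bilin, Matrix.toBilin'_apply, Matrix.toBilin'_apply, Finset.sum_comm]
  refine Finset.sum_congr rfl fun i _ => Finset.sum_congr rfl fun j _ => ?_
  rw [Matrix.of_apply, Matrix.of_apply, D.form_symm]
  ring

theorem bilin_intCast {V : Type*} [Fintype V] [DecidableEq V] (D : DynkinConfig V) (K : Type*)
    [CommRing K] (x y : V → ℤ) :
    D.bilin K (fun i => (x i : K)) (fun i => (y i : K)) = ((D.bilin ℤ x y : ℤ) : K) := by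
  simp [DynkinConfig.bilin, Matrix.toBilin'_apply]

theorem even_bilin_self {V : Type*} [Fintype V] [DecidableEq V] (D : DynkinConfig V)
    (x : V → ℤ) : Even (D.bilin ℤ x x) := by
  induction x using Pi.single_induction with
  | zero => simp
  | add f g hf hg =>
    have : D.bilin ℤ (f + g) (f + g) =
        D.bilin ℤ f f + D.bilin ℤ g g + (D.bilin ℤ f g + D.bilin ℤ f g) := by
      simp only [map_add, LinearMap.add_apply, bilin_symm D ℤ g f]
      ring
    rw [this]
    exact (hf.add hg).add ⟨_, rfl⟩
  | single i c =>
    have : (Pi.single i c : V → ℤ) = c • Pi.single i 1 := by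
      rw [← Pi.single_smul, smul_eq_mul, mul_one]
    rw [this, map_smul, map_smul, LinearMap.smul_apply, bilin_single, D.form_self]
    exact ⟨-(c * c), by simp; ring⟩

/-- The square-norm on `L₁₀` is negative on the hyperplane spanned by the basis vectors other than
the branch vertex, which is the lattice `A₁ + A₂ + A₆`. -/
theorem bilin_self_of_branch_eq_zero {x : L10} (h3 : x 3 = 0) :
    E10.bilin ℤ x x = -(2 * x 0 ^ 2 + (x 1 ^ 2 + (x 1 - x 2) ^ 2 + x 2 ^ 2) +
      (x 4 ^ 2 + (x 4 - x 5) ^ 2 + (x 5 - x 6) ^ 2 + (x 6 - x 7) ^ 2 + (x 7 - x 8) ^ 2 +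
        (x 8 - x 9) ^ 2 + x 9 ^ 2)) := by
  have hM : (Matrix.of fun i j => ((E10.form i j : ℤ) : ℤ)) = !![
      -2, 0, 0, 1, 0, 0, 0, 0, 0, 0;
      0, -2, 1, 0, 0, 0, 0, 0, 0, 0;
      0, 1, -2, 1, 0, 0, 0, 0, 0, 0;
      1, 0, 1, -2, 1, 0, 0, 0, 0, 0;
      0, 0, 0, 1, -2, 1, 0, 0, 0, 0;
      0, 0, 0, 0, 1, -2, 1, 0, 0, 0;
      0, 0, 0, 0, 0, 1, -2, 1, 0, 0;
      0, 0, 0, 0, 0, 0, 1, -2, 1, 0;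
      0, 0, 0, 0, 0, 0, 0, 1, -2, 1;
      0, 0, 0, 0, 0, 0, 0, 0, 1, -2] := by decide +kernel
  rw [DynkinConfig.bilin]
  erw [hM]
  rw [Matrix.toBilin'_apply']
  simp [dotProduct, Matrix.mulVec, Fin.sum_univ_succ, h3]
  ring

theorem bilin_self_neg_of_branch_eq_zero {x : L10} (h3 : x 3 = 0) (hx : x ≠ 0) :
    E10.bilin ℤ x x < 0 := by
  rw [bilin_self_of_branch_eq_zero h3]
  by_contra! h
  refine hx (funext fun i => ?_)
  have hs : 2 * x 0 ^ 2 + (x 1 ^ 2 + (x 1 - x 2) ^ 2 + x 2 ^ 2) +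
      (x 4 ^ 2 + (x 4 - x 5) ^ 2 + (x 5 - x 6) ^ 2 + (x 6 - x 7) ^ 2 + (x 7 - x 8) ^ 2 +
        (x 8 - x 9) ^ 2 + x 9 ^ 2) ≤ 0 := by omega
  have e0 := sq_nonneg (x 0)
  have e1 := sq_nonneg (x 1)
  have e2 := sq_nonneg (x 1 - x 2)
  have e3 := sq_nonneg (x 2)
  have e4 := sq_nonneg (x 4)
  have e5 := sq_nonneg (x 4 - x 5)
  have e6 := sq_nonneg (x 5 - x 6)
  have e7 := sq_nonneg (x 6 - x 7)
  have e8 := sq_nonneg (x 7 - x 8)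
  have e9 := sq_nonneg (x 8 - x 9)
  have e10 := sq_nonneg (x 9)
  have f0 : x 0 = 0 := pow_eq_zero_iff two_ne_zero |>.1 (by linarith)
  have f1 : x 1 = 0 := pow_eq_zero_iff two_ne_zero |>.1 (by linarith)
  have f2 : x 2 = 0 := pow_eq_zero_iff two_ne_zero |>.1 (by linarith)
  have f4 : x 4 = 0 := pow_eq_zero_iff two_ne_zero |>.1 (by linarith)
  have f5 : x 4 - x 5 = 0 := pow_eq_zero_iff two_ne_zero |>.1 (by linarith)
  have f6 : x 5 - x 6 = 0 := pow_eq_zero_iff two_ne_zero |>.1 (by linarith)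
  have f7 : x 6 - x 7 = 0 := pow_eq_zero_iff two_ne_zero |>.1 (by linarith)
  have f8 : x 7 - x 8 = 0 := pow_eq_zero_iff two_ne_zero |>.1 (by linarith)
  have f9 : x 9 = 0 := pow_eq_zero_iff two_ne_zero |>.1 (by linarith)
  fin_cases i <;> simp <;> omega

/-- The rows of this matrix are the dual basis `e_1^∨, …, e_10^∨`. -/
def dualBasis : Fin 10 → L10 := ![
  ![10, 7, 14, 21, 18, 15, 12, 9, 6, 3],
  ![7, 4, 9, 14, 12, 10, 8, 6, 4, 2],
  ![14, 9, 18, 28, 24, 20, 16, 12, 8, 4],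
  ![21, 14, 28, 42, 36, 30, 24, 18, 12, 6],
  ![18, 12, 24, 36, 30, 25, 20, 15, 10, 5],
  ![15, 10, 20, 30, 25, 20, 16, 12, 8, 4],
  ![12, 8, 16, 24, 20, 16, 12, 9, 6, 3],
  ![9, 6, 12, 18, 15, 12, 9, 6, 4, 2],
  ![6, 4, 8, 12, 10, 8, 6, 4, 2, 1],
  ![3, 2, 4, 6, 5, 4, 3, 2, 1, 0]]

theorem bilin_dualBasis (k : Fin 10) (x : L10) : E10.bilin ℤ (dualBasis k) x = x k := by
  have h : ∀ k i : Fin 10, ∑ j, dualBasis k j * E10.form j i = if i = k then 1 else 0 := by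
    decide +kernel
  rw [DynkinConfig.bilin, Matrix.toBilin'_apply, Finset.sum_comm]
  simp only [Matrix.of_apply, ← Finset.sum_mul, Int.cast_id, h]
  simp

/-- A vector that is orthogonal to a vector `e_k^∨` of positive square-norm has negative
square-norm: a suitable combination of the two vectors lies in the negative-definite
hyperplane of `bilin_self_of_branch_eq_zero`. -/
theorem bilin_self_neg {x : L10} {k : Fin 10} (hk : k ≠ 9) (hxk : x k = 0) (hx : x ≠ 0) :
    E10.bilin ℤ x x < 0 := by
  by_cases h3 : x 3 = 0
  · exact bilin_self_neg_of_branch_eq_zero h3 hx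
  have hkk : 0 < dualBasis k k := by
    have : ∀ k : Fin 10, k ≠ 9 → 0 < dualBasis k k := by decide
    exact this k hk
  set h := dualBasis k with hh
  set y : L10 := x 3 • h - h 3 • x with hy
  have hy3 : y 3 = 0 := by
    simp only [hy, Pi.sub_apply, Pi.smul_apply, smul_eq_mul]
    ring
  have hyle : E10.bilin ℤ y y ≤ 0 := by
    by_cases hy0 : y = 0
    · simp [hy0]
    · exact (bilin_self_neg_of_branch_eq_zero hy3 hy0).le
  have hBhx : E10.bilin ℤ h x = 0 := by rw [hh, bilin_dualBasis, hxk]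
  have hBhh : E10.bilin ℤ h h = h k := by rw [hh, bilin_dualBasis]
  simp only [hy, map_sub, map_smul, LinearMap.sub_apply, LinearMap.smul_apply, smul_eq_mul,
    hBhx, bilin_symm E10 ℤ x h, hBhh] at hyle
  by_contra! hnn
  have h1 : 0 < x 3 * x 3 := mul_self_pos.2 h3
  have h2 : 0 < x 3 * x 3 * h k := mul_pos h1 hkk
  have h4 : 0 ≤ h 3 * h 3 * E10.bilin ℤ x x := mul_nonneg (mul_self_nonneg _) hnn
  nlinarith

theorem apply_eq_zero_of_mem_gen {S : Set (Fin 10)} {x : L10} (hx : x ∈ gen S) {k : Fin 10}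
    (hk : k ∉ S) : x k = 0 := by
  induction hx using Submodule.span_induction with
  | mem x hx =>
    obtain ⟨i, hi, rfl⟩ := hx
    have : k ≠ i := fun h => hk (h ▸ hi)
    simp [this]
  | zero => rfl
  | add u v _ _ hu hv => simp [hu, hv]
  | smul c u _ hu => simp [hu]

theorem isNegDefEven_gen {S : Set (Fin 10)} (hS : S ∈ admissibleSubsets) :
    IsNegDefEven ((E10.bilin ℤ).restrict (gen S)) where
  symm x y := bilin_symm E10 ℤ x y
  even x := even_bilin_self E10 x
  neg x hx := by
    obtain ⟨k, hk, hk9⟩ : ∃ k, k ∉ S ∧ k ≠ 9 := by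
      by_contra! h
      have hsub : ∀ k, k ≠ 9 → k ∈ S := fun k hk => by
        by_contra h'
        exact hk (h k h')
      by_cases h9 : (9 : Fin 10) ∈ S
      · refine hS.2.1 (Set.eq_univ_of_forall fun k => ?_)
        by_cases hk : k = 9
        · exact hk ▸ h9
        · exact hsub k hk
      · refine hS.2.2 (Set.ext fun k => ⟨fun hk hk9 => ?_, fun hk => hsub k hk⟩)
        exact h9 (hk9 ▸ hk)
    exact bilin_self_neg hk9 (apply_eq_zero_of_mem_gen x.2 hk) fun h => hx (Subtype.ext h)

theorem single_mem_gen {S : Set (Fin 10)} (i : S) : (Pi.single (i : Fin 10) 1 : L10) ∈ gen S :=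
  Submodule.subset_span ⟨i, i.2, rfl⟩

/-- The basis of `⟨Σ⟩` that consists of the elements of `Σ`. -/
noncomputable def genBasis (S : Set (Fin 10)) : Module.Basis S ℤ (gen S) :=
  Module.Basis.mk (v := fun i : S => (⟨Pi.single (i : Fin 10) 1, single_mem_gen i⟩ : gen S))
    (LinearIndependent.of_comp (gen S).subtype
      ((Pi.linearIndependent_single_one (Fin 10) ℤ).comp Subtype.val Subtype.val_injective))
    (by
      rintro ⟨x, hx⟩ -
      have hx' := hx
      unfold gen at hx'
      induction hx' using Submodule.span_induction with
      | mem x hx' =>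
        obtain ⟨i, hi, rfl⟩ := hx'
        exact Submodule.subset_span ⟨⟨i, hi⟩, rfl⟩
      | zero => exact zero_mem _
      | add u v hu hv hu' hv' => exact add_mem (hu' hu) (hv' hv)
      | smul c u hu hu' => exact Submodule.smul_mem _ c (hu' hu))

theorem coe_genBasis (S : Set (Fin 10)) (i : S) :
    (genBasis S i : L10) = Pi.single (i : Fin 10) 1 := by
  rw [genBasis, Module.Basis.mk_apply]

theorem represents_genBasis (S : Set (Fin 10)) :
    Represents ((E10.bilin ℤ).restrict (gen S)) (genBasis S) (E10.restrict S).diagram := by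
  have h : ∀ i j, (E10.bilin ℤ).restrict (gen S) (genBasis S i) (genBasis S j) =
      (E10.restrict S).form i j := by
    intro i j
    change E10.bilin ℤ (genBasis S i) (genBasis S j) = _
    rw [coe_genBasis, coe_genBasis, bilin_single]
    rfl
  refine ⟨fun i => ?_, fun i j hij => ?_, fun i j hij hadj => ?_⟩
  · rw [h, (E10.restrict S).form_self]
  · rw [h]; exact hij
  · rw [h]; exact ((E10.restrict S).form_ne i j hij).resolve_right hadj

/-! ### Reflections of `L₁₀` -/

theorem realExt_apply_single (g : L10 →ₗ[ℤ] L10) (i : Fin 10) :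
    realExt g (Pi.single i 1) = fun j => ((g (Pi.single i 1) j : ℤ) : ℝ) := by
  funext j
  rw [realExt, Matrix.toLin'_apply, Matrix.mulVec_single_one]
  simp [LinearMap.toMatrix'_apply, Matrix.col]

/-- Reflections in roots preserve the positive cone: on the segment from `c₀` to its mirror image
the square-norm is positive. -/
theorem reflection_mem_OPlus {s : L10 ≃ₗ[ℤ] L10} {r : L10} (hr : E10.bilin ℤ r r = -2)
    (hs : ∀ x, s x = x + E10.bilin ℤ x r • r) : s ∈ OPlus := by
  have hiso : ∀ x y, E10.bilin ℤ (s x) (s y) = E10.bilin ℤ x y := by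
    intro x y
    rw [hs, hs]
    simp only [map_add, map_smul, LinearMap.add_apply, LinearMap.smul_apply, smul_eq_mul, hr,
      bilin_symm E10 ℤ r y]
    ring
  have hinv : (s : L10 →ₗ[ℤ] L10).comp (s : L10 →ₗ[ℤ] L10) = LinearMap.id := by
    refine LinearMap.ext fun x => ?_
    change s (s x) = x
    rw [hs (s x), hs x]
    simp only [map_add, map_smul, LinearMap.add_apply, LinearMap.smul_apply, smul_eq_mul, hr]
    module
  set ρ : Fin 10 → ℝ := fun i => (r i : ℝ) with hρ
  have hρρ : E10.bilin ℝ ρ ρ = -2 := by rw [hρ, bilin_intCast, hr]; norm_num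
  have hreal : ∀ v, realExt (s : L10 →ₗ[ℤ] L10) v = v + E10.bilin ℝ v ρ • ρ := by
    have : realExt (s : L10 →ₗ[ℤ] L10) =
        LinearMap.id + ((E10.bilin ℝ).flip ρ).smulRight ρ := by
      refine (Pi.basisFun ℝ (Fin 10)).ext fun i => ?_
      rw [Pi.basisFun_apply, realExt_apply_single]
      funext j
      have h1 : E10.bilin ℝ (Pi.single i 1) ρ = ((E10.bilin ℤ (Pi.single i 1) r : ℤ) : ℝ) := by
        rw [← bilin_intCast]
        congr 2
        funext j
        simp [Pi.single_apply]
      change ((s (Pi.single i 1) j : ℤ) : ℝ) =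
        (Pi.single i 1 : Fin 10 → ℝ) j + E10.bilin ℝ (Pi.single i 1) ρ * ρ j
      rw [h1, hs]
      simp [hρ, Pi.single_apply]
    intro v
    rw [this]
    rfl
  set γ : Fin 10 → ℝ := fun i => (c0 i : ℝ) with hγ
  have hγγ : 0 < E10.bilin ℝ γ γ := by
    rw [hγ, bilin_intCast]
    have h1 : ∀ x : L10, E10.bilin ℤ c0 x = ∑ i, x i := by
      intro x
      have hx : x = ∑ i, x i • (Pi.single i 1 : L10) := by
        funext j
        simp [Finset.sum_apply, Pi.single_apply]
      conv_lhs => rw [hx]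
      simp only [map_sum, map_smul, c0_mul_e, smul_eq_mul, mul_one]
    rw [h1]
    have h2 : (0 : ℤ) < ∑ i, c0 i := by decide
    exact_mod_cast h2
  set U : Set (Fin 10 → ℝ) := {x | 0 < E10.bilin ℝ x x} with hU
  have hγU : γ ∈ U := hγγ
  have hγcone : γ ∈ posCone := mem_connectedComponentIn hγU
  have hRiso : ∀ v, E10.bilin ℝ (v + E10.bilin ℝ v ρ • ρ) (v + E10.bilin ℝ v ρ • ρ) =
      E10.bilin ℝ v v := by
    intro v
    simp only [map_add, map_smul, LinearMap.add_apply, LinearMap.smul_apply, smul_eq_mul, hρρ,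
      bilin_symm E10 ℝ ρ v]
    ring
  have hsγ : realExt (s : L10 →ₗ[ℤ] L10) γ ∈ posCone := by
    have hseg : segment ℝ γ (realExt (s : L10 →ₗ[ℤ] L10) γ) ⊆ U := by
      rw [segment_eq_image']
      rintro _ ⟨t, ⟨ht0, ht1⟩, rfl⟩
      rw [hreal, add_sub_cancel_left]
      change 0 < E10.bilin ℝ _ _
      simp only [map_add, map_smul, LinearMap.add_apply, LinearMap.smul_apply, smul_eq_mul, hρρ,
        bilin_symm E10 ℝ ρ γ]
      have h1 : 0 ≤ t * (1 - t) * (E10.bilin ℝ γ ρ) ^ 2 :=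
        mul_nonneg (mul_nonneg ht0 (by linarith)) (sq_nonneg _)
      nlinarith
    exact (convex_segment _ _).isPreconnected.subset_connectedComponentIn
      (left_mem_segment ℝ _ _) hseg (right_mem_segment ℝ _ _)
  have hsub : realExt (s : L10 →ₗ[ℤ] L10) '' posCone ⊆ posCone := by
    have hpre : IsPreconnected (realExt (s : L10 →ₗ[ℤ] L10) '' posCone) :=
      isPreconnected_connectedComponentIn.image _
        (LinearMap.continuous_of_finiteDimensional _).continuousOn
    have hU' : realExt (s : L10 →ₗ[ℤ] L10) '' posCone ⊆ U := by
      rintro _ ⟨v, hv, rfl⟩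
      have hvU : v ∈ U := connectedComponentIn_subset _ _ hv
      change 0 < E10.bilin ℝ _ _
      rw [hreal, hRiso]
      exact hvU
    have := hpre.subset_connectedComponentIn ⟨γ, hγcone, rfl⟩ hU'
    rwa [← connectedComponentIn_eq hsγ] at this
  refine ⟨hiso, hsub.antisymm fun v hv => ⟨realExt (s : L10 →ₗ[ℤ] L10) v, hsub ⟨v, hv, rfl⟩, ?_⟩⟩
  rw [← LinearMap.comp_apply, ← realExt_comp, hinv, realExt_id]
  rfl

/-- Elements of the Weyl group of `⟨Σ⟩` extend to elements of the stabilizer of `⟨Σ⟩`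
in `O⁺(L₁₀)`. -/
theorem exists_stabGen_extension {S : Set (Fin 10)} {w : gen S ≃ₗ[ℤ] gen S}
    (hw : w ∈ weyl ((E10.bilin ℤ).restrict (gen S)) ⊤) :
    ∃ g ∈ stabGen S, ∀ x : gen S, g x = (w x : L10) := by
  induction hw using Subgroup.closure_induction with
  | mem w hw =>
    obtain ⟨r, -, hr, hw⟩ := hw
    have hr' : E10.bilin ℤ (r : L10) r = -2 := hr
    obtain ⟨s, -, hs⟩ := exists_reflection (B := E10.bilin ℤ) ⊤ (Submodule.mem_top (x := (r : L10)))
      hr'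
    have hle : ∀ x ∈ gen S, s x ∈ gen S := fun x hx => by
      rw [hs]
      exact add_mem hx (Submodule.smul_mem _ _ r.2)
    refine ⟨s, ⟨reflection_mem_OPlus hr' hs, ?_⟩, fun x => ?_⟩
    · refine le_antisymm ?_ fun x hx => ⟨s x, hle x hx, ?_⟩
      · rintro _ ⟨x, hx, rfl⟩
        exact hle x hx
      · change s (s x) = x
        rw [hs (s x), hs x]
        simp only [map_add, map_smul, LinearMap.add_apply, LinearMap.smul_apply, smul_eq_mul, hr']
        module
    · rw [hs, hw]
      rfl
  | one => exact ⟨1, one_mem _, fun _ => rfl⟩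
  | mul a b _ _ ha hb =>
    obtain ⟨g, hg, hga⟩ := ha
    obtain ⟨g', hg', hgb⟩ := hb
    refine ⟨g * g', mul_mem hg hg', fun x => ?_⟩
    rw [LinearEquiv.mul_apply, hgb, hga]
    rfl
  | inv a _ ha =>
    obtain ⟨g, hg, hga⟩ := ha
    refine ⟨g⁻¹, inv_mem hg, fun x => ?_⟩
    apply g.injective
    rw [hga, show g (g⁻¹ (x : L10)) = x from g.apply_symm_apply _,
      show a (a⁻¹ x) = x from a.apply_symm_apply x]

end Hyperbolic

/-! ### The double coset space -/

section Main

variable {V : Type*} [Fintype V] [DecidableEq V]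

theorem exists_smul_eq_sum_single (z : V → ℚ) :
    ∃ k : ℤ, k ≠ 0 ∧ ∃ n : V → ℤ, k • z = ∑ x, n x • (Pi.single x 1 : V → ℚ) := by
  obtain ⟨k, hk⟩ := IsLocalization.exist_integer_multiples_of_finite (nonZeroDivisors ℤ) z
  choose n hn using hk
  refine ⟨k, nonZeroDivisors.ne_zero k.2, n, funext fun x => ?_⟩
  have := hn x
  simp only [Finset.sum_apply, Pi.smul_apply, Pi.single_apply]
  simp only [eq_intCast, zsmul_eq_mul] at this
  simp [this]

/-- Two isometries from `M` onto `⟨Σ⟩` lie in the same double coset: the isometry of `⟨Σ⟩` in which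
they differ is realized by the image of `Φ`. -/
theorem sameDoubleCoset {D : DynkinConfig V} {M : Submodule ℤ (V → ℚ)} {S : Set (Fin 10)}
    (hpair : D.IsAdmissiblePair M S) (φ ψ : D.Isom M S) : D.SameDoubleCoset M S φ ψ := by
  have hB := isNegDefEven_gen hpair.mem
  set B := (E10.bilin ℤ).restrict (gen S) with hBdef
  have hsingle : ∀ x : V, (Pi.single x 1 : V → ℚ) ∈ M := fun x =>
    hpair.overlattice.le (Submodule.subset_span ⟨x, rfl⟩)
  let e : V → M := fun x => ⟨Pi.single x 1, hsingle x⟩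
  have he : ∀ z : M, ∃ k : ℤ, k ≠ 0 ∧ ∃ n : V → ℤ, k • z = ∑ x, n x • e x := by
    intro z
    obtain ⟨k, hk, n, hn⟩ := exists_smul_eq_sum_single (z : V → ℚ)
    refine ⟨k, hk, n, Subtype.ext ?_⟩
    rw [Submodule.coe_smul, hn, Submodule.coe_sum]
    rfl
  have heinj : Function.Injective e := fun x y h => by
    have h1 := congrArg (fun z : M => (z : V → ℚ) x) h
    by_contra hxy
    simp [e, hxy] at h1
  have hiso : ∀ (χ : D.Isom M S) (x y : V), B (χ.1 (e x)) (χ.1 (e y)) = D.form x y := by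
    intro χ x y
    have h1 := χ.2 (e x) (e y)
    rw [show D.bilin ℚ (e x) (e y) = (D.form x y : ℚ) from bilin_single D ℚ x y] at h1
    exact_mod_cast h1
  let p : V → gen S := fun x => φ.1 (e x)
  have hps : IsSimpleFamily B p := by
    refine ⟨?_, fun x => ?_, fun x y hxy => ?_⟩
    · have h1 : LinearIndependent ℤ e := by
        refine LinearIndependent.of_comp M.subtype ?_
        exact (Pi.linearIndependent_single_one V ℚ).restrict_scalars' ℤ
      exact h1.map' (φ.1 : M →ₗ[ℤ] gen S) (LinearMap.ker_eq_bot.2 φ.1.injective)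
    · rw [hiso, D.form_self]
    · rw [hiso]
      rcases D.form_ne x y hxy with h | h <;> norm_num [h]
  have hle : ∀ x y, x ≠ y → B (p x) (p y) ≤ 1 := fun x y hxy => by
    rw [hiso]
    rcases D.form_ne x y hxy with h | h <;> rw [h]
    norm_num
  have hp : SpansRationally p := by
    intro y
    obtain ⟨k, hk, n, hn⟩ := he (φ.1.symm y)
    refine ⟨k, hk, ?_⟩
    have h1 : k • y = ∑ x, n x • p x := by
      have := congrArg φ.1 hn
      rwa [map_smul, LinearEquiv.apply_symm_apply, map_sum, Finset.sum_congr rfl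
        fun x _ => map_smul φ.1 (n x) (e x)] at this
    rw [h1]
    exact Submodule.sum_mem _ fun x _ => Submodule.smul_mem _ _ (Submodule.subset_span ⟨x, rfl⟩)
  -- the isometry `ψ ∘ φ⁻¹` of `⟨Σ⟩`
  let α : gen S ≃ₗ[ℤ] gen S := φ.1.symm.trans ψ.1
  have hα : IsIsometry B α := by
    intro x y
    have h1 := ψ.2 (φ.1.symm x) (φ.1.symm y)
    have h2 := φ.2 (φ.1.symm x) (φ.1.symm y)
    rw [LinearEquiv.apply_symm_apply, LinearEquiv.apply_symm_apply] at h2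
    rw [← h2] at h1
    exact_mod_cast h1
  have : Fintype S := Fintype.ofFinite S
  obtain ⟨w, hw, hwp⟩ := realizable_of_isIsometry hB hps hle hp (represents_genBasis S)
    (isADE_restrict_E10 hpair.mem) (fun _ _ => eq_of_isTrivalent_restrict_E10) hα
  choose τ hτ using hwp
  have hτ' : ∀ x, w (ψ.1 (e x)) = φ.1 (e (τ x)) := fun x => by
    have := hτ x
    simp only [α, p, LinearEquiv.trans_apply, LinearEquiv.symm_apply_apply] at this
    exact this
  have hτinj : Function.Injective τ := fun x y h => by
    apply heinj
    apply ψ.1.injective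
    apply w.injective
    rw [hτ', hτ', h]
  let γ : Equiv.Perm V := Equiv.ofBijective τ (Finite.injective_iff_bijective.1 hτinj)
  have hwi := isIsometry_of_mem_weyl hB hw
  -- on `M` the permutation `γ` acts as `φ⁻¹ w ψ`
  let θ : M ≃ₗ[ℤ] M := ψ.1.trans (w.trans φ.1.symm)
  have hθ : ∀ z : M, permMap γ (z : V → ℚ) = θ z := by
    intro z
    have h1 : ∀ x, permMap γ (e x : V → ℚ) = θ (e x) := fun x => by
      rw [show (e x : V → ℚ) = Pi.single x 1 from rfl, permMap_single]
      simp only [θ, LinearEquiv.trans_apply, hτ', LinearEquiv.symm_apply_apply]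
      rfl
    obtain ⟨k, hk, n, hn⟩ := he z
    have h2 : k • permMap γ (z : V → ℚ) = k • (θ z : V → ℚ) := by
      rw [← map_smul, ← Submodule.coe_smul, ← Submodule.coe_smul, ← map_smul, hn, map_sum,
        Submodule.coe_sum, Submodule.coe_sum, map_sum]
      refine Finset.sum_congr rfl fun x _ => ?_
      rw [Submodule.coe_smul, map_smul, map_smul, Submodule.coe_smul, h1]
    exact smul_right_injective _ hk h2
  obtain ⟨g, hg, hgw⟩ := exists_stabGen_extension (inv_mem hw)
  refine ⟨γ, ⟨fun x y => ?_, ?_⟩, g, hg, fun x y hxy => ?_⟩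
  · rw [← hiso φ, ← hiso ψ]
    change B (φ.1 (e (τ x))) (φ.1 (e (τ y))) = _
    rw [← hτ', ← hτ', hwi]
  · refine le_antisymm ?_ fun y hy => ⟨θ.symm ⟨y, hy⟩, (θ.symm ⟨y, hy⟩).2, ?_⟩
    · rintro _ ⟨x, hx, rfl⟩
      exact (hθ ⟨x, hx⟩) ▸ (θ ⟨x, hx⟩).2
    · change permMap γ _ = _
      rw [hθ, LinearEquiv.apply_symm_apply]
  · have h1 : y = θ x := Subtype.ext (by rw [hxy, hθ])
    rw [hgw, h1]
    simp only [θ, LinearEquiv.trans_apply, LinearEquiv.apply_symm_apply]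
    rw [show w⁻¹ (w (ψ.1 x)) = ψ.1 x from w.symm_apply_apply _]

theorem nonempty_isom {D : DynkinConfig V} {M : Submodule ℤ (V → ℚ)} {S : Set (Fin 10)}
    (hS : S ∈ admissibleSubsets) (htype : D.OverlatticeHasType M (E10.restrict S).adeType) :
    Nonempty (D.Isom M S) := by
  obtain ⟨n, b, C, hli, hspan, hform, hC, htype⟩ := htype
  obtain ⟨e⟩ := nonempty_iso_of_adeType_eq hC (isADE_restrict_E10 hS) htype
  subst hspan
  let b' := Module.Basis.span hli
  have hb' : ∀ i, (b' i : V → ℚ) = b i := fun i => by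
    simp only [b', Module.Basis.span_apply]
  let φ := b'.equiv (genBasis S) e.toEquiv
  have hφ : ∀ i, φ (b' i) = genBasis S (e i) := fun i => Module.Basis.equiv_apply _ _ _ _
  have hee : ∀ i j, E10.form (e i) (e j) = C.form i j := by
    intro i j
    by_cases hij : i = j
    · rw [hij, C.form_self, E10.form_self]
    · have hadj : (E10.restrict S).diagram.Adj (e i) (e j) ↔ C.diagram.Adj i j := e.map_adj_iff
      have h1 : E10.form (e i) (e j) = 1 ↔ C.form i j = 1 := hadj
      have h2 := E10.form_ne (e i) (e j) fun h => hij (e.injective (Subtype.ext h))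
      have h3 := C.form_ne i j hij
      omega
  refine ⟨⟨φ, fun x y => ?_⟩⟩
  induction b'.mem_span x using Submodule.span_induction with
  | mem x hx =>
    obtain ⟨i, rfl⟩ := hx
    induction b'.mem_span y using Submodule.span_induction with
    | mem y hy =>
      obtain ⟨j, rfl⟩ := hy
      rw [hφ, hφ, coe_genBasis, coe_genBasis, bilin_single, hb', hb', hform, Int.cast_id, hee]
    | zero => simp
    | add u v _ _ hu hv => simp only [map_add, Submodule.coe_add, Int.cast_add, hu, hv]
    | smul c u _ hu =>
      rw [map_smul, Submodule.coe_smul, Submodule.coe_smul, map_smul, map_zsmul, ← hu, smul_eq_mul,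
        Int.cast_mul, zsmul_eq_mul]
  | zero => simp
  | add u v _ _ hu hv =>
    simp only [map_add, Submodule.coe_add, Int.cast_add, hu, hv, LinearMap.add_apply]
  | smul c u _ hu =>
    rw [map_smul, Submodule.coe_smul, Submodule.coe_smul, map_smul, map_zsmul, LinearMap.smul_apply,
      LinearMap.smul_apply, ← hu, smul_eq_mul, Int.cast_mul, zsmul_eq_mul]

end Main

end EnriquesADE

theorem mainTheorem10 {V : Type*} [Fintype V] [DecidableEq V]
    (Φ : EnriquesADE.DynkinConfig V) (hΦ : Φ.IsADE) (hcard : Fintype.card V < 10)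
    (R : Submodule ℤ (V → ℚ)) (S : Set (Fin 10)) (hpair : Φ.IsAdmissiblePair R S) :
    Nat.card (Φ.Emb R S) = 1 := by
  rw [Nat.card_eq_one_iff_unique]
  constructor
  · constructor
    rintro ⟨φ⟩ ⟨ψ⟩
    exact Quotient.sound (EnriquesADE.sameDoubleCoset hpair φ ψ)
  · obtain ⟨φ⟩ := EnriquesADE.nonempty_isom hpair.mem hpair.type_eq
    exact ⟨Quotient.mk _ φ⟩
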